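/- Let $V$ be a complex vector space of dimension $7$ with basis $x_1,\dots,x_7$. For $\omega\in\bigwedge^4V$ let $$Y_\omega=\{[v_1\wedge v_2]\in G(2,V)\subset\mathbb P(\textstyle\bigwedge^2V)\ :\ v_1\wedge v_2\wedge\omega=0\in\bigwedge^6V\}$$ with its reduced structure; regarding $V$ as the dual of a seven-dimensional space and $\omega$ as a four-form on that space, $Y_\omega$ is the variety of five-spaces isotropic for $\omega$. Call $\omega$ non-degenerate if it lies in the open orbit of $GL(V)$ on $\bigwedge^4V$. For $t\in\mathbb C$ put $$\omega_t=x_1\wedge x_2\wedge x_3\wedge x_7+x_4\wedge x_5\wedge x_6\wedge x_7+x_2\wedge x_3\wedge x_5\wedge x_6+x_1\wedge x_3\wedge x_4\wedge x_6+t\,x_1\wedge x_2\wedge x_4\wedge x_5 ,$$ and let $\hat G_2=Y_{\omega_0}$. Let $\mathcal X\subset\mathbb P(\bigwedge^2V)\times\mathbb A^1$ be the closed subscheme defined by the equations $p\wedge p=0$ and $p\wedge\omega_t=0$, where $p\in\bigwedge^2V$ and $t$ is the coordinate on $\mathbb A^1=\operatorname{Spec}\mathbb C[t]$, and let $\pi:\mathcal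 X\to\mathbb A^1$ be the projection. Then $\hat G_2$ is a flat degeneration (flat deformation) of the adjoint variety $G_2$ of the complex simple Lie group $\mathbb G_2$, through the family $\pi$. Precisely: 1. $\pi$ is flat and proper. 2. For every $t\in\mathbb C$ the scheme-theoretic fibre $\mathcal X_t$ is isomorphic over $\mathbb C$ to $Y_{\omega_t}$; indeed the equations $p\wedge p=0$, $p\wedge\omega_t=0$ generate the full homogeneous ideal of $Y_{\omega_t}$. In particular $\mathcal X_0\cong\hat G_2$. 3. For $t\ne0$ the form $\omega_t$ is non-degenerate, and for every non-degenerate $\omega$ and every $t\neq 0$ the fibre $\mathcal X_t$ is isomorphic over $\mathbb C$ to $Y_\omega$ and to the adjoint variety of $\mathbb G_2$. Here $\mathbb G_2$ is the stabilizer of $\omega$ in $SL(V)$, and its adjoint variety is the closed orbit of $\mathbb G_2$ on the projective space $\mathbb P(\mathfrak g_2)$ of its adjoint representation. 4. All the varieties $Y_{\omega_t}$, $t\in\mathbb C$, have the same Hilbert polynomial in $\mathbb P(\bigwedge^2V)$. -/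

import Mathlib

open CategoryTheory AlgebraicGeometry

attribute [local instance] MvPolynomial.gradedAlgebra

noncomputable section

/-! ### Closed subschemes of projective space given by homogeneous ideals -/

section Quotient

variable {R A : Type} [CommRing R] [CommRing A] [Algebra R A] {𝒜 : ℕ → Submodule R A}
  [GradedAlgebra 𝒜]

/-- The grading induced on the quotient of a graded algebra by a homogeneous ideal. -/
def quotientGrading (I : HomogeneousIdeal 𝒜) (n : ℕ) : Submodule R (A ⧸ I.toIdeal) :=
  (𝒜 n).map (Ideal.Quotient.mkₐ R I.toIdeal).toLinearMap

theorem mk_mem_quotientGrading (I : HomogeneousIdeal 𝒜) {n : ℕ} {a : A} (ha : a ∈ 𝒜 n) :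
    Ideal.Quotient.mk I.toIdeal a ∈ quotientGrading I n :=
  ⟨a, ha, rfl⟩

instance quotientGradedMonoid (I : HomogeneousIdeal 𝒜) :
    SetLike.GradedMonoid (quotientGrading I) where
  one_mem := by
    have h := mk_mem_quotientGrading I (SetLike.GradedOne.one_mem (A := 𝒜))
    rwa [map_one] at h
  mul_mem := by
    rintro i j _ _ ⟨a, ha, rfl⟩ ⟨b, hb, rfl⟩
    have h := mk_mem_quotientGrading I (SetLike.GradedMul.mul_mem (A := 𝒜) ha hb)
    rw [map_mul] at h
    exact h

/-- The projection of a homogeneous component to the quotient. -/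
def quotientComponent (I : HomogeneousIdeal 𝒜) (n : ℕ) : 𝒜 n →ₗ[R] quotientGrading I n :=
  ((Ideal.Quotient.mkₐ R I.toIdeal).toLinearMap.comp (𝒜 n).subtype).codRestrict _
    fun a => ⟨a, a.2, rfl⟩

/-- Decomposition into homogeneous components, followed by projection to the quotient. -/
def quotientDecomposeAux (I : HomogeneousIdeal 𝒜) :
    A →ₗ[R] DirectSum ℕ fun n => quotientGrading I n :=
  (DirectSum.lmap (quotientComponent I)).comp (DirectSum.decomposeLinearEquiv 𝒜).toLinearMap

theorem quotientDecomposeAux_eq_zero (I : HomogeneousIdeal 𝒜) (a : A) (ha : a ∈ I.toIdeal) :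
    quotientDecomposeAux I a = 0 := by
  ext n
  have h : (DirectSum.decompose 𝒜 a n : A) ∈ I.toIdeal := I.isHomogeneous n ha
  simp only [quotientDecomposeAux, LinearMap.comp_apply, LinearEquiv.coe_coe,
    DirectSum.decomposeLinearEquiv_apply, DirectSum.lmap_apply, DirectSum.zero_apply]
  exact Ideal.Quotient.eq_zero_iff_mem.mpr h

theorem quotientDecomposeAux_of_mem (I : HomogeneousIdeal 𝒜) {n : ℕ} {a : A} (ha : a ∈ 𝒜 n) :
    quotientDecomposeAux I a =
      DirectSum.of (fun n => quotientGrading I n) n ⟨_, mk_mem_quotientGrading I ha⟩ := by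
  simp only [quotientDecomposeAux, LinearMap.comp_apply, LinearEquiv.coe_coe,
    DirectSum.decomposeLinearEquiv_apply, DirectSum.decompose_of_mem 𝒜 ha]
  exact DirectSum.lmap_lof (quotientComponent I) n ⟨a, ha⟩

theorem quotientDecomposeAux_congr (I : HomogeneousIdeal 𝒜) {a b : A}
    (h : Ideal.Quotient.mk I.toIdeal a = Ideal.Quotient.mk I.toIdeal b) :
    quotientDecomposeAux I a = quotientDecomposeAux I b := by
  have h1 := quotientDecomposeAux_eq_zero I (a - b) (Ideal.Quotient.eq.mp h)
  have h2 := (quotientDecomposeAux I).map_add (a - b) b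
  rwa [sub_add_cancel, h1, zero_add] at h2

/-- The decomposition of an element of the quotient into homogeneous components. -/
def quotientDecompose (I : HomogeneousIdeal 𝒜) :
    (A ⧸ I.toIdeal) →ₗ[R] DirectSum ℕ fun n => quotientGrading I n where
  toFun x := quotientDecomposeAux I (Function.surjInv Ideal.Quotient.mk_surjective x)
  map_add' x y := by
    rw [← map_add]
    apply quotientDecomposeAux_congr
    simp only [map_add, Function.surjInv_eq]
  map_smul' r x := by
    rw [RingHom.id_apply, ← map_smul]
    apply quotientDecomposeAux_congr
    refine (Function.surjInv_eq Ideal.Quotient.mk_surjective _).trans ?_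
    exact congrArg (r • ·) (Function.surjInv_eq Ideal.Quotient.mk_surjective x).symm

theorem quotientDecompose_mk (I : HomogeneousIdeal 𝒜) (a : A) :
    quotientDecompose I (Ideal.Quotient.mk I.toIdeal a) = quotientDecomposeAux I a :=
  quotientDecomposeAux_congr I (Function.surjInv_eq _ _)

theorem quotientDecompose_left (I : HomogeneousIdeal 𝒜) (a : A) :
    DirectSum.coeAddMonoidHom (quotientGrading I) (quotientDecomposeAux I a) =
      Ideal.Quotient.mk I.toIdeal a := by
  induction a using DirectSum.Decomposition.inductionOn 𝒜 with
  | zero => rw [map_zero, map_zero, map_zero]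
  | homogeneous a => rw [quotientDecomposeAux_of_mem I a.2, DirectSum.coeAddMonoidHom_of]
  | add a b ha hb => rw [map_add, map_add, map_add, ha, hb]

theorem quotientDecompose_right (I : HomogeneousIdeal 𝒜)
    (x : DirectSum ℕ fun n => quotientGrading I n) :
    quotientDecompose I (DirectSum.coeAddMonoidHom (quotientGrading I) x) = x := by
  induction x using DirectSum.induction_on with
  | zero => rw [map_zero, map_zero]
  | of n x =>
    obtain ⟨_, a, ha, rfl⟩ := x
    rw [DirectSum.coeAddMonoidHom_of]
    exact (quotientDecompose_mk I a).trans (quotientDecomposeAux_of_mem I ha)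
  | add x y hx hy => rw [map_add, map_add, hx, hy]

/-- The quotient of a graded algebra by a homogeneous ideal is graded. -/
instance quotientGradedAlgebra (I : HomogeneousIdeal 𝒜) : GradedAlgebra (quotientGrading I) where
  decompose' := quotientDecompose I
  left_inv x := by
    obtain ⟨a, rfl⟩ := Ideal.Quotient.mk_surjective x
    rw [quotientDecompose_mk, quotientDecompose_left]
  right_inv x := quotientDecompose_right I x

end Quotient

section ProjectiveScheme

variable {R σ : Type} [CommRing R]

/-- The closed subscheme of the projective space over `R` with homogeneous coordinates indexed by
`σ` that is defined by a homogeneous ideal `I`, that is `Proj (R[X_σ] / I)`. -/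
def projScheme (I : HomogeneousIdeal (MvPolynomial.homogeneousSubmodule σ R)) : Scheme.{0} :=
  Proj (quotientGrading I)

/-- The structure morphism `Proj (R[X_σ] / I) ⟶ Spec R`. -/
def projSchemeHom (I : HomogeneousIdeal (MvPolynomial.homogeneousSubmodule σ R)) :
    projScheme I ⟶ Spec (CommRingCat.of R) :=
  Proj.toSpecZero (quotientGrading I) ≫
    Spec.map (CommRingCat.ofHom (algebraMap R (quotientGrading I 0)))

/-- The homogeneous ideal of all polynomials vanishing on the affine cone `C`, so that
`projScheme (coneIdeal C)` is the projective variety (with its reduced structure) whose affine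
cone is `C`. -/
def coneIdeal (C : Set (σ → ℂ)) : HomogeneousIdeal (MvPolynomial.homogeneousSubmodule σ ℂ) :=
  (MvPolynomial.vanishingIdeal ℂ C).homogeneousCore _

/-- `P` is the Hilbert polynomial of the projective scheme defined by `I`. -/
def IsHilbertPolynomial (I : HomogeneousIdeal (MvPolynomial.homogeneousSubmodule σ ℂ))
    (P : Polynomial ℚ) : Prop :=
  ∀ᶠ n : ℕ in Filter.atTop, (Module.finrank ℂ (quotientGrading I n) : ℚ) = P.eval (n : ℚ)

/-- Zariski closed subsets of a complex vector space: common zeros of polynomials in linear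
functionals. -/
def IsZariskiClosed {W : Type} [AddCommGroup W] [Module ℂ W] (Z : Set W) : Prop :=
  ∃ S : Set (MvPolynomial (Module.Dual ℂ W) ℂ),
    Z = {w | ∀ f ∈ S, MvPolynomial.eval (fun l : Module.Dual ℂ W => l w) f = 0}

end ProjectiveScheme

/-! ### Four-forms on a seven-dimensional space -/

/-- The seven-dimensional vector space `V`. -/
abbrev V7 : Type := Fin 7 → ℂ

/-- Elements of `⋀⁴ V`. -/
abbrev FourForm : Type := ⋀[ℂ]^4 V7

/-- The decomposable form `x_i ∧ x_j ∧ x_k ∧ x_l` (indices starting from `0`). -/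
def decomposableForm (i j k l : Fin 7) : FourForm :=
  exteriorPower.ιMulti ℂ 4
    ![Pi.single i (1 : ℂ), Pi.single j (1 : ℂ), Pi.single k (1 : ℂ), Pi.single l (1 : ℂ)]

/-- With `x₁, …, x₇` the standard basis, the form
`ω_t = x₁∧x₂∧x₃∧x₇ + x₄∧x₅∧x₆∧x₇ + x₂∧x₃∧x₅∧x₆ + x₁∧x₃∧x₄∧x₆ + t x₁∧x₂∧x₄∧x₅`. -/
def omegaForm (t : ℂ) : FourForm :=
  decomposableForm 0 1 2 6 + decomposableForm 3 4 5 6 + decomposableForm 1 2 4 5 +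
    decomposableForm 0 2 3 5 + t • decomposableForm 0 1 3 4

/-- A four-form is nondegenerate if it lies in the open orbit of `GL(V)` on `⋀⁴ V`, i.e. if its
own orbit is Zariski open. -/
def FourForm.IsNondegenerate (ω : FourForm) : Prop :=
  IsZariskiClosed {η : FourForm | ∃ g : V7 ≃ₗ[ℂ] V7, η = exteriorPower.map 4 g.toLinearMap ω}ᶜ

/-- Index set of the 21 Plücker coordinates `p_ij`, `i < j`, on `⋀² V`. -/
abbrev PluckerIndex : Type := {a : Fin 7 × Fin 7 // a.1 < a.2}

/-- The affine cone, in the Plücker coordinates of `⋀² V`, over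
`{[v ∧ w] ∈ G(2, V) | v ∧ w ∧ ω = 0 in ⋀⁶ V}`. Viewing `V` as the dual of a space `U`, the line
`[v ∧ w]` is the five-space `{v = w = 0}` of `U`, and the condition says that it is isotropic for
the four-form `ω` on `U`. -/
def isotropicCone (ω : FourForm) : Set (PluckerIndex → ℂ) :=
  {p | ∃ v w : V7,
    ExteriorAlgebra.ι ℂ v * ExteriorAlgebra.ι ℂ w * (ω : ExteriorAlgebra ℂ V7) = 0 ∧
      ∀ a : PluckerIndex, p a = v a.1.1 * w a.1.2 - v a.1.2 * w a.1.1}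

/-- The homogeneous ideal of the variety of isotropic five-spaces of `ω` in `P(⋀² V)`. -/
def isotropicIdeal (ω : FourForm) :
    HomogeneousIdeal (MvPolynomial.homogeneousSubmodule PluckerIndex ℂ) :=
  coneIdeal (isotropicCone ω)

/-- The variety `Ĝ₂` of isotropic five-spaces of the degenerate form `ω₀`, with its structure
morphism `GHatHom` to `Spec ℂ`. -/
def GHat : Scheme.{0} := projScheme (isotropicIdeal (omegaForm 0))

def GHatHom : GHat ⟶ Spec (CommRingCat.of ℂ) := projSchemeHom (isotropicIdeal (omegaForm 0))

/-! ### The family of isotropic varieties of the forms `ω_t` -/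

section Family

variable (R : Type) [CommRing R]

/-- The entries `p_ij` of the generic skew-symmetric `7 × 7` matrix. -/
def genericEntry (i j : Fin 7) : MvPolynomial PluckerIndex R :=
  if h : i < j then MvPolynomial.X ⟨(i, j), h⟩
  else if h : j < i then -MvPolynomial.X ⟨(j, i), h⟩ else 0

/-- The `4 × 4` Pfaffians of the generic skew-symmetric matrix: the Plücker relations `p ∧ p = 0`
of the Grassmannian. -/
def pluckerRelations : Set (MvPolynomial PluckerIndex R) :=
  {f | ∃ i j k l : Fin 7, f = genericEntry R i j * genericEntry R k l -
    genericEntry R i k * genericEntry R j l + genericEntry R i l * genericEntry R j k}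

variable {R}

/-- The seven coordinates of `p ∧ ω_s` in `⋀⁶ V`, for a parameter `s` in the base ring. -/
def isotropyEquations (s : R) : Set (MvPolynomial PluckerIndex R) :=
  let p := genericEntry R
  let c : MvPolynomial PluckerIndex R := MvPolynomial.C s
  {p 1 2 + p 3 6, p 0 2 - p 4 6, p 0 1 + c * p 5 6, p 4 5 + p 0 6, p 3 5 - p 1 6,
    p 3 4 + c * p 2 6, p 0 3 + p 1 4 + c * p 2 5}

theorem genericEntry_mem (i j : Fin 7) :
    genericEntry R i j ∈ MvPolynomial.homogeneousSubmodule PluckerIndex R 1 := by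
  unfold genericEntry
  split_ifs
  · exact MvPolynomial.isHomogeneous_X R _
  · exact Submodule.neg_mem _ (MvPolynomial.isHomogeneous_X R _)
  · exact Submodule.zero_mem _

theorem equations_homogeneous (s : R) (f : MvPolynomial PluckerIndex R)
    (hf : f ∈ pluckerRelations R ∪ isotropyEquations s) :
    SetLike.IsHomogeneousElem (MvPolynomial.homogeneousSubmodule PluckerIndex R) f := by
  rcases hf with ⟨i, j, k, l, rfl⟩ | hf
  · have h (a b c d : Fin 7) : genericEntry R a b * genericEntry R c d ∈
        MvPolynomial.homogeneousSubmodule PluckerIndex R 2 :=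
      SetLike.GradedMul.mul_mem (genericEntry_mem a b) (genericEntry_mem c d)
    exact ⟨2, Submodule.add_mem _ (Submodule.sub_mem _ (h _ _ _ _) (h _ _ _ _)) (h _ _ _ _)⟩
  · have h := genericEntry_mem (R := R)
    have h' (i j : Fin 7) : MvPolynomial.C s * genericEntry R i j ∈
        MvPolynomial.homogeneousSubmodule PluckerIndex R 1 := by
      rw [← MvPolynomial.smul_eq_C_mul]
      exact Submodule.smul_mem _ s (h i j)
    refine ⟨1, ?_⟩
    simp only [isotropyEquations, Set.mem_insert_iff, Set.mem_singleton_iff] at hf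
    rcases hf with rfl | rfl | rfl | rfl | rfl | rfl | rfl
    · exact Submodule.add_mem _ (h _ _) (h _ _)
    · exact Submodule.sub_mem _ (h _ _) (h _ _)
    · exact Submodule.add_mem _ (h _ _) (h' _ _)
    · exact Submodule.add_mem _ (h _ _) (h _ _)
    · exact Submodule.sub_mem _ (h _ _) (h _ _)
    · exact Submodule.add_mem _ (h _ _) (h' _ _)
    · exact Submodule.add_mem _ (Submodule.add_mem _ (h _ _) (h _ _)) (h' _ _)

/-- The homogeneous ideal generated by the equations `p ∧ p = 0` and `p ∧ ω_s = 0`. -/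
def familyIdeal (s : R) : HomogeneousIdeal (MvPolynomial.homogeneousSubmodule PluckerIndex R) :=
  ⟨Ideal.span (pluckerRelations R ∪ isotropyEquations s),
    Ideal.homogeneous_span _ _ (equations_homogeneous s)⟩

end Family

/-- The total space of the family over the affine line `Spec ℂ[t]`: the closed subscheme of
`P(⋀² V) × 𝔸¹` defined by `p ∧ p = 0` and `p ∧ ω_t = 0`. -/
def isotropicFamily : Scheme.{0} := projScheme (familyIdeal (Polynomial.X : Polynomial ℂ))

/-- The projection of the family to the affine line. -/
def isotropicFamilyHom : isotropicFamily ⟶ Spec (CommRingCat.of (Polynomial ℂ)) :=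
  projSchemeHom (familyIdeal (Polynomial.X : Polynomial ℂ))

/-- The complex scheme `q : Y ⟶ Spec ℂ` is (isomorphic to) the scheme-theoretic fibre over the
complex point `t` of a scheme `π : X ⟶ 𝔸¹` over the affine line. -/
def IsFiberAt {X Y : Scheme.{0}} (π : X ⟶ Spec (CommRingCat.of (Polynomial ℂ)))
    (t : ℂ) (q : Y ⟶ Spec (CommRingCat.of ℂ)) : Prop :=
  ∃ j : Y ⟶ X,
    IsPullback j q π (Spec.map (CommRingCat.ofHom (Polynomial.evalRingHom t)))

/-! ### The group `𝔾₂`, its Lie algebra and its adjoint variety -/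

/-- For an endomorphism `A` of `V`, the algebra map `v ↦ v + ε A v` from the exterior algebra to
its dual numbers. -/
def extDual (A : V7 →ₗ[ℂ] V7) :
    ExteriorAlgebra ℂ V7 →ₐ[ℂ] TrivSqZeroExt (ExteriorAlgebra ℂ V7) (ExteriorAlgebra ℂ V7) :=
  ExteriorAlgebra.lift ℂ
    ⟨(TrivSqZeroExt.inlAlgHom ℂ (ExteriorAlgebra ℂ V7) (ExteriorAlgebra ℂ V7)).toLinearMap ∘ₗ
        ExteriorAlgebra.ι ℂ +
      (TrivSqZeroExt.inrHom (ExteriorAlgebra ℂ V7) (ExteriorAlgebra ℂ V7)).restrictScalars ℂ ∘ₗ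
        ExteriorAlgebra.ι ℂ ∘ₗ A, by
      intro v
      ext
      · simp
      · simp [ExteriorAlgebra.ι_add_mul_swap]⟩

/-- The derivation of the exterior algebra that extends `A`: the `ε`-part of `extDual A`. -/
def extDerivation (A : V7 →ₗ[ℂ] V7) : ExteriorAlgebra ℂ V7 →ₗ[ℂ] ExteriorAlgebra ℂ V7 :=
  (TrivSqZeroExt.sndHom (ExteriorAlgebra ℂ V7) (ExteriorAlgebra ℂ V7)).restrictScalars ℂ ∘ₗ
    (extDual A).toLinearMap

theorem extDerivation_apply (A : V7 →ₗ[ℂ] V7) (x : ExteriorAlgebra ℂ V7) :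
    extDerivation A x = (extDual A x).snd :=
  rfl

theorem extDual_fst (A : V7 →ₗ[ℂ] V7) (x : ExteriorAlgebra ℂ V7) : (extDual A x).fst = x := by
  induction x using ExteriorAlgebra.induction with
  | algebraMap r => rw [AlgHom.commutes]; rfl
  | ι v => simp [extDual]
  | mul a b ha hb => rw [map_mul, TrivSqZeroExt.fst_mul, ha, hb]
  | add a b ha hb => rw [map_add, TrivSqZeroExt.fst_add, ha, hb]

theorem extDerivation_ι (A : V7 →ₗ[ℂ] V7) (v : V7) :
    extDerivation A (ExteriorAlgebra.ι ℂ v) = ExteriorAlgebra.ι ℂ (A v) := by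
  simp [extDerivation_apply, extDual]

theorem extDerivation_mul (A : V7 →ₗ[ℂ] V7) (x y : ExteriorAlgebra ℂ V7) :
    extDerivation A (x * y) = extDerivation A x * y + x * extDerivation A y := by
  rw [extDerivation_apply, map_mul, TrivSqZeroExt.snd_mul, extDual_fst, extDual_fst, add_comm]
  rfl

/-- The subgroup of `SL(V)` fixing `ω`; for nondegenerate `ω` it is the complex simple Lie group
`𝔾₂`. -/
def stabilizerGroup (ω : FourForm) : Set (Matrix.SpecialLinearGroup (Fin 7) ℂ) :=
  {g | exteriorPower.map 4 (Matrix.toLin' (g : Matrix (Fin 7) (Fin 7) ℂ)) ω = ω}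

/-- The Lie algebra of `stabilizerGroup ω`: the traceless endomorphisms that act on `ω` by zero. -/
def stabilizerLieAlgebra (ω : FourForm) : Set (Matrix (Fin 7) (Fin 7) ℂ) :=
  {A | A.trace = 0 ∧ extDerivation (Matrix.toLin' A) (ω : ExteriorAlgebra ℂ V7) = 0}

/-- `C` is the affine cone over a closed orbit of `𝔾₂ = stabilizerGroup ω` on the projective space
`P(𝔤₂)` of its adjoint representation. For nondegenerate `ω` there is exactly one closed orbit,
the adjoint variety of `𝔾₂`. -/
def IsAdjointCone (ω : FourForm) (C : Set (Matrix (Fin 7) (Fin 7) ℂ)) : Prop :=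
  IsZariskiClosed C ∧ ∃ A ∈ stabilizerLieAlgebra ω, A ≠ 0 ∧
    C = {B | ∃ c : ℂ, ∃ g ∈ stabilizerGroup ω,
      B = c • ((g : Matrix (Fin 7) (Fin 7) ℂ) * A *
        ((g⁻¹ : Matrix.SpecialLinearGroup (Fin 7) ℂ) : Matrix (Fin 7) (Fin 7) ℂ))}

/-- The homogeneous ideal of the projective variety in `P(End V)` with affine cone `C`. -/
def matrixConeIdeal (C : Set (Matrix (Fin 7) (Fin 7) ℂ)) :
    HomogeneousIdeal (MvPolynomial.homogeneousSubmodule (Fin 7 × Fin 7) ℂ) :=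
  coneIdeal ((fun B ij => B ij.1 ij.2) '' C)

end

/-!
The coordinate ring of the family is understood through a toric degeneration that works uniformly in
the parameter. The linear equations `p ∧ ω_s = 0` leave fourteen of the Plücker coordinates free, and
these are labelled by pairs of six letters `s, a, b, c, d, e` (`LetterPair`). For a weight on the
letters, every quadratic binomial relating two products of letter pairs is the leading part of a
quadric in the ideal of the family (`binomial_mem_lowerSpan`). These binomials identify any two
products of pairs with the same letters (`con_of_letters_eq`); so, over any base ring and for any
value of the parameter, the coordinate ring is spanned by one product of pairs for each possible
collection of letters (`ideal_sup_span_eq_top`). On the other hand, the isotropic planes near a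
general one have a polynomial parametrization by the letters, in which each coordinate has leading
monomial its label, up to a common factor. Hence the spanning monomials are linearly independent
already as functions on this chart, and the ideal of the equations is the kernel of restriction to
the chart (`mem_familyIdeal_iff_chartHom`).

Three parts of the theorem follow. The coordinate ring over `ℂ[t]` is torsion-free, so the family is
flat. At a complex point, a polynomial vanishing on the isotropic cone vanishes on the chart, so the
equations generate the full ideal (`familyIdeal_eq_isotropicIdeal`). The Hilbert function counts
collections of letters and does not depend on the parameter; it is a polynomial
(`isHilbertPolynomial_familyIdeal`). A fibre of the family is `Proj` of the specialized coordinate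
ring (`exists_isPullback_projStructure`), and a linear isomorphism of affine cones identifies it with
other embeddings of the same variety (`isFiberAt_of_linear`).

For the open orbit, `ω₁` has a stabilizer whose Lie algebra has dimension `14 = 49 - 35`, so the
infinitesimal action of `𝔤𝔩(V)` on it is surjective. Any two forms with this property are equivalent,
by the inverse function theorem and the connectedness of a complex line with finitely many points
removed (`equivalent_of_surjective`); a form in the open orbit is equivalent to them because nonempty
Zariski open sets meet (`equivalent_of_isNondegenerate`). The forms `ω_t` with `t ≠ 0` are
equivalent to `ω₁` by rescaling the basis vectors.

For the adjoint variety, let `S` be the Gram matrix of the symmetric form invariant under the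
stabilizer of `ω₁`. The map `P ↦ P S` identifies the bivectors `P` with `P ∧ ω₁ = 0` with `𝔤₂`
(`extDerivation_mul_invariantForm_eq_zero_iff`), and the decomposable ones form a single cone orbit:
a point at which the coordinate of the base point does not vanish is reached by the exponential of a
nilpotent element of `𝔤₂`, and two Weyl group elements move one of the long root coordinates of any
other point, not all of which vanish, to this position (`IsotropicMatrix.isReachable`). So the image
of the isotropic cone is the cone over the closed orbit, for `ω₁` (`isAdjointCone_omegaForm_one`) and
by conjugation for every non-degenerate form.
-/

open CategoryTheory AlgebraicGeometry

attribute [local instance] MvPolynomial.gradedAlgebra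

noncomputable section

/-! ### Fibres and flatness of projective schemes over a base -/

open HomogeneousLocalization Limits in
/-- A surjective ring homomorphism `g` whose kernel is generated by the image of a kernel element of
the surjection `φ` is a base change of `φ`. -/
theorem isPushout_of_surjective_of_ker {R S A B : CommRingCat.{0}} (φ : R ⟶ S) (i : R ⟶ A)
    (g : A ⟶ B)
    (k : S ⟶ B) (comm : i ≫ g = φ ≫ k) (hφ : Function.Surjective φ.hom)
    (hg : Function.Surjective g.hom)
    (hker : ∀ a, g.hom a = 0 → ∃ r b, φ.hom r = 0 ∧ a = i.hom r * b) :
    IsPushout i φ g k := by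
  have hi (W : PushoutCocone i φ) : RingHom.ker g.hom ≤ RingHom.ker W.inl.hom := by
    intro a ha
    obtain ⟨r, b, hr, rfl⟩ := hker a ha
    have h : W.inl.hom (i.hom r) = W.inr.hom (φ.hom r) :=
      congrArg (fun m : R ⟶ W.pt => m.hom r) W.condition
    rw [RingHom.mem_ker, map_mul, h, hr, map_zero, zero_mul]
  have hfac (W : PushoutCocone i φ) (a : A) :
      g.hom.liftOfSurjective hg ⟨W.inl.hom, hi W⟩ (g.hom a) = W.inl.hom a :=
    RingHom.liftOfRightInverse_comp_apply _ _ (Function.rightInverse_surjInv hg)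
      ⟨W.inl.hom, hi W⟩ a
  refine IsPushout.of_isColimit' ⟨comm⟩ (PushoutCocone.IsColimit.mk _
    (fun W => CommRingCat.ofHom (g.hom.liftOfSurjective hg ⟨W.inl.hom, hi W⟩))
    (fun W => ?_) (fun W => ?_) (fun W m h1 _ => ?_))
  · ext a
    exact hfac W a
  · ext s
    obtain ⟨r, rfl⟩ := hφ s
    have h : k.hom (φ.hom r) = g.hom (i.hom r) :=
      (congrArg (fun m : R ⟶ B => m.hom r) comm).symm
    have h' : W.inl.hom (i.hom r) = W.inr.hom (φ.hom r) :=
      congrArg (fun m : R ⟶ W.pt => m.hom r) W.condition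
    change g.hom.liftOfSurjective hg ⟨W.inl.hom, hi W⟩ (k.hom (φ.hom r)) = _
    rw [h, hfac, h']
  · ext b
    obtain ⟨a, rfl⟩ := hg b
    exact (congrArg (fun n : A ⟶ W.pt => n.hom a) h1).trans (hfac W a).symm

section Graded

open HomogeneousLocalization Limits

variable {R A : Type} [CommRing R] [CommRing A] [Algebra R A] (𝒜 : ℕ → Submodule R A)
  [GradedAlgebra 𝒜]

/-- The structure morphism `Proj 𝒜 ⟶ Spec R` of a graded `R`-algebra. -/
def projStructure : Proj 𝒜 ⟶ Spec (CommRingCat.of R) :=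
  Proj.toSpecZero 𝒜 ≫ Spec.map (CommRingCat.ofHom (algebraMap R (𝒜 0)))

/-- The structure homomorphism of the homogeneous localization `A_(s)` as an algebra over `R`. -/
def awayBase (s : A) : R →+* Away 𝒜 s :=
  (fromZeroRingHom 𝒜 _).comp (algebraMap R (𝒜 0))

theorem awayι_projStructure (s : A) {m : ℕ} (hs : s ∈ 𝒜 m) (hm : 0 < m) :
    Proj.awayι 𝒜 s hs hm ≫ projStructure 𝒜 = Spec.map (CommRingCat.ofHom (awayBase 𝒜 s)) := by
  rw [projStructure, Proj.awayι_toSpecZero_assoc, ← Spec.map_comp, ← CommRingCat.ofHom_comp]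
  rfl

theorem awayBase_mul_mk (s : A) {m : ℕ} (hs : s ∈ 𝒜 m) (r : R) (n : ℕ) (a : A)
    (ha : a ∈ 𝒜 (n • m)) :
    awayBase 𝒜 s r * Away.mk 𝒜 hs n a ha =
      Away.mk 𝒜 hs n (r • a) (Submodule.smul_mem _ r ha) := by
  apply val_injective
  rw [val_mul, Away.val_mk, Away.val_mk]
  change Localization.mk (algebraMap R A r) 1 * _ = _
  rw [Localization.mk_mul, one_mul, Algebra.smul_def]

/-- The projective scheme of a graded algebra that is torsion-free over a principal ideal domain
is flat over it. -/
theorem flat_projStructure [IsDomain R] [IsPrincipalIdealRing R]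
    (h : ∀ (r : R) (a : A), r • a = 0 → r = 0 ∨ a = 0) : Flat (projStructure 𝒜) := by
  have haff (s : (Proj.affineOpenCover 𝒜).openCover.I₀) :
      IsAffine ((Proj.affineOpenCover 𝒜).openCover.X s) :=
    inferInstanceAs (IsAffine (Spec _))
  refine HasRingHomProperty.of_source_openCover (P := @Flat) (Q := RingHom.Flat)
    (Proj.affineOpenCover 𝒜).openCover fun s => ?_
  rw [← HasRingHomProperty.iff_of_isAffine (P := @Flat)]
  have hs := awayι_projStructure 𝒜 (s.2 : A) s.2.2 s.1.2
  change Flat (Proj.awayι 𝒜 _ _ _ ≫ projStructure 𝒜)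
  rw [hs, Flat.SpecMap_iff]
  change (awayBase 𝒜 (s.2 : A)).Flat
  algebraize [awayBase 𝒜 (s.2 : A)]
  change Module.Flat R (Away 𝒜 (s.2 : A))
  have : Module.IsTorsionFree R (Away 𝒜 (s.2 : A)) := by
    refine Module.IsTorsionFree.of_smul_eq_zero fun r x hx => ?_
    obtain ⟨n, a, ha, rfl⟩ := Away.mk_surjective 𝒜 s.2.2 x
    rw [Algebra.smul_def] at hx
    change awayBase 𝒜 (s.2 : A) r * _ = 0 at hx
    rw [awayBase_mul_mk] at hx
    have hx' := congrArg HomogeneousLocalization.val hx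
    rw [Away.val_mk, val_zero, Localization.mk_eq_mk', IsLocalization.mk'_eq_zero_iff] at hx'
    obtain ⟨⟨_, k, rfl⟩, hk⟩ := hx'
    change (s.2 : A) ^ k * (r • a) = 0 at hk
    rw [mul_smul_comm] at hk
    refine (h _ _ hk).imp_right fun h0 => ?_
    apply val_injective
    rw [Away.val_mk, val_zero, Localization.mk_eq_mk', IsLocalization.mk'_eq_zero_iff]
    exact ⟨⟨_, k, rfl⟩, h0⟩
  infer_instance

theorem isProper_projStructure [Algebra.FiniteType R A]
    (h0 : Function.Surjective (algebraMap R (𝒜 0))) : IsProper (projStructure 𝒜) := by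
  have : IsScalarTower R (𝒜 0) A := ⟨fun r x a => smul_mul_assoc r (x : A) a⟩
  have : Algebra.FiniteType (𝒜 0) A := Algebra.FiniteType.of_restrictScalars_finiteType R (𝒜 0) A
  have : IsClosedImmersion (Spec.map (CommRingCat.ofHom (algebraMap R (𝒜 0)))) :=
    IsClosedImmersion.spec_of_surjective _ h0
  unfold projStructure
  infer_instance

variable {S B : Type} [CommRing S] [CommRing B] [Algebra S B] (ℬ : ℕ → Submodule S B)
  [GradedAlgebra ℬ]

/-- A surjection of graded algebras `A → B` over a surjection `φ` of base rings, whose kernel is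
generated by the kernel of `φ`, exhibits `Proj ℬ` as the base change of `Proj 𝒜`. -/
theorem exists_isPullback_projStructure (φ : R →+* S) (hφ : Function.Surjective φ)
    (f : GradedRingHom 𝒜 ℬ) (hf : Function.Surjective f)
    (hbase : ∀ r, f (algebraMap R A r) = algebraMap S B (φ r))
    (hker : ∀ n, ∀ a ∈ 𝒜 n, f a = 0 → ∃ r, ∃ b ∈ 𝒜 n, φ r = 0 ∧ a = r • b) :
    ∃ j : Proj ℬ ⟶ Proj 𝒜, IsPullback j (projStructure ℬ) (projStructure 𝒜)
      (Spec.map (CommRingCat.ofHom φ)) := by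
  have hsurj (n : ℕ) (b : B) (hb : b ∈ ℬ n) : ∃ a ∈ 𝒜 n, f a = b := by
    obtain ⟨a, rfl⟩ := hf b
    refine ⟨DirectSum.decompose 𝒜 a n, SetLike.coe_mem _, ?_⟩
    rw [GradedRingHom.map_directSumDecompose, DirectSum.decompose_of_mem_same ℬ hb]
  have hirr : HomogeneousIdeal.irrelevant ℬ ≤ (HomogeneousIdeal.irrelevant 𝒜).map f := by
    rw [HomogeneousIdeal.irrelevant_le]
    intro n hn b hb
    obtain ⟨a, ha, rfl⟩ := hsurj n b hb
    exact Ideal.mem_map_of_mem f (HomogeneousIdeal.mem_irrelevant_of_mem 𝒜 hn ha)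
  have haway (s : A) : (Away.map f s).comp (awayBase 𝒜 s) = (awayBase ℬ (f s)).comp φ := by
    ext r
    change Localization.mk (f (algebraMap R A r)) ⟨f 1, _⟩ =
      Localization.mk (algebraMap S B (φ r)) 1
    rw [hbase]
    congr 1
    exact Subtype.ext (map_one f)
  have hcomm : Proj.map f hirr ≫ projStructure 𝒜 =
      projStructure ℬ ≫ Spec.map (CommRingCat.ofHom φ) := by
    refine (Proj.mapAffineOpenCover f hirr).openCover.hom_ext _ _ fun s => ?_
    change Proj.awayι ℬ (f s.2) (f.2 s.2.2) s.1.2 ≫ _ = Proj.awayι ℬ (f s.2) (f.2 s.2.2) s.1.2 ≫ _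
    refine (Proj.awayι_comp_map_assoc f hirr s.1.2 _ s.2.2 _).trans ?_
    refine (congrArg _ (awayι_projStructure 𝒜 _ s.2.2 s.1.2)).trans ?_
    refine Eq.trans ?_ (congrArg (· ≫ Spec.map (CommRingCat.ofHom φ))
      (awayι_projStructure ℬ (f s.2) (f.2 s.2.2) s.1.2).symm)
    rw [← Spec.map_comp]
    refine Eq.trans ?_ (Spec.map_comp _ _)
    rw [← CommRingCat.ofHom_comp, ← CommRingCat.ofHom_comp, haway]
  have hpush (s : A) {m : ℕ} (hs : s ∈ 𝒜 m) : IsPushout (CommRingCat.ofHom (awayBase 𝒜 s))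
      (CommRingCat.ofHom φ) (CommRingCat.ofHom (Away.map f s))
      (CommRingCat.ofHom (awayBase ℬ (f s))) := by
    refine isPushout_of_surjective_of_ker _ _ _ _ ?_ hφ ?_ ?_
    · rw [← CommRingCat.ofHom_comp, ← CommRingCat.ofHom_comp, haway]
    · intro x
      obtain ⟨n, b, hb, rfl⟩ := Away.mk_surjective ℬ (f.2 hs) x
      obtain ⟨a, ha, rfl⟩ := hsurj _ b hb
      exact ⟨Away.mk 𝒜 hs n a ha, Away.map_mk f s hs n a ha⟩
    · intro x hx
      obtain ⟨n, a, ha, rfl⟩ := Away.mk_surjective 𝒜 hs x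
      change Away.map f s (Away.mk 𝒜 hs n a ha) = 0 at hx
      rw [Away.map_mk] at hx
      have hx' := congrArg HomogeneousLocalization.val hx
      rw [Away.val_mk, val_zero, Localization.mk_eq_mk', IsLocalization.mk'_eq_zero_iff] at hx'
      obtain ⟨⟨_, k, rfl⟩, hk⟩ := hx'
      change f s ^ k * f a = 0 at hk
      rw [← map_pow, ← map_mul] at hk
      have hmem : s ^ k * a ∈ 𝒜 ((k + n) • m) := by
        rw [add_smul]
        exact SetLike.mul_mem_graded (SetLike.pow_mem_graded k hs) ha
      obtain ⟨r, b, hb, hr, hab⟩ := hker _ _ hmem hk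
      refine ⟨r, Away.mk 𝒜 hs (k + n) b hb, hr, ?_⟩
      change _ = awayBase 𝒜 s r * _
      rw [awayBase_mul_mk]
      apply val_injective
      rw [Away.val_mk, Away.val_mk, ← hab, Localization.mk_eq_mk_iff, Localization.r_iff_exists]
      exact ⟨1, by simp only [OneMemClass.coe_one, one_mul]; ring⟩
  refine ⟨Proj.map f hirr, ?_⟩
  -- The comparison morphism `c` to the fibre product is an isomorphism, because it is one over each
  -- of the affine charts of `Proj 𝒜`, where it is given by the pushout square `hpush`.
  let X' := pullback (projStructure 𝒜) (Spec.map (CommRingCat.ofHom φ))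
  let c : Proj ℬ ⟶ X' := pullback.lift (Proj.map f hirr) (projStructure ℬ) hcomm
  let q := pullback.fst (projStructure 𝒜) (Spec.map (CommRingCat.ofHom φ))
  have hloc (s : A) {m : ℕ} (hs : s ∈ 𝒜 m) (hm : 0 < m) :
      IsIso (pullback.snd c (pullback.fst q (Proj.awayι 𝒜 s hs hm))) := by
    let a := Proj.awayι 𝒜 s hs hm
    let b := Proj.awayι ℬ (f s) (f.2 hs) hm
    have h1 : IsPullback (Spec.map (CommRingCat.ofHom (Away.map f s))) b a (c ≫ q) := by
      have hcq : c ≫ q = Proj.map f hirr := pullback.lift_fst _ _ _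
      rw [hcq]
      refine IsOpenImmersion.isPullback _ _ _ _ (Proj.awayι_comp_map f hirr hm s hs) ?_
      change Proj.map f hirr ⁻¹ᵁ (Proj.awayι 𝒜 s hs hm).opensRange =
        (Proj.awayι ℬ (f s) (f.2 hs) hm).opensRange
      rw [Proj.opensRange_awayι, Proj.opensRange_awayι, Proj.map_preimage_basicOpen]
    have h2 : IsPullback (pullback.snd q a) (pullback.fst q a) a q :=
      (IsPullback.of_hasPullback q a).flip
    let d := h2.lift (Spec.map (CommRingCat.ofHom (Away.map f s))) (b ≫ c)
      (by rw [Category.assoc]; exact h1.w)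
    have h3 : IsPullback d b (pullback.fst q a) c :=
      IsPullback.of_right (by rw [h2.lift_fst]; exact h1) (h2.lift_snd _ _ _) h2
    have h4 : IsPullback _ _ (a ≫ projStructure 𝒜) _ :=
      h2.paste_vert (IsPullback.of_hasPullback (projStructure 𝒜) (Spec.map (CommRingCat.ofHom φ)))
    rw [awayι_projStructure 𝒜 s hs hm] at h4
    have h5 := isPullback_SpecMap_of_isPushout _ _ _ _ (hpush s hs)
    have h6 : d = (h5.isoIsPullback _ _ h4).hom := by
      apply h4.hom_ext
      · rw [IsPullback.isoIsPullback_hom_fst, h2.lift_fst]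
      · rw [IsPullback.isoIsPullback_hom_snd, h2.lift_snd_assoc, Category.assoc,
          pullback.lift_snd, awayι_projStructure ℬ (f s) (f.2 hs) hm]
    have h7 : pullback.snd c (pullback.fst q a) = h3.flip.isoPullback.inv ≫ d :=
      h3.flip.isoPullback_inv_snd.symm
    have h8 : IsIso d := by
      rw [h6]
      infer_instance
    rw [h7]
    infer_instance
  have hc : IsIso c := IsZariskiLocalAtTarget.of_openCover
    (P := MorphismProperty.isomorphisms Scheme.{0})
    ((Proj.affineOpenCover 𝒜).openCover.pullback₁ q) fun s => hloc _ s.2.2 s.1.2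
  exact IsPullback.of_iso_pullback ⟨hcomm⟩ (asIso c) (pullback.lift_fst _ _ _)
    (pullback.lift_snd _ _ _)

end Graded

/-! ### The toric congruence on monomials in letter pairs -/

/-- Labels of the fourteen coordinates left free by the linear equations `p ∧ ω_s = 0`. The label, a
product of two of the letters `s, a, b, c, d, e`, is the leading monomial of the coordinate in the
chart `chartEntry`, divided by the square of the letter `s`. The letter `s` is unrelated to the
parameter of the family. -/
inductive LetterPair
  | ss | sa | aa | sb | ab | sc | ac | sd | ad | se | ae | de | be | bc
  deriving DecidableEq

namespace LetterPair

instance : Fintype LetterPair where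
  elems := {ss, sa, aa, sb, ab, sc, ac, sd, ad, se, ae, de, be, bc}
  complete e := by cases e <;> simp

/-- The exponents of the letters `s, a, b, c, d, e` in a product of letter pairs with
multiplicities `m`. -/
def letters (m : LetterPair → ℕ) : Fin 6 → ℕ :=
  ![2 * m ss + m sa + m sb + m sc + m sd + m se, 2 * m aa + m sa + m ab + m ac + m ad + m ae,
    m sb + m ab + m be + m bc, m sc + m ac + m bc, m sd + m ad + m de,
    m se + m ae + m de + m be]

/-- The quadratic binomials `ef - gh` that generate the relations between products of letter
pairs. -/
inductive Binomial : LetterPair → LetterPair → LetterPair → LetterPair → Prop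
  | sa_sa : Binomial sa sa ss aa
  | ab_ss : Binomial ab ss sb sa
  | ac_ss : Binomial ac ss sc sa
  | ad_ss : Binomial ad ss sd sa
  | ae_ss : Binomial ae ss se sa
  | ab_sa : Binomial ab sa sb aa
  | ac_sa : Binomial ac sa sc aa
  | ad_sa : Binomial ad sa sd aa
  | ae_sa : Binomial ae sa se aa
  | ab_sc : Binomial ab sc sb ac
  | ab_sd : Binomial ab sd sb ad
  | ab_se : Binomial ab se sb ae
  | ac_sd : Binomial ac sd sc ad
  | ac_se : Binomial ac se sc ae
  | ad_se : Binomial ad se sd ae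
  | ss_de : Binomial ss de sd se
  | sa_de : Binomial sa de sd ae
  | aa_de : Binomial aa de ad ae
  | ss_be : Binomial ss be sb se
  | sa_be : Binomial sa be sb ae
  | aa_be : Binomial aa be ab ae
  | ss_bc : Binomial ss bc sb sc
  | sa_bc : Binomial sa bc sb ac
  | aa_bc : Binomial aa bc ab ac
  | sb_de : Binomial sb de sd be
  | ab_de : Binomial ab de ad be
  | se_bc : Binomial se bc sc be
  | ae_bc : Binomial ae bc ac be

theorem letters_add (m m' : LetterPair → ℕ) : letters (m + m') = letters m + letters m' := by
  ext i
  fin_cases i <;> simp [letters] <;> ring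

theorem letters_zero : letters 0 = 0 := by
  ext i
  fin_cases i <;> rfl

theorem Binomial.letters_eq {e f g h : LetterPair} (r : Binomial e f g h) :
    letters (Pi.single e 1 + Pi.single f 1) = letters (Pi.single g 1 + Pi.single h 1) := by
  cases r <;> decide

theorem sum_eq (m : LetterPair → ℕ) : ∑ e, m e = m ss + m sa + m aa + m sb + m ab + m sc + m ac +
    m sd + m ad + m se + m ae + m de + m be + m bc := by
  change ∑ e ∈ {ss, sa, aa, sb, ab, sc, ac, sd, ad, se, ae, de, be, bc}, m e = _
  simp
  ring

theorem two_mul_sum (m : LetterPair → ℕ) : ∑ i, letters m i = 2 * ∑ e, m e := by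
  rw [sum_eq]
  simp [Fin.sum_univ_succ, letters]
  ring

section Congruence

/-- The monomial `m` is congruent to a multiple of `e`. -/
def Divides (c : AddCon (LetterPair → ℕ)) (e : LetterPair) (m : LetterPair → ℕ) : Prop :=
  ∃ k : LetterPair → ℕ, c m (k + Pi.single e 1)

variable {c : AddCon (LetterPair → ℕ)}

theorem eq_add_single {m : LetterPair → ℕ} {e : LetterPair} (h : 0 < m e) :
    ∃ k : LetterPair → ℕ, m = k + Pi.single e 1 := by
  refine ⟨m - Pi.single e 1, ?_⟩
  ext f
  by_cases hf : f = e
  · subst hf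
    simp
    omega
  · simp [hf]

theorem Divides.of_pos {m : LetterPair → ℕ} {e : LetterPair} (h : 0 < m e) : Divides c e m := by
  obtain ⟨k, rfl⟩ := eq_add_single h
  exact ⟨k, c.refl _⟩

theorem Divides.trans {m m' : LetterPair → ℕ} {e : LetterPair} (h : c m m') (h' : Divides c e m') :
    Divides c e m := by
  obtain ⟨k, hk⟩ := h'
  exact ⟨k, c.trans h hk⟩

variable (hc : ∀ e f g h, Binomial e f g h →
  c (Pi.single e 1 + Pi.single f 1) (Pi.single g 1 + Pi.single h 1))
include hc

theorem exists_step {e f g h : LetterPair} (r : Binomial e f g h) {m : LetterPair → ℕ}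
    (he : 0 < m e) (hf : 0 < m f) (hef : e ≠ f) :
    ∃ k : LetterPair → ℕ, m = k + (Pi.single e 1 + Pi.single f 1) ∧
      c m (k + (Pi.single g 1 + Pi.single h 1)) ∧
      letters (k + (Pi.single g 1 + Pi.single h 1)) = letters m := by
  obtain ⟨k, rfl⟩ := eq_add_single he
  have hk : 0 < k f := by simpa [Pi.single_apply, hef.symm] using hf
  obtain ⟨k, rfl⟩ := eq_add_single hk
  have h1 : k + Pi.single f 1 + Pi.single e 1 = k + (Pi.single e 1 + Pi.single f 1) := by
    rw [add_assoc, add_comm (Pi.single f 1)]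
  refine ⟨k, h1, ?_, ?_⟩
  · rw [h1]
    exact c.add (c.refl k) (hc _ _ _ _ r)
  · rw [h1, letters_add k, letters_add k, r.letters_eq]

theorem divides_left {e f g h : LetterPair} (r : Binomial e f g h) {m : LetterPair → ℕ}
    (he : 0 < m e) (hf : 0 < m f) (hef : e ≠ f) : Divides c g m := by
  obtain ⟨k, -, hk, -⟩ := exists_step hc r he hf hef
  exact ⟨k + Pi.single h 1, by rwa [add_assoc, add_comm (Pi.single h 1)]⟩

theorem divides_of_reverse {e f g h : LetterPair} (r : Binomial e f g h) {m : LetterPair → ℕ}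
    (hg : 0 < m g) (hh : 0 < m h) (hgh : g ≠ h) : Divides c f m := by
  obtain ⟨k, rfl⟩ := eq_add_single hg
  have hk : 0 < k h := by simpa [Pi.single_apply, hgh.symm] using hh
  obtain ⟨k, rfl⟩ := eq_add_single hk
  refine ⟨k + Pi.single e 1, ?_⟩
  rw [add_assoc, add_assoc, add_comm (Pi.single h 1)]
  exact c.add (c.refl k) (c.symm (hc _ _ _ _ r))

/-- If a letter `b` is paired with `s` or `a`, the monomial is congruent to a multiple of `sb` as
soon as a letter `s` occurs at all, and it is a multiple of `ab` otherwise. So whether `s` or `a`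
is used is decided by the letters; the same holds for `c`, `d` and `e`. -/
theorem divides_b {m : LetterPair → ℕ} (h : 0 < m sb + m ab) :
    Divides c (if 0 < letters m 0 then sb else ab) m := by
  have h0 : letters m 0 = 2 * m ss + m sa + m sb + m sc + m sd + m se := rfl
  by_cases hb : 0 < m sb
  · rw [if_pos (by omega)]
    exact .of_pos hb
  have ha : 0 < m ab := by omega
  split_ifs with hs
  · obtain h1 | h1 | h1 | h1 | h1 : 0 < m ss ∨ 0 < m sa ∨ 0 < m sc ∨ 0 < m sd ∨ 0 < m se := by omega
    · exact divides_left hc .ab_ss ha h1 (by decide)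
    · exact divides_left hc .ab_sa ha h1 (by decide)
    · exact divides_left hc .ab_sc ha h1 (by decide)
    · exact divides_left hc .ab_sd ha h1 (by decide)
    · exact divides_left hc .ab_se ha h1 (by decide)
  · exact .of_pos ha

theorem divides_c {m : LetterPair → ℕ} (h : 0 < m sc + m ac) :
    Divides c (if 0 < letters m 0 then sc else ac) m := by
  have h0 : letters m 0 = 2 * m ss + m sa + m sb + m sc + m sd + m se := rfl
  by_cases hb : 0 < m sc
  · rw [if_pos (by omega)]
    exact .of_pos hb
  have ha : 0 < m ac := by omega
  split_ifs with hs
  · obtain h1 | h1 | h1 | h1 | h1 : 0 < m ss ∨ 0 < m sa ∨ 0 < m sb ∨ 0 < m sd ∨ 0 < m se := by omega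
    · exact divides_left hc .ac_ss ha h1 (by decide)
    · exact divides_left hc .ac_sa ha h1 (by decide)
    · exact divides_of_reverse hc .ab_sc h1 ha (by decide)
    · exact divides_left hc .ac_sd ha h1 (by decide)
    · exact divides_left hc .ac_se ha h1 (by decide)
  · exact .of_pos ha

theorem divides_d {m : LetterPair → ℕ} (h : 0 < m sd + m ad) :
    Divides c (if 0 < letters m 0 then sd else ad) m := by
  have h0 : letters m 0 = 2 * m ss + m sa + m sb + m sc + m sd + m se := rfl
  by_cases hb : 0 < m sd
  · rw [if_pos (by omega)]
    exact .of_pos hb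
  have ha : 0 < m ad := by omega
  split_ifs with hs
  · obtain h1 | h1 | h1 | h1 | h1 : 0 < m ss ∨ 0 < m sa ∨ 0 < m sb ∨ 0 < m sc ∨ 0 < m se := by omega
    · exact divides_left hc .ad_ss ha h1 (by decide)
    · exact divides_left hc .ad_sa ha h1 (by decide)
    · exact divides_of_reverse hc .ab_sd h1 ha (by decide)
    · exact divides_of_reverse hc .ac_sd h1 ha (by decide)
    · exact divides_left hc .ad_se ha h1 (by decide)
  · exact .of_pos ha

theorem divides_e {m : LetterPair → ℕ} (h : 0 < m se + m ae) :
    Divides c (if 0 < letters m 0 then se else ae) m := by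
  have h0 : letters m 0 = 2 * m ss + m sa + m sb + m sc + m sd + m se := rfl
  by_cases hb : 0 < m se
  · rw [if_pos (by omega)]
    exact .of_pos hb
  have ha : 0 < m ae := by omega
  split_ifs with hs
  · obtain h1 | h1 | h1 | h1 | h1 : 0 < m ss ∨ 0 < m sa ∨ 0 < m sb ∨ 0 < m sc ∨ 0 < m sd := by omega
    · exact divides_left hc .ae_ss ha h1 (by decide)
    · exact divides_left hc .ae_sa ha h1 (by decide)
    · exact divides_of_reverse hc .ab_se h1 ha (by decide)
    · exact divides_of_reverse hc .ac_se h1 ha (by decide)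
    · exact divides_of_reverse hc .ad_se h1 ha (by decide)
  · exact .of_pos ha

/-- A product of a pair from `{s, a}` and a pair from `{b, c, d, e}` can be replaced by a product of
two mixed pairs, so that one kind of unmixed pairs disappears. -/
theorem exists_con_unmixed (n : ℕ) (m : LetterPair → ℕ) (hn : m de + m be + m bc = n) :
    ∃ m', c m m' ∧ letters m' = letters m ∧
      (m' ss + m' sa + m' aa = 0 ∨ m' de + m' be + m' bc = 0) := by
  induction n generalizing m with
  | zero => exact ⟨m, c.refl m, rfl, Or.inr hn⟩
  | succ n ih =>
    by_cases h0 : m ss + m sa + m aa = 0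
    · exact ⟨m, c.refl m, rfl, Or.inl h0⟩
    have key {e f g h : LetterPair} (r : Binomial e f g h) (he : 0 < m e) (hf : 0 < m f)
        (hef : e ≠ f)
        (hk : ∀ k m' : LetterPair → ℕ, m = k + (Pi.single e 1 + Pi.single f 1) →
          m' = k + (Pi.single g 1 + Pi.single h 1) → m' de + m' be + m' bc = n) :
        ∃ m', c m m' ∧ letters m' = letters m ∧
          (m' ss + m' sa + m' aa = 0 ∨ m' de + m' be + m' bc = 0) := by
      obtain ⟨k, h1, h2, h3⟩ := exists_step hc r he hf hef
      obtain ⟨m', h4, h5, h6⟩ := ih _ (hk k _ h1 rfl)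
      exact ⟨m', c.trans h2 h4, h5.trans h3, h6⟩
    have aux (k : LetterPair → ℕ) (e f : LetterPair) (i : LetterPair)
        (hm : m = k + (Pi.single e 1 + Pi.single f 1)) :
        m i = k i + ((if i = e then 1 else 0) + (if i = f then 1 else 0)) := by
      rw [hm]
      simp [Pi.single_apply]
    obtain h1 | h1 | h1 : 0 < m ss ∨ 0 < m sa ∨ 0 < m aa := by omega
    all_goals obtain h2 | h2 | h2 : 0 < m de ∨ 0 < m be ∨ 0 < m bc := by omega
    on_goal 1 => refine key .ss_de h1 h2 (by decide) ?_
    on_goal 2 => refine key .ss_be h1 h2 (by decide) ?_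
    on_goal 3 => refine key .ss_bc h1 h2 (by decide) ?_
    on_goal 4 => refine key .sa_de h1 h2 (by decide) ?_
    on_goal 5 => refine key .sa_be h1 h2 (by decide) ?_
    on_goal 6 => refine key .sa_bc h1 h2 (by decide) ?_
    on_goal 7 => refine key .aa_de h1 h2 (by decide) ?_
    on_goal 8 => refine key .aa_be h1 h2 (by decide) ?_
    on_goal 9 => refine key .aa_bc h1 h2 (by decide) ?_
    all_goals
      rintro k m' hk rfl
      have k1 := aux k _ _ de hk
      have k2 := aux k _ _ be hk
      have k3 := aux k _ _ bc hk
      simp at k1 k2 k3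
      simp
      omega

/-- Some letter pair, depending on the letters only, divides up to congruence every monomial with
these letters. Cancelling it is the induction step for `con_of_letters_eq`. -/
theorem exists_divides (E : Fin 6 → ℕ) (hE : E ≠ 0) :
    ∃ e, ∀ m, letters m = E → Divides c e m := by
  have hpos : 0 < E 0 + E 1 + E 2 + E 3 + E 4 + E 5 := by
    by_contra h
    refine hE (funext fun i => ?_)
    fin_cases i <;> simp <;> omega
  -- It suffices to treat representatives without superfluous unmixed pairs.
  suffices H : ∃ e, ∀ m, letters m = E →
      (m ss + m sa + m aa = 0 ∨ m de + m be + m bc = 0) → Divides c e m by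
    obtain ⟨e, he⟩ := H
    refine ⟨e, fun m hm => ?_⟩
    obtain ⟨m', h1, h2, h3⟩ := exists_con_unmixed hc _ m rfl
    exact .trans h1 (he m' (h2.trans hm) h3)
  have hl (m : LetterPair → ℕ) (hm : letters m = E) :
      E 0 = 2 * m ss + m sa + m sb + m sc + m sd + m se ∧
      E 1 = 2 * m aa + m sa + m ab + m ac + m ad + m ae ∧
      E 2 = m sb + m ab + m be + m bc ∧ E 3 = m sc + m ac + m bc ∧
      E 4 = m sd + m ad + m de ∧ E 5 = m se + m ae + m de + m be := by
    subst hm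
    exact ⟨rfl, rfl, rfl, rfl, rfl, rfl⟩
  by_cases hA : E 2 + E 3 + E 4 + E 5 ≤ E 0 + E 1
  · by_cases h0 : E 2 + E 3 + E 4 + E 5 = 0
    · by_cases hs : 2 ≤ E 0
      · refine ⟨ss, fun m hm _ => ?_⟩
        have := hl m hm
        by_cases h1 : 0 < m ss
        · exact .of_pos h1
        obtain ⟨k, rfl⟩ := eq_add_single (m := m) (e := sa) (by omega)
        simp only [Pi.add_apply, Pi.single_apply, reduceCtorEq, if_false, if_true] at this h1
        obtain ⟨k, rfl⟩ := eq_add_single (m := k) (e := sa) (by omega)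
        refine ⟨k + Pi.single aa 1, ?_⟩
        rw [add_assoc, add_assoc, add_comm (Pi.single aa 1)]
        exact c.add (c.refl k) (hc _ _ _ _ .sa_sa)
      by_cases hs : E 0 = 1
      · refine ⟨sa, fun m hm _ => .of_pos ?_⟩
        have := hl m hm
        omega
      · refine ⟨aa, fun m hm _ => .of_pos ?_⟩
        have := hl m hm
        omega
    by_cases h2 : 0 < E 2
    · refine ⟨if 0 < E 0 then sb else ab, fun m hm _ => ?_⟩
      have := hl m hm
      rw [← hm]
      exact divides_b hc (by omega)
    by_cases h3 : 0 < E 3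
    · refine ⟨if 0 < E 0 then sc else ac, fun m hm _ => ?_⟩
      have := hl m hm
      rw [← hm]
      exact divides_c hc (by omega)
    by_cases h4 : 0 < E 4
    · refine ⟨if 0 < E 0 then sd else ad, fun m hm _ => ?_⟩
      have := hl m hm
      rw [← hm]
      exact divides_d hc (by omega)
    · refine ⟨if 0 < E 0 then se else ae, fun m hm _ => ?_⟩
      have := hl m hm
      rw [← hm]
      exact divides_e hc (by omega)
  by_cases h0 : E 0 + E 1 = 0
  · by_cases h4 : 0 < E 4
    · refine ⟨de, fun m hm _ => .of_pos ?_⟩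
      have := hl m hm
      omega
    by_cases h3 : 0 < E 3
    · refine ⟨bc, fun m hm _ => .of_pos ?_⟩
      have := hl m hm
      omega
    · refine ⟨be, fun m hm _ => .of_pos ?_⟩
      have := hl m hm
      omega
  -- The pairs among `b, c, d, e` join `{b, d}` to `{c, e}`, so the number of letters `b, d` paired
  -- with `s` or `a` minus the number of such letters `c, e` depends on the exponents only.
  by_cases hD : E 3 + E 5 < E 0 + E 1 + E 2 + E 4
  · by_cases h4 : 0 < E 4
    · refine ⟨if 0 < E 0 then sd else ad, fun m hm _ => ?_⟩
      have := hl m hm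
      rw [← hm]
      by_cases h5 : 0 < m sd + m ad
      · exact divides_d hc h5
      by_cases h6 : 0 < m sb
      · obtain ⟨k, h7, h8, h9⟩ := exists_step hc .sb_de h6 (by omega) (by decide)
        rw [← h9]
        exact .trans h8 (divides_d hc (by simp))
      · obtain ⟨k, h7, h8, h9⟩ := exists_step hc .ab_de (m := m) (by omega) (by omega) (by decide)
        rw [← h9]
        exact .trans h8 (divides_d hc (by simp))
    · refine ⟨if 0 < E 0 then sb else ab, fun m hm _ => ?_⟩
      have := hl m hm
      rw [← hm]
      exact divides_b hc (by omega)
  · by_cases h3 : 0 < E 3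
    · refine ⟨if 0 < E 0 then sc else ac, fun m hm _ => ?_⟩
      have := hl m hm
      rw [← hm]
      by_cases h5 : 0 < m sc + m ac
      · exact divides_c hc h5
      by_cases h6 : 0 < m se
      · obtain ⟨k, h7, h8, h9⟩ := exists_step hc .se_bc h6 (by omega) (by decide)
        rw [← h9]
        exact .trans h8 (divides_c hc (by simp))
      · obtain ⟨k, h7, h8, h9⟩ := exists_step hc .ae_bc (m := m) (by omega) (by omega) (by decide)
        rw [← h9]
        exact .trans h8 (divides_c hc (by simp))
    · refine ⟨if 0 < E 0 then se else ae, fun m hm _ => ?_⟩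
      have := hl m hm
      rw [← hm]
      exact divides_e hc (by omega)

/-- The quadratic binomials generate the toric congruence: two products of letter pairs with the
same letters are congruent. -/
theorem con_of_letters_eq {m m' : LetterPair → ℕ} (h : letters m = letters m')
    (hl : ∀ m m', c m m' → letters m = letters m') : c m m' := by
  induction hn : ∑ e, m e using Nat.strong_induction_on generalizing m m' with
  | _ n ih =>
    by_cases hE : letters m = 0
    · have h0 {m : LetterPair → ℕ} (hm : letters m = 0) : m = 0 := by
        have h1 := two_mul_sum m
        rw [hm] at h1
        have h2 : ∑ e, m e = 0 := by simpa using h1.symm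
        exact funext fun e => (Finset.sum_eq_zero_iff.mp h2) e (Finset.mem_univ e)
      have h1 : m = 0 := h0 hE
      have h2 : m' = 0 := h0 (h.symm.trans hE)
      rw [h1, h2]
      exact c.refl 0
    obtain ⟨e, he⟩ := exists_divides hc _ hE
    obtain ⟨k, hk⟩ := he m rfl
    obtain ⟨k', hk'⟩ := he m' h.symm
    have h1 := hl _ _ hk
    have h2 := hl _ _ hk'
    have h3 := two_mul_sum m
    rw [h1, two_mul_sum] at h3
    rw [letters_add] at h1 h2
    refine c.trans hk (c.trans (c.add ?_ (c.refl _)) (c.symm hk'))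
    refine ih (∑ e, k e) ?_ ?_ rfl
    · rw [← hn]
      simp only [Pi.add_apply, Finset.sum_add_distrib, Finset.sum_pi_single', Finset.mem_univ,
        if_true] at h3
      omega
    · exact add_right_cancel (h1.symm.trans (h.trans h2))

end Congruence

end LetterPair

/-! ### Straightening in the coordinate ring -/

section Straightening

set_option linter.unusedSimpArgs false

open MvPolynomial LetterPair

variable (R : Type) [CommRing R]

/-- The Plücker coordinate with a given label, up to sign. -/
def pairCoord : LetterPair → MvPolynomial PluckerIndex R
  | ss => genericEntry R 0 4
  | sa => genericEntry R 1 4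
  | aa => -genericEntry R 1 3
  | sb => genericEntry R 2 4
  | ab => -genericEntry R 2 3
  | sc => genericEntry R 0 6
  | ac => genericEntry R 1 6
  | sd => -genericEntry R 4 6
  | ad => genericEntry R 3 6
  | se => genericEntry R 0 5
  | ae => genericEntry R 1 5
  | de => -genericEntry R 5 6
  | be => genericEntry R 2 5
  | bc => genericEntry R 2 6

/-- The monomial in the fourteen coordinates `pairCoord` with exponents `m`. -/
def pairMonomial (m : LetterPair → ℕ) : MvPolynomial PluckerIndex R :=
  ∏ e, pairCoord R e ^ m e

variable {R}

theorem pairMonomial_add (m m' : LetterPair → ℕ) :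
    pairMonomial R (m + m') = pairMonomial R m * pairMonomial R m' := by
  simp [pairMonomial, pow_add, Finset.prod_mul_distrib]

theorem pairMonomial_zero : pairMonomial R 0 = 1 := by
  simp [pairMonomial]

theorem pairMonomial_single (e : LetterPair) : pairMonomial R (Pi.single e 1) = pairCoord R e := by
  rw [pairMonomial, Finset.prod_eq_single e]
  · simp
  · intro f _ hf
    simp [hf]
  · simp

/-- The weight of a monomial in the letters, for which `a` has weight `4`, the letters `b, e` have
weight `1` and the letters `s, c, d` have weight `0`. -/
def letterWeight (E : Fin 6 → ℕ) : ℕ :=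
  4 * E 1 + E 2 + E 5

theorem letterWeight_add (E E' : Fin 6 → ℕ) :
    letterWeight (E + E') = letterWeight E + letterWeight E' := by
  simp only [letterWeight, Pi.add_apply]
  ring

variable (s : R)

/-- The polynomials that are, modulo the ideal of the family, combinations of monomials in the
coordinates `pairCoord` that have the degree of `E` and smaller weight. -/
def lowerSpan (E : Fin 6 → ℕ) : Submodule R (MvPolynomial PluckerIndex R) :=
  (familyIdeal s).toIdeal.restrictScalars R ⊔ Submodule.span R (pairMonomial R ''
    {m | ∑ i, letters m i = ∑ i, E i ∧ letterWeight (letters m) < letterWeight E})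

variable {s}

theorem mem_lowerSpan_of_mem_ideal {E : Fin 6 → ℕ} {x : MvPolynomial PluckerIndex R}
    (hx : x ∈ (familyIdeal s).toIdeal) : x ∈ lowerSpan s E :=
  Submodule.mem_sup_left hx

theorem pairMonomial_mem_lowerSpan {E : Fin 6 → ℕ} {m : LetterPair → ℕ}
    (h1 : ∑ i, letters m i = ∑ i, E i) (h2 : letterWeight (letters m) < letterWeight E) :
    pairMonomial R m ∈ lowerSpan s E := by
  refine Submodule.mem_sup_right (Submodule.subset_span ?_)
  exact Set.mem_image_of_mem _ ⟨h1, h2⟩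

theorem mul_pairMonomial_mem_lowerSpan {E : Fin 6 → ℕ} {x : MvPolynomial PluckerIndex R}
    (hx : x ∈ lowerSpan s E) (k : LetterPair → ℕ) :
    x * pairMonomial R k ∈ lowerSpan s (E + letters k) := by
  have h : lowerSpan s E ≤ (lowerSpan s (E + letters k)).comap
      (LinearMap.mulRight R (pairMonomial R k)) := by
    refine sup_le (fun y hy => ?_) (Submodule.span_le.mpr ?_)
    · rw [Submodule.mem_comap, LinearMap.mulRight_apply]
      exact mem_lowerSpan_of_mem_ideal (Ideal.mul_mem_right _ _ hy)
    rintro _ ⟨m, ⟨h1, h2⟩, rfl⟩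
    rw [SetLike.mem_coe, Submodule.mem_comap, LinearMap.mulRight_apply, ← pairMonomial_add]
    refine pairMonomial_mem_lowerSpan ?_ ?_
    · simp only [letters_add, Pi.add_apply, Finset.sum_add_distrib, h1]
    · rw [letters_add, letterWeight_add, letterWeight_add]
      omega
  have hx' := h hx
  rwa [Submodule.mem_comap, LinearMap.mulRight_apply] at hx'

variable (s)

theorem lowerSpan_C_mul_mem {E : Fin 6 → ℕ} (r : R) {e f : LetterPair}
    (h : ∑ i, letters (Pi.single e 1 + Pi.single f 1) i = ∑ i, E i ∧
      letterWeight (letters (Pi.single e 1 + Pi.single f 1)) < letterWeight E) :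
    C r * (pairCoord R e * pairCoord R f) ∈ lowerSpan s E := by
  rw [← smul_eq_C_mul, ← pairMonomial_single, ← pairMonomial_single, ← pairMonomial_add]
  exact Submodule.smul_mem _ _ (pairMonomial_mem_lowerSpan h.1 h.2)

theorem mem_lowerSpan_of_mk_eq {E : Fin 6 → ℕ} {x y : MvPolynomial PluckerIndex R}
    (h : Ideal.Quotient.mk (familyIdeal s).toIdeal x = Ideal.Quotient.mk (familyIdeal s).toIdeal y)
    (hy : y ∈ lowerSpan s E) : x ∈ lowerSpan s E := by
  have := add_mem (mem_lowerSpan_of_mem_ideal (Ideal.Quotient.eq.mp h)) hy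
  rwa [sub_add_cancel] at this

theorem mk_plucker (i j k l : Fin 7) :
    Ideal.Quotient.mk (familyIdeal s).toIdeal (genericEntry R i j) *
        Ideal.Quotient.mk (familyIdeal s).toIdeal (genericEntry R k l) -
      Ideal.Quotient.mk (familyIdeal s).toIdeal (genericEntry R i k) *
        Ideal.Quotient.mk (familyIdeal s).toIdeal (genericEntry R j l) +
      Ideal.Quotient.mk (familyIdeal s).toIdeal (genericEntry R i l) *
        Ideal.Quotient.mk (familyIdeal s).toIdeal (genericEntry R j k) = 0 := by
  simp only [← map_mul, ← map_sub, ← map_add]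
  exact Ideal.Quotient.eq_zero_iff_mem.mpr (Ideal.subset_span (Or.inl ⟨i, j, k, l, rfl⟩))

/-- The linear equations `p ∧ ω_s = 0`, solved for seven of the Plücker coordinates. -/
theorem mk_linear :
    letI q (i j : Fin 7) := Ideal.Quotient.mk (familyIdeal s).toIdeal (genericEntry R i j)
    letI c := Ideal.Quotient.mk (familyIdeal s).toIdeal (C s)
    q 1 2 = -q 3 6 ∧ q 0 2 = q 4 6 ∧ q 0 1 = -c * q 5 6 ∧ q 4 5 = -q 0 6 ∧ q 3 5 = q 1 6 ∧
      q 3 4 = -c * q 2 6 ∧ q 0 3 = -q 1 4 - c * q 2 5 := by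
  have h (x : MvPolynomial PluckerIndex R) (hx : x ∈ isotropyEquations s) :
      Ideal.Quotient.mk (familyIdeal s).toIdeal x = 0 :=
    Ideal.Quotient.eq_zero_iff_mem.mpr (Ideal.subset_span (Or.inr hx))
  simp only [isotropyEquations, Set.mem_insert_iff, Set.mem_singleton_iff, forall_eq_or_imp,
    forall_eq, map_add, map_sub, map_mul] at h
  obtain ⟨h1, h2, h3, h4, h5, h6, h7⟩ := h
  refine ⟨?_, ?_, ?_, ?_, ?_, ?_, ?_⟩
  · linear_combination h1
  · linear_combination h2
  · linear_combination h3
  · linear_combination h4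
  · linear_combination h5
  · linear_combination h6
  · linear_combination h7

/-- Every toric binomial is the leading part of a quadric in the ideal of the family. -/
theorem binomial_mem_lowerSpan {e f g h : LetterPair} (r : Binomial e f g h) :
    pairCoord R e * pairCoord R f - pairCoord R g * pairCoord R h ∈
      lowerSpan s (letters (Pi.single e 1 + Pi.single f 1)) := by
  obtain ⟨l12, l02, l01, l45, l35, l34, l03⟩ := mk_linear s
  have plu := mk_plucker s
  cases r with
  | sa_sa =>
    refine mem_lowerSpan_of_mk_eq s
      (y := C (s ^ 2) * (pairCoord R de * pairCoord R bc) +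
        C (-s) * (pairCoord R sc * pairCoord R ad) +
        C (-s) * (pairCoord R sb * pairCoord R ae)) ?_
      (add_mem (add_mem (lowerSpan_C_mul_mem s _ (by decide +kernel))
        (lowerSpan_C_mul_mem s _ (by decide +kernel)))
        (lowerSpan_C_mul_mem s _ (by decide +kernel)))
    simp only [pairCoord, map_sub, map_add, map_mul, map_neg, map_pow, map_one]
    have h1 := plu 0 1 3 4
    have h2 := plu 1 2 4 5
    simp only [l12, l02, l01, l45, l35, l34, l03] at h1 h2
    linear_combination h1 + Ideal.Quotient.mk _ (C s) * h2
  | ab_ss =>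
    refine mem_lowerSpan_of_mk_eq s
      (y := C (s) * (pairCoord R sd * pairCoord R bc) +
        C (s) * (pairCoord R sb * pairCoord R be)) ?_
      (add_mem (lowerSpan_C_mul_mem s _ (by decide +kernel))
        (lowerSpan_C_mul_mem s _ (by decide +kernel)))
    simp only [pairCoord, map_sub, map_add, map_mul, map_neg, map_pow, map_one]
    have h1 := plu 0 2 3 4
    simp only [l12, l02, l01, l45, l35, l34, l03] at h1
    linear_combination -h1
  | ac_ss =>
    refine mem_lowerSpan_of_mk_eq s
      (y := C (-s) * (pairCoord R sd * pairCoord R de)) ?_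
      (lowerSpan_C_mul_mem s _ (by decide +kernel))
    simp only [pairCoord, map_sub, map_add, map_mul, map_neg, map_pow, map_one]
    have h1 := plu 0 1 4 6
    simp only [l12, l02, l01, l45, l35, l34, l03] at h1
    linear_combination -h1
  | ad_ss =>
    refine mem_lowerSpan_of_mk_eq s
      (y := C (s) * (pairCoord R sd * pairCoord R be) +
        C (-s) * (pairCoord R sc * pairCoord R bc)) ?_
      (add_mem (lowerSpan_C_mul_mem s _ (by decide +kernel))
        (lowerSpan_C_mul_mem s _ (by decide +kernel)))
    simp only [pairCoord, map_sub, map_add, map_mul, map_neg, map_pow, map_one]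
    have h1 := plu 0 1 2 4
    have h2 := plu 2 4 5 6
    simp only [l12, l02, l01, l45, l35, l34, l03] at h1 h2
    linear_combination -h1 - Ideal.Quotient.mk _ (C s) * h2
  | ae_ss =>
    refine mem_lowerSpan_of_mk_eq s
      (y := C (-s) * (pairCoord R sc * pairCoord R de)) ?_
      (lowerSpan_C_mul_mem s _ (by decide +kernel))
    simp only [pairCoord, map_sub, map_add, map_mul, map_neg, map_pow, map_one]
    have h1 := plu 0 1 4 5
    simp only [l12, l02, l01, l45, l35, l34, l03] at h1
    linear_combination -h1
  | ab_sa =>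
    refine mem_lowerSpan_of_mk_eq s
      (y := C (s) * (pairCoord R ad * pairCoord R bc)) ?_
      (lowerSpan_C_mul_mem s _ (by decide +kernel))
    simp only [pairCoord, map_sub, map_add, map_mul, map_neg, map_pow, map_one]
    have h1 := plu 1 2 3 4
    simp only [l12, l02, l01, l45, l35, l34, l03] at h1
    linear_combination -h1
  | ac_sa =>
    refine mem_lowerSpan_of_mk_eq s
      (y := C (-s) * (pairCoord R ad * pairCoord R de) +
        C (-s) * (pairCoord R ac * pairCoord R be)) ?_
      (add_mem (lowerSpan_C_mul_mem s _ (by decide +kernel))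
        (lowerSpan_C_mul_mem s _ (by decide +kernel)))
    simp only [pairCoord, map_sub, map_add, map_mul, map_neg, map_pow, map_one]
    have h1 := plu 0 1 3 6
    simp only [l12, l02, l01, l45, l35, l34, l03] at h1
    linear_combination h1
  | ad_sa =>
    refine mem_lowerSpan_of_mk_eq s
      (y := C (-s) * (pairCoord R ac * pairCoord R bc)) ?_
      (lowerSpan_C_mul_mem s _ (by decide +kernel))
    simp only [pairCoord, map_sub, map_add, map_mul, map_neg, map_pow, map_one]
    have h1 := plu 0 1 2 3
    have h2 := plu 2 3 5 6
    simp only [l12, l02, l01, l45, l35, l34, l03] at h1 h2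
    linear_combination h1 + Ideal.Quotient.mk _ (C s) * h2
  | ae_sa =>
    refine mem_lowerSpan_of_mk_eq s
      (y := C (-s) * (pairCoord R ac * pairCoord R de) +
        C (-s) * (pairCoord R ae * pairCoord R be)) ?_
      (add_mem (lowerSpan_C_mul_mem s _ (by decide +kernel))
        (lowerSpan_C_mul_mem s _ (by decide +kernel)))
    simp only [pairCoord, map_sub, map_add, map_mul, map_neg, map_pow, map_one]
    have h1 := plu 0 1 3 5
    simp only [l12, l02, l01, l45, l35, l34, l03] at h1
    linear_combination h1
  | ab_sc =>
    refine mem_lowerSpan_of_mk_eq s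
      (y := C (s) * (pairCoord R be * pairCoord R bc)) ?_
      (lowerSpan_C_mul_mem s _ (by decide +kernel))
    simp only [pairCoord, map_sub, map_add, map_mul, map_neg, map_pow, map_one]
    have h1 := plu 0 2 3 6
    have h2 := plu 1 2 4 6
    simp only [l12, l02, l01, l45, l35, l34, l03] at h1 h2
    linear_combination -h1 - h2
  | ab_sd =>
    refine mem_lowerSpan_of_mk_eq s
      (y := C (s) * (pairCoord R bc * pairCoord R bc)) ?_
      (lowerSpan_C_mul_mem s _ (by decide +kernel))
    simp only [pairCoord, map_sub, map_add, map_mul, map_neg, map_pow, map_one]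
    have h1 := plu 2 3 4 6
    simp only [l12, l02, l01, l45, l35, l34, l03] at h1
    linear_combination h1
  | ab_se =>
    refine mem_lowerSpan_of_mk_eq s
      (y := C (s) * (pairCoord R be * pairCoord R be) +
        C (s) * (pairCoord R de * pairCoord R bc)) ?_
      (add_mem (lowerSpan_C_mul_mem s _ (by decide +kernel))
        (lowerSpan_C_mul_mem s _ (by decide +kernel)))
    simp only [pairCoord, map_sub, map_add, map_mul, map_neg, map_pow, map_one]
    have h1 := plu 0 2 3 5
    have h2 := plu 0 1 2 6
    have h3 := plu 1 2 4 5
    simp only [l12, l02, l01, l45, l35, l34, l03] at h1 h2 h3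
    linear_combination -h1 - h2 - h3
  | ac_sd =>
    refine mem_lowerSpan_of_mk_eq s
      (y := C (-s) * (pairCoord R de * pairCoord R bc)) ?_
      (lowerSpan_C_mul_mem s _ (by decide +kernel))
    simp only [pairCoord, map_sub, map_add, map_mul, map_neg, map_pow, map_one]
    have h1 := plu 0 1 2 6
    simp only [l12, l02, l01, l45, l35, l34, l03] at h1
    linear_combination h1
  | ac_se =>
    refine mem_lowerSpan_of_mk_eq s
      (y := C (-s) * (pairCoord R de * pairCoord R de)) ?_
      (lowerSpan_C_mul_mem s _ (by decide +kernel))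
    simp only [pairCoord, map_sub, map_add, map_mul, map_neg, map_pow, map_one]
    have h1 := plu 0 1 5 6
    simp only [l12, l02, l01, l45, l35, l34, l03] at h1
    linear_combination -h1
  | ad_se =>
    refine mem_lowerSpan_of_mk_eq s
      (y := C (s) * (pairCoord R de * pairCoord R be)) ?_
      (lowerSpan_C_mul_mem s _ (by decide +kernel))
    simp only [pairCoord, map_sub, map_add, map_mul, map_neg, map_pow, map_one]
    have h1 := plu 0 1 2 5
    simp only [l12, l02, l01, l45, l35, l34, l03] at h1
    linear_combination -h1
  | ss_de =>
    refine mem_lowerSpan_of_mk_eq s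
      (y := C (-1) * (pairCoord R sc * pairCoord R sc)) ?_
      (lowerSpan_C_mul_mem s _ (by decide +kernel))
    simp only [pairCoord, map_sub, map_add, map_mul, map_neg, map_pow, map_one]
    have h1 := plu 0 4 5 6
    simp only [l12, l02, l01, l45, l35, l34, l03] at h1
    linear_combination -h1
  | sa_de =>
    refine mem_lowerSpan_of_mk_eq s
      (y := C (-1) * (pairCoord R sc * pairCoord R ac)) ?_
      (lowerSpan_C_mul_mem s _ (by decide +kernel))
    simp only [pairCoord, map_sub, map_add, map_mul, map_neg, map_pow, map_one]
    have h1 := plu 0 3 5 6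
    have h2 := plu 0 1 2 5
    simp only [l12, l02, l01, l45, l35, l34, l03] at h1 h2
    linear_combination h1 - h2
  | aa_de =>
    refine mem_lowerSpan_of_mk_eq s
      (y := C (-1) * (pairCoord R ac * pairCoord R ac)) ?_
      (lowerSpan_C_mul_mem s _ (by decide +kernel))
    simp only [pairCoord, map_sub, map_add, map_mul, map_neg, map_pow, map_one]
    have h1 := plu 1 3 5 6
    simp only [l12, l02, l01, l45, l35, l34, l03] at h1
    linear_combination h1
  | ss_be =>
    refine mem_lowerSpan_of_mk_eq s
      (y := C (1) * (pairCoord R sc * pairCoord R sd)) ?_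
      (lowerSpan_C_mul_mem s _ (by decide +kernel))
    simp only [pairCoord, map_sub, map_add, map_mul, map_neg, map_pow, map_one]
    have h1 := plu 0 2 4 5
    simp only [l12, l02, l01, l45, l35, l34, l03] at h1
    linear_combination -h1
  | sa_be =>
    refine mem_lowerSpan_of_mk_eq s
      (y := C (1) * (pairCoord R sc * pairCoord R ad)) ?_
      (lowerSpan_C_mul_mem s _ (by decide +kernel))
    simp only [pairCoord, map_sub, map_add, map_mul, map_neg, map_pow, map_one]
    have h1 := plu 1 2 4 5
    simp only [l12, l02, l01, l45, l35, l34, l03] at h1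
    linear_combination -h1
  | aa_be =>
    refine mem_lowerSpan_of_mk_eq s
      (y := C (1) * (pairCoord R ac * pairCoord R ad)) ?_
      (lowerSpan_C_mul_mem s _ (by decide +kernel))
    simp only [pairCoord, map_sub, map_add, map_mul, map_neg, map_pow, map_one]
    have h1 := plu 1 2 3 5
    simp only [l12, l02, l01, l45, l35, l34, l03] at h1
    linear_combination h1
  | ss_bc =>
    refine mem_lowerSpan_of_mk_eq s
      (y := C (1) * (pairCoord R sd * pairCoord R sd)) ?_
      (lowerSpan_C_mul_mem s _ (by decide +kernel))
    simp only [pairCoord, map_sub, map_add, map_mul, map_neg, map_pow, map_one]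
    have h1 := plu 0 2 4 6
    simp only [l12, l02, l01, l45, l35, l34, l03] at h1
    linear_combination -h1
  | sa_bc =>
    refine mem_lowerSpan_of_mk_eq s
      (y := C (1) * (pairCoord R sd * pairCoord R ad)) ?_
      (lowerSpan_C_mul_mem s _ (by decide +kernel))
    simp only [pairCoord, map_sub, map_add, map_mul, map_neg, map_pow, map_one]
    have h1 := plu 1 2 4 6
    simp only [l12, l02, l01, l45, l35, l34, l03] at h1
    linear_combination -h1
  | aa_bc =>
    refine mem_lowerSpan_of_mk_eq s
      (y := C (1) * (pairCoord R ad * pairCoord R ad)) ?_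
      (lowerSpan_C_mul_mem s _ (by decide +kernel))
    simp only [pairCoord, map_sub, map_add, map_mul, map_neg, map_pow, map_one]
    have h1 := plu 1 2 3 6
    simp only [l12, l02, l01, l45, l35, l34, l03] at h1
    linear_combination h1
  | sb_de =>
    refine mem_lowerSpan_of_mk_eq s
      (y := C (-1) * (pairCoord R sc * pairCoord R bc)) ?_
      (lowerSpan_C_mul_mem s _ (by decide +kernel))
    simp only [pairCoord, map_sub, map_add, map_mul, map_neg, map_pow, map_one]
    have h1 := plu 2 4 5 6
    simp only [l12, l02, l01, l45, l35, l34, l03] at h1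
    linear_combination -h1
  | ab_de =>
    refine mem_lowerSpan_of_mk_eq s
      (y := C (-1) * (pairCoord R ac * pairCoord R bc)) ?_
      (lowerSpan_C_mul_mem s _ (by decide +kernel))
    simp only [pairCoord, map_sub, map_add, map_mul, map_neg, map_pow, map_one]
    have h1 := plu 2 3 5 6
    simp only [l12, l02, l01, l45, l35, l34, l03] at h1
    linear_combination h1
  | se_bc =>
    refine mem_lowerSpan_of_mk_eq s
      (y := C (1) * (pairCoord R sd * pairCoord R de)) ?_
      (lowerSpan_C_mul_mem s _ (by decide +kernel))
    simp only [pairCoord, map_sub, map_add, map_mul, map_neg, map_pow, map_one]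
    have h1 := plu 0 2 5 6
    simp only [l12, l02, l01, l45, l35, l34, l03] at h1
    linear_combination -h1
  | ae_bc =>
    refine mem_lowerSpan_of_mk_eq s
      (y := C (1) * (pairCoord R ad * pairCoord R de)) ?_
      (lowerSpan_C_mul_mem s _ (by decide +kernel))
    simp only [pairCoord, map_sub, map_add, map_mul, map_neg, map_pow, map_one]
    have h1 := plu 1 2 5 6
    simp only [l12, l02, l01, l45, l35, l34, l03] at h1
    linear_combination -h1

end Straightening

section Straightening

set_option linter.unusedSimpArgs false

open MvPolynomial LetterPair

variable {R : Type} [CommRing R] (s : R)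

/-- Congruence of monomials with the same letters modulo `lowerSpan`. -/
def straighteningCon : AddCon (LetterPair → ℕ) where
  r m m' := letters m = letters m' ∧
    pairMonomial R m - pairMonomial R m' ∈ lowerSpan s (letters m)
  iseqv :=
    { refl := fun m => ⟨rfl, by rw [sub_self]; exact zero_mem _⟩
      symm := fun {m m'} h => ⟨h.1.symm, by
        rw [← h.1, ← neg_sub]
        exact neg_mem h.2⟩
      trans := fun {m m' m''} h h' => ⟨h.1.trans h'.1, by
        have h2 := h'.2
        rw [← h.1] at h2
        have h3 := add_mem h.2 h2
        rwa [sub_add_sub_cancel] at h3⟩ }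
  add' := by
    rintro m m' k k' ⟨h1, h2⟩ ⟨h3, h4⟩
    refine ⟨by rw [letters_add, letters_add, h1, h3], ?_⟩
    have h5 := mul_pairMonomial_mem_lowerSpan h2 k
    have h6 := mul_pairMonomial_mem_lowerSpan h4 m'
    rw [← h1, add_comm] at h6
    rw [letters_add, pairMonomial_add, pairMonomial_add]
    have h7 := add_mem h5 h6
    convert h7 using 1
    ring

theorem pairMonomial_sub_mem_lowerSpan {m m' : LetterPair → ℕ} (h : letters m = letters m') :
    pairMonomial R m - pairMonomial R m' ∈ lowerSpan s (letters m) := by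
  refine (con_of_letters_eq (c := straighteningCon s) (fun e f g h r => ?_) h
    fun m m' h => h.1).2
  refine ⟨r.letters_eq, ?_⟩
  rw [pairMonomial_add, pairMonomial_add, pairMonomial_single, pairMonomial_single,
    pairMonomial_single, pairMonomial_single]
  exact binomial_mem_lowerSpan s r

/-- A chosen factorization into letter pairs of a monomial in the letters. -/
def letterRep (E : Set.range letters) : LetterPair → ℕ :=
  E.2.choose

theorem letters_letterRep (E : Set.range letters) : letters (letterRep E) = E :=
  E.2.choose_spec

variable (R) in
/-- The basis monomial of the coordinate ring with given exponents of the letters. -/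
def basisMonomial (E : Set.range letters) : MvPolynomial PluckerIndex R :=
  pairMonomial R (letterRep E)

theorem pairMonomial_mem_ideal_sup_span (m : LetterPair → ℕ) :
    pairMonomial R m ∈ (familyIdeal s).toIdeal.restrictScalars R ⊔
      Submodule.span R (Set.range (basisMonomial R)) := by
  induction hw : letterWeight (letters m) using Nat.strong_induction_on generalizing m with
  | _ w ih =>
    have h1 := pairMonomial_sub_mem_lowerSpan s (letters_letterRep ⟨_, m, rfl⟩).symm
    have h2 : lowerSpan s (letters m) ≤ (familyIdeal s).toIdeal.restrictScalars R ⊔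
        Submodule.span R (Set.range (basisMonomial R)) := by
      refine sup_le le_sup_left (Submodule.span_le.mpr ?_)
      rintro _ ⟨m', ⟨-, hm'⟩, rfl⟩
      exact ih _ (hw ▸ hm') m' rfl
    have h3 : basisMonomial R ⟨_, m, rfl⟩ ∈ (familyIdeal s).toIdeal.restrictScalars R ⊔
        Submodule.span R (Set.range (basisMonomial R)) :=
      Submodule.mem_sup_right (Submodule.subset_span ⟨_, rfl⟩)
    have h4 := add_mem (h2 h1) h3
    rwa [basisMonomial, sub_add_cancel] at h4

theorem X_mem_ideal_sup_span (a : PluckerIndex) :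
    (X a : MvPolynomial PluckerIndex R) ∈ (familyIdeal s).toIdeal.restrictScalars R ⊔
      Submodule.span R (Set.range (pairCoord R)) := by
  have key (x y : MvPolynomial PluckerIndex R)
      (h : Ideal.Quotient.mk (familyIdeal s).toIdeal x =
        Ideal.Quotient.mk (familyIdeal s).toIdeal y)
      (hy : y ∈ Submodule.span R (Set.range (pairCoord R))) :
      x ∈ (familyIdeal s).toIdeal.restrictScalars R ⊔
        Submodule.span R (Set.range (pairCoord R)) := by
    have h1 : x - y ∈ (familyIdeal s).toIdeal.restrictScalars R := Ideal.Quotient.eq.mp h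
    have h2 := add_mem (Submodule.mem_sup_left h1) (Submodule.mem_sup_right hy)
    rwa [sub_add_cancel] at h2
  have hp (e : LetterPair) : pairCoord R e ∈ Submodule.span R (Set.range (pairCoord R)) :=
    Submodule.subset_span ⟨e, rfl⟩
  have hC (r : R) (e : LetterPair) :
      C r * pairCoord R e ∈ Submodule.span R (Set.range (pairCoord R)) := by
    rw [← smul_eq_C_mul]
    exact Submodule.smul_mem _ _ (hp e)
  obtain ⟨l12, l02, l01, l45, l35, l34, l03⟩ := mk_linear s
  obtain ⟨⟨i, j⟩, hij⟩ := a
  change i < j at hij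
  have hX : (X ⟨(i, j), hij⟩ : MvPolynomial PluckerIndex R) = genericEntry R i j := by
    rw [genericEntry, dif_pos hij]
  rw [hX]
  clear hX
  fin_cases i
  · fin_cases j
    · exact absurd hij (by decide)
    · refine key _ (C s * pairCoord R .de) ?_ (hC s _)
      simp only [pairCoord, map_mul, map_neg, map_sub, neg_neg]
      exact l01.trans (by ring)
    · refine key _ (-pairCoord R .sd) ?_ (neg_mem (hp _))
      simp only [pairCoord, map_mul, map_neg, map_sub, neg_neg]
      exact l02
    · refine key _ (-pairCoord R .sa - C s * pairCoord R .be) ?_ (sub_mem (neg_mem (hp _)) (hC s _))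
      simp only [pairCoord, map_mul, map_neg, map_sub, neg_neg]
      exact l03
    · exact Submodule.mem_sup_right (hp .ss)
    · exact Submodule.mem_sup_right (hp .se)
    · exact Submodule.mem_sup_right (hp .sc)
  · fin_cases j
    · exact absurd hij (by decide)
    · exact absurd hij (by decide)
    · refine key _ (-pairCoord R .ad) ?_ (neg_mem (hp _))
      simp only [pairCoord, map_mul, map_neg, map_sub, neg_neg]
      exact l12
    · exact key _ (-pairCoord R .aa) (by simp [pairCoord]) (neg_mem (hp _))
    · exact Submodule.mem_sup_right (hp .sa)
    · exact Submodule.mem_sup_right (hp .ae)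
    · exact Submodule.mem_sup_right (hp .ac)
  · fin_cases j
    · exact absurd hij (by decide)
    · exact absurd hij (by decide)
    · exact absurd hij (by decide)
    · exact key _ (-pairCoord R .ab) (by simp [pairCoord]) (neg_mem (hp _))
    · exact Submodule.mem_sup_right (hp .sb)
    · exact Submodule.mem_sup_right (hp .be)
    · exact Submodule.mem_sup_right (hp .bc)
  · fin_cases j
    · exact absurd hij (by decide)
    · exact absurd hij (by decide)
    · exact absurd hij (by decide)
    · exact absurd hij (by decide)
    · refine key _ (-(C s * pairCoord R .bc)) ?_ (neg_mem (hC s _))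
      simp only [pairCoord, map_mul, map_neg, map_sub, neg_neg]
      exact l34.trans (by ring)
    · refine key _ (pairCoord R .ac) ?_ (hp _)
      simp only [pairCoord, map_mul, map_neg, map_sub, neg_neg]
      exact l35
    · exact Submodule.mem_sup_right (hp .ad)
  · fin_cases j
    · exact absurd hij (by decide)
    · exact absurd hij (by decide)
    · exact absurd hij (by decide)
    · exact absurd hij (by decide)
    · exact absurd hij (by decide)
    · refine key _ (-pairCoord R .sc) ?_ (neg_mem (hp _))
      simp only [pairCoord, map_mul, map_neg, map_sub, neg_neg]
      exact l45
    · exact key _ (-pairCoord R .sd) (by simp [pairCoord]) (neg_mem (hp _))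
  · fin_cases j
    · exact absurd hij (by decide)
    · exact absurd hij (by decide)
    · exact absurd hij (by decide)
    · exact absurd hij (by decide)
    · exact absurd hij (by decide)
    · exact absurd hij (by decide)
    · exact key _ (-pairCoord R .de) (by simp [pairCoord]) (neg_mem (hp _))
  · fin_cases j
    · exact absurd hij (by decide)
    · exact absurd hij (by decide)
    · exact absurd hij (by decide)
    · exact absurd hij (by decide)
    · exact absurd hij (by decide)
    · exact absurd hij (by decide)
    · exact absurd hij (by decide)

/-- The basis monomials span the coordinate ring of the family, over every base ring and for every
value of the parameter. -/
theorem ideal_sup_span_eq_top : (familyIdeal s).toIdeal.restrictScalars R ⊔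
    Submodule.span R (Set.range (basisMonomial R)) = ⊤ := by
  set T := (familyIdeal s).toIdeal.restrictScalars R ⊔
    Submodule.span R (Set.range (basisMonomial R)) with hT
  have hmulI (x y : MvPolynomial PluckerIndex R) (hx : x ∈ (familyIdeal s).toIdeal) : x * y ∈ T :=
    Submodule.mem_sup_left (Ideal.mul_mem_right _ _ hx)
  have hmul (x : MvPolynomial PluckerIndex R) (hx : x ∈ T) (a : PluckerIndex) : x * X a ∈ T := by
    have h1 (e : LetterPair) : x * pairCoord R e ∈ T := by
      have h2 : T ≤ T.comap (LinearMap.mulRight R (pairCoord R e)) := by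
        refine sup_le (fun y hy => ?_) (Submodule.span_le.mpr ?_)
        · rw [Submodule.mem_comap, LinearMap.mulRight_apply]
          exact hmulI _ _ hy
        rintro _ ⟨E, rfl⟩
        rw [SetLike.mem_coe, Submodule.mem_comap, LinearMap.mulRight_apply, basisMonomial,
          ← pairMonomial_single, ← pairMonomial_add]
        exact pairMonomial_mem_ideal_sup_span s _
      have h3 := h2 hx
      rwa [Submodule.mem_comap, LinearMap.mulRight_apply] at h3
    have h2 : (familyIdeal s).toIdeal.restrictScalars R ⊔
        Submodule.span R (Set.range (pairCoord R)) ≤ T.comap (LinearMap.mulLeft R x) := by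
      refine sup_le (fun y hy => ?_) (Submodule.span_le.mpr ?_)
      · rw [Submodule.mem_comap, LinearMap.mulLeft_apply, mul_comm]
        exact hmulI _ _ hy
      rintro _ ⟨e, rfl⟩
      rw [SetLike.mem_coe, Submodule.mem_comap, LinearMap.mulLeft_apply]
      exact h1 e
    have h3 := h2 (X_mem_ideal_sup_span s a)
    rwa [Submodule.mem_comap, LinearMap.mulLeft_apply] at h3
  rw [eq_top_iff]
  rintro x -
  induction x using MvPolynomial.induction_on with
  | C r =>
    have h := pairMonomial_mem_ideal_sup_span s 0
    rw [pairMonomial_zero] at h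
    have h2 := Submodule.smul_mem T r h
    rwa [smul_eq_C_mul, mul_one] at h2
  | add x y hx hy => exact add_mem hx hy
  | mul_X x a hx => exact hmul x hx a

end Straightening

/-! ### A chart of the family -/

section Chart

open MvPolynomial LetterPair

variable {R : Type} [CommRing R] (s : R)

/-- The first vector of a parametrized family of planes isotropic for `ω_s`, with parameters the
letters `s, a, b, c, d, e`, here the variables with indices `0, …, 5`. -/
def chartFst : Fin 7 → MvPolynomial (Fin 6) R :=
  ![X 0 ^ 2, X 0 * X 1, X 0 * X 2, -(C s * (X 2 * X 3 + X 4 ^ 2)), 0, X 0 * X 3, X 0 * X 4]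

/-- The second vector of the parametrized family of isotropic planes. -/
def chartSnd : Fin 7 → MvPolynomial (Fin 6) R :=
  ![0, -(C s * (X 3 ^ 2 - X 4 * X 5)), -(X 0 * X 4), -(X 0 * X 1) - C s * (X 2 * X 5 + X 3 * X 4),
    X 0 ^ 2, X 0 * X 5, X 0 * X 3]

/-- The Plücker coordinates of the parametrized family of isotropic planes. -/
def chartEntry (i j : Fin 7) : MvPolynomial (Fin 6) R :=
  chartFst s i * chartSnd s j - chartFst s j * chartSnd s i

/-- Restriction of polynomials in the Plücker coordinates to the chart. -/
def chartHom : MvPolynomial PluckerIndex R →ₐ[R] MvPolynomial (Fin 6) R :=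
  aeval fun a => chartEntry s a.1.1 a.1.2

theorem chartHom_genericEntry (i j : Fin 7) :
    chartHom s (genericEntry R i j) = chartEntry s i j := by
  unfold genericEntry
  split_ifs with h1 h2
  · rw [chartHom, aeval_X]
  · rw [map_neg, chartHom, aeval_X, chartEntry, chartEntry]
    ring
  · obtain rfl : i = j := le_antisymm (not_lt.mp h2) (not_lt.mp h1)
    rw [map_zero, chartEntry, sub_self]

theorem chartHom_eq_zero_of_mem {f : MvPolynomial PluckerIndex R}
    (hf : f ∈ (familyIdeal s).toIdeal) : chartHom s f = 0 := by
  suffices h : (familyIdeal s).toIdeal ≤ RingHom.ker (chartHom s) from h hf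
  refine Ideal.span_le.mpr ?_
  rintro f (⟨i, j, k, l, rfl⟩ | hf)
  · simp only [SetLike.mem_coe, RingHom.mem_ker, map_add, map_sub, map_mul, chartHom_genericEntry,
      chartEntry]
    ring
  · simp only [isotropyEquations, Set.mem_insert_iff, Set.mem_singleton_iff] at hf
    have hC : chartHom s (C s) = C s := by rw [← algebraMap_eq, AlgHom.commutes, algebraMap_eq]
    rw [SetLike.mem_coe, RingHom.mem_ker]
    rcases hf with rfl | rfl | rfl | rfl | rfl | rfl | rfl <;>
    simp only [map_add, map_sub, map_mul, chartHom_genericEntry, chartEntry, chartFst, chartSnd, hC,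
      Matrix.cons_val] <;> ring

/-- The polynomial `f` has leading monomial `E`, with coefficient one, and all its other monomials
have smaller weight. -/
def HasLeading (f : MvPolynomial (Fin 6) R) (E : Fin 6 →₀ ℕ) : Prop :=
  coeff E f = 1 ∧ ∀ d, coeff d f ≠ 0 → d = E ∨ letterWeight d < letterWeight E

/-- All monomials of `f` have weight at most `w`. -/
def WeightLE (f : MvPolynomial (Fin 6) R) (w : ℕ) : Prop :=
  ∀ d, coeff d f ≠ 0 → letterWeight d ≤ w

theorem WeightLE.mono {f : MvPolynomial (Fin 6) R} {w w' : ℕ} (h : WeightLE f w) (hw : w ≤ w') :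
    WeightLE f w' :=
  fun d hd => (h d hd).trans hw

theorem WeightLE.add {f g : MvPolynomial (Fin 6) R} {w : ℕ} (hf : WeightLE f w)
    (hg : WeightLE g w) : WeightLE (f + g) w := by
  intro d hd
  rw [coeff_add] at hd
  by_cases h : coeff d f = 0
  · exact hg d (by rintro h'; exact hd (by rw [h, h', add_zero]))
  · exact hf d h

theorem WeightLE.neg {f : MvPolynomial (Fin 6) R} {w : ℕ} (hf : WeightLE f w) :
    WeightLE (-f) w := by
  intro d hd
  rw [coeff_neg] at hd
  exact hf d (neg_ne_zero.mp hd)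

theorem WeightLE.sub {f g : MvPolynomial (Fin 6) R} {w : ℕ} (hf : WeightLE f w)
    (hg : WeightLE g w) : WeightLE (f - g) w := by
  rw [sub_eq_add_neg]
  exact hf.add hg.neg

theorem exists_of_coeff_mul_ne_zero {f g : MvPolynomial (Fin 6) R} {d : Fin 6 →₀ ℕ}
    (h : coeff d (f * g) ≠ 0) : ∃ d1 d2, d1 + d2 = d ∧ coeff d1 f ≠ 0 ∧ coeff d2 g ≠ 0 := by
  rw [coeff_mul] at h
  obtain ⟨⟨d1, d2⟩, hd, h⟩ := Finset.exists_ne_zero_of_sum_ne_zero h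
  exact ⟨d1, d2, Finset.HasAntidiagonal.mem_antidiagonal.mp hd, left_ne_zero_of_mul h,
    right_ne_zero_of_mul h⟩

theorem WeightLE.mul {f g : MvPolynomial (Fin 6) R} {w w' : ℕ} (hf : WeightLE f w)
    (hg : WeightLE g w') : WeightLE (f * g) (w + w') := by
  intro d hd
  obtain ⟨d1, d2, rfl, h1, h2⟩ := exists_of_coeff_mul_ne_zero hd
  rw [Finsupp.coe_add, letterWeight_add]
  exact add_le_add (hf d1 h1) (hg d2 h2)

theorem WeightLE.C (r : R) : WeightLE (C r) 0 := by
  intro d hd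
  rw [coeff_C] at hd
  obtain rfl : 0 = d := by_contra fun h => hd (if_neg h)
  exact le_rfl

theorem WeightLE.X (i : Fin 6) :
    WeightLE (X i : MvPolynomial (Fin 6) R) (![0, 4, 1, 0, 0, 1] i) := by
  intro d hd
  rw [coeff_X] at hd
  obtain rfl : Finsupp.single i 1 = d := by_contra fun h => hd (if_neg h)
  fin_cases i <;> simp [letterWeight]

theorem HasLeading.one : HasLeading (1 : MvPolynomial (Fin 6) R) 0 := by
  refine ⟨by simp, fun d hd => Or.inl ?_⟩
  rw [coeff_one] at hd
  exact (by_contra fun h => hd (if_neg h) : 0 = d).symm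

theorem HasLeading.X (i : Fin 6) :
    HasLeading (X i : MvPolynomial (Fin 6) R) (Finsupp.single i 1) := by
  refine ⟨by simp, fun d hd => Or.inl ?_⟩
  rw [coeff_X] at hd
  exact (by_contra fun h => hd (if_neg h) : Finsupp.single i 1 = d).symm

theorem HasLeading.add_lower {f g : MvPolynomial (Fin 6) R} {E : Fin 6 →₀ ℕ} {w : ℕ}
    (hf : HasLeading f E) (hg : WeightLE g w) (hw : w < letterWeight E) : HasLeading (f + g) E := by
  have h0 : coeff E g = 0 := by
    by_contra h
    exact absurd (hg E h) (not_le.mpr hw)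
  refine ⟨by rw [coeff_add, hf.1, h0, add_zero], fun d hd => ?_⟩
  rw [coeff_add] at hd
  by_cases h : coeff d g = 0
  · rw [h, add_zero] at hd
    exact hf.2 d hd
  · exact Or.inr ((hg d h).trans_lt hw)

theorem HasLeading.mul {f g : MvPolynomial (Fin 6) R} {E E' : Fin 6 →₀ ℕ} (hf : HasLeading f E)
    (hg : HasLeading g E') : HasLeading (f * g) (E + E') := by
  constructor
  · rw [coeff_mul, Finset.sum_eq_single (E, E')]
    · rw [hf.1, hg.1, one_mul]
    · rintro ⟨d1, d2⟩ hd hne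
      by_contra h
      have h1 := hf.2 d1 (left_ne_zero_of_mul h)
      have h2 := hg.2 d2 (right_ne_zero_of_mul h)
      have h3 : d1 + d2 = E + E' := Finset.HasAntidiagonal.mem_antidiagonal.mp hd
      have h4 := congrArg (fun d : Fin 6 →₀ ℕ => letterWeight d) h3
      simp only [Finsupp.coe_add, letterWeight_add] at h4
      rcases h1 with rfl | h1
      · exact hne (by rw [add_left_cancel h3])
      · rcases h2 with rfl | h2 <;> omega
    · intro h
      rw [Finset.HasAntidiagonal.mem_antidiagonal] at h
      exact absurd rfl h
  · intro d hd
    obtain ⟨d1, d2, rfl, h1, h2⟩ := exists_of_coeff_mul_ne_zero hd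
    rw [Finsupp.coe_add, Finsupp.coe_add, letterWeight_add, letterWeight_add]
    rcases hf.2 d1 h1 with rfl | h1
    · rcases hg.2 d2 h2 with rfl | h2
      · exact Or.inl rfl
      · right; omega
    · rcases hg.2 d2 h2 with rfl | h2 <;> (right; omega)

theorem HasLeading.pow {f : MvPolynomial (Fin 6) R} {E : Fin 6 →₀ ℕ} (hf : HasLeading f E) (n : ℕ) :
    HasLeading (f ^ n) (n • E) := by
  induction n with
  | zero => simpa using HasLeading.one
  | succ n ih => simpa [pow_succ, add_smul] using ih.mul hf

theorem HasLeading.prod {ι : Type} (t : Finset ι) {f : ι → MvPolynomial (Fin 6) R}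
    {E : ι → Fin 6 →₀ ℕ} (h : ∀ i, HasLeading (f i) (E i)) :
    HasLeading (∏ i ∈ t, f i) (∑ i ∈ t, E i) := by
  classical
  induction t using Finset.induction_on with
  | empty => simpa using HasLeading.one
  | insert i t hi ih =>
    rw [Finset.prod_insert hi, Finset.sum_insert hi]
    exact (h i).mul ih

/-- Polynomials with distinct leading monomials are linearly independent. -/
theorem linearIndependent_of_hasLeading [Nontrivial R] {ι : Type} {f : ι → MvPolynomial (Fin 6) R}
    {E : ι → Fin 6 →₀ ℕ} (h : ∀ i, HasLeading (f i) (E i)) (hE : Function.Injective E) :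
    LinearIndependent R f := by
  rw [linearIndependent_iff]
  intro l hl
  by_contra hne
  obtain ⟨i, hi, hmax⟩ := Finset.exists_max_image l.support (fun i => letterWeight (E i))
    (Finsupp.support_nonempty_iff.mpr hne)
  have h1 := congrArg (coeff (E i)) hl
  rw [Finsupp.linearCombination_apply, Finsupp.sum, coeff_sum, coeff_zero,
    Finset.sum_eq_single i] at h1
  · rw [coeff_smul, (h i).1, smul_eq_mul, mul_one] at h1
    exact Finsupp.mem_support_iff.mp hi h1
  · intro j hj hji
    rw [coeff_smul]
    by_contra h2
    rcases (h j).2 (E i) (right_ne_zero_of_mul h2) with h3 | h3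
    · exact hji (hE h3.symm)
    · exact absurd (hmax j hj) (not_le.mpr h3)
  · exact fun h2 => absurd hi h2

/-- The leading exponents of the restriction of a monomial to the chart. -/
def chartExponent (E : Fin 6 → ℕ) : Fin 6 →₀ ℕ :=
  Finsupp.equivFunOnFinite.symm fun i => E i + if i = 0 then ∑ j, E j else 0

theorem chartExponent_add (E E' : Fin 6 → ℕ) :
    chartExponent (E + E') = chartExponent E + chartExponent E' := by
  ext i
  simp only [chartExponent, Finsupp.equivFunOnFinite_symm_apply_apply, Finsupp.coe_add,
    Pi.add_apply, Finset.sum_add_distrib]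
  split_ifs <;> ring

theorem chartExponent_injective : Function.Injective chartExponent := by
  intro E E' h
  have h1 (i : Fin 6) : E i + (if i = 0 then ∑ j, E j else 0) =
      E' i + if i = 0 then ∑ j, E' j else 0 :=
    DFunLike.congr_fun h i
  have h2 (i : Fin 6) (hi : i ≠ 0) : E i = E' i := by simpa [hi] using h1 i
  have h3 : E 0 = E' 0 := by
    have := h1 0
    simp only [if_true, Fin.sum_univ_six] at this
    have a1 := h2 1 (by decide)
    have a2 := h2 2 (by decide)
    have a3 := h2 3 (by decide)
    have a4 := h2 4 (by decide)
    have a5 := h2 5 (by decide)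
    omega
  ext i
  by_cases hi : i = 0
  · rw [hi, h3]
  · exact h2 i hi

theorem hasLeading_X_zero_sq_mul (i j : Fin 6) {E : Fin 6 → ℕ} (hE : ∑ k, E k = 2)
    (h : ∀ k, E k = (if i = k then 1 else 0) + if j = k then 1 else 0) :
    HasLeading (X 0 ^ 2 * (X i * X j) : MvPolynomial (Fin 6) R) (chartExponent E) := by
  have h1 := ((HasLeading.X (R := R) 0).pow 2).mul ((HasLeading.X i).mul (HasLeading.X j))
  convert h1 using 1
  ext k
  simp only [chartExponent, Finsupp.equivFunOnFinite_symm_apply_apply, Finsupp.coe_add,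
    Pi.add_apply, Finsupp.coe_smul, Pi.smul_apply, Finsupp.single_apply, h k, hE,
    eq_comm (a := k), smul_eq_mul]
  split_ifs <;> rfl

/-- The labels of the fourteen coordinates name their leading monomials in the chart, up to a factor
`s²`. -/
theorem hasLeading_chartHom_pairCoord (e : LetterPair) :
    HasLeading (chartHom s (pairCoord R e)) (chartExponent (letters (Pi.single e 1))) := by
  have lead {e : LetterPair} (i j : Fin 6) {f g : MvPolynomial (Fin 6) R} {w : ℕ}
      (hfg : f = X 0 ^ 2 * (X i * X j) + g) (hg : WeightLE g w)
      (h : ∀ k, letters (Pi.single e 1) k = (if i = k then 1 else 0) + if j = k then 1 else 0)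
      (hw : w < letterWeight (letters (Pi.single e 1))) :
      HasLeading f (chartExponent (letters (Pi.single e 1))) := by
    rw [hfg]
    refine (hasLeading_X_zero_sq_mul i j ?_ h).add_lower hg ?_
    · cases e <;> decide
    · refine hw.trans_le ?_
      simp [letterWeight, chartExponent]
  have lead' {e : LetterPair} (i j : Fin 6) {f : MvPolynomial (Fin 6) R}
      (hfg : f = X 0 ^ 2 * (X i * X j))
      (h : ∀ k, letters (Pi.single e 1) k = (if i = k then 1 else 0) + if j = k then 1 else 0) :
      HasLeading f (chartExponent (letters (Pi.single e 1))) := by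
    rw [hfg]
    refine hasLeading_X_zero_sq_mul i j ?_ h
    cases e <;> decide
  have x0 := WeightLE.X (R := R) 0
  have x1 := WeightLE.X (R := R) 1
  have x2 := WeightLE.X (R := R) 2
  have x3 := WeightLE.X (R := R) 3
  have x4 := WeightLE.X (R := R) 4
  have x5 := WeightLE.X (R := R) 5
  have hC := WeightLE.C (R := R) s
  have q1 : WeightLE (X 3 * X 3 - X 4 * X 5 : MvPolynomial (Fin 6) R) 1 :=
    ((x3.mul x3).mono (by decide)).sub ((x4.mul x5).mono (by decide))
  have q2 : WeightLE (X 2 * X 3 + X 4 * X 4 : MvPolynomial (Fin 6) R) 1 :=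
    ((x2.mul x3).mono (by decide)).add ((x4.mul x4).mono (by decide))
  have q3 : WeightLE (X 2 * X 5 + X 3 * X 4 : MvPolynomial (Fin 6) R) 2 :=
    ((x2.mul x5).mono (by decide)).add ((x3.mul x4).mono (by decide))
  cases e <;> simp only [pairCoord, map_neg, chartHom_genericEntry, chartEntry, chartFst, chartSnd,
    Matrix.cons_val]
  case ss => exact lead' 0 0 (by ring) (by decide)
  case sa => exact lead' 0 1 (by ring) (by decide)
  case sb => exact lead' 0 2 (by ring) (by decide)
  case sc => exact lead' 0 3 (by ring) (by decide)
  case sd => exact lead' 0 4 (by ring) (by decide)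
  case se => exact lead' 0 5 (by ring) (by decide)
  case de =>
    exact lead 4 5 (g := -(X 0 * X 0 * (X 3 * X 3))) (by ring)
      ((x0.mul x0).mul (x3.mul x3)).neg (by decide) (by decide)
  case be =>
    exact lead 2 5 (g := X 0 * X 0 * (X 3 * X 4)) (by ring)
      ((x0.mul x0).mul (x3.mul x4)) (by decide) (by decide)
  case bc =>
    exact lead 2 3 (g := X 0 * X 0 * (X 4 * X 4)) (by ring)
      ((x0.mul x0).mul (x4.mul x4)) (by decide) (by decide)
  case ac =>
    exact lead 1 3 (g := C s * (X 0 * X 4) * (X 3 * X 3 - X 4 * X 5)) (by ring)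
      ((hC.mul (x0.mul x4)).mul q1) (by decide) (by decide)
  case ad =>
    exact lead 1 4 (g := -(C s * (X 0 * X 2) * (X 3 * X 3 - X 4 * X 5))) (by ring)
      ((hC.mul (x0.mul x2)).mul q1).neg (by decide) (by decide)
  case ae =>
    exact lead 1 5 (g := C s * (X 0 * X 3) * (X 3 * X 3 - X 4 * X 5)) (by ring)
      ((hC.mul (x0.mul x3)).mul q1) (by decide) (by decide)
  case ab =>
    exact lead 1 2 (g := C s * (X 0 * X 2) * (X 2 * X 5 + X 3 * X 4) +
      C s * (X 0 * X 4) * (X 2 * X 3 + X 4 * X 4)) (by ring)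
      (((hC.mul (x0.mul x2)).mul q3).add (((hC.mul (x0.mul x4)).mul q2).mono (by decide)))
      (by decide) (by decide)
  case aa =>
    exact lead 1 1 (g := C s * (X 0 * X 1) * (X 2 * X 5 + X 3 * X 4) +
      C s * C s * ((X 2 * X 3 + X 4 * X 4) * (X 3 * X 3 - X 4 * X 5))) (by ring)
      (((hC.mul (x0.mul x1)).mul q3).add (((hC.mul hC).mul (q2.mul q1)).mono (by decide)))
      (by decide) (by decide)

theorem chartExponent_zero : chartExponent 0 = 0 := by
  ext i
  simp [chartExponent]

theorem hasLeading_chartHom_pairMonomial (m : LetterPair → ℕ) :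
    HasLeading (chartHom s (pairMonomial R m)) (chartExponent (letters m)) := by
  have h := HasLeading.prod Finset.univ fun e => (hasLeading_chartHom_pairCoord s e).pow (m e)
  have h1 : ∑ e, m e • chartExponent (letters (Pi.single e 1)) = chartExponent (letters m) := by
    let φ : (LetterPair → ℕ) →+ (Fin 6 →₀ ℕ) :=
      { toFun := fun m => chartExponent (letters m)
        map_zero' := by rw [letters_zero, chartExponent_zero]
        map_add' := fun m m' => by rw [letters_add, chartExponent_add] }
    calc ∑ e, m e • chartExponent (letters (Pi.single e 1))
        = ∑ e, m e • φ (Pi.single e 1) := rfl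
      _ = φ (∑ e, m e • Pi.single e 1) := by simp only [map_sum, map_nsmul]
      _ = φ m := by
        congr 1
        ext e
        simp [Finset.sum_apply, Pi.single_apply]
      _ = chartExponent (letters m) := rfl
  rw [h1] at h
  simpa only [pairMonomial, map_prod, map_pow] using h

/-- On the chart, the basis monomials have distinct leading monomials. -/
theorem linearIndependent_chartHom_basisMonomial [Nontrivial R] :
    LinearIndependent R fun E => chartHom s (basisMonomial R E) := by
  refine linearIndependent_of_hasLeading (E := fun E : Set.range letters => chartExponent E)
    (fun E => ?_) (chartExponent_injective.comp Subtype.val_injective)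
  have h := hasLeading_chartHom_pairMonomial s (letterRep E)
  rwa [letters_letterRep] at h

/-- The chart is dense: the ideal of the family is the kernel of restriction to the chart. -/
theorem mem_familyIdeal_iff_chartHom [Nontrivial R] (f : MvPolynomial PluckerIndex R) :
    f ∈ (familyIdeal s).toIdeal ↔ chartHom s f = 0 := by
  refine ⟨chartHom_eq_zero_of_mem s, fun hf => ?_⟩
  have h : f ∈ (familyIdeal s).toIdeal.restrictScalars R ⊔
      Submodule.span R (Set.range (basisMonomial R)) := by
    rw [ideal_sup_span_eq_top]
    trivial
  obtain ⟨i, hi, g, hg, rfl⟩ := Submodule.mem_sup.mp h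
  rw [map_add, chartHom_eq_zero_of_mem s hi, zero_add] at hf
  rw [← Set.image_univ, Finsupp.mem_span_image_iff_linearCombination] at hg
  obtain ⟨l, -, rfl⟩ := hg
  have h1 : Finsupp.linearCombination R (fun E => chartHom s (basisMonomial R E)) l = 0 := by
    rw [← hf]
    exact (Finsupp.apply_linearCombination R (chartHom s).toLinearMap _ l).symm
  rw [linearIndependent_iff.mp (linearIndependent_chartHom_basisMonomial s) l h1, map_zero,
    add_zero]
  exact hi

/-- The coordinate ring is torsion-free, since it embeds into a polynomial ring over the base. -/
theorem smul_eq_zero_of_quotient [IsDomain R] (r : R)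
    (x : MvPolynomial PluckerIndex R ⧸ (familyIdeal s).toIdeal) (h : r • x = 0) :
    r = 0 ∨ x = 0 := by
  obtain ⟨f, rfl⟩ := Ideal.Quotient.mk_surjective x
  rw [← Ideal.Quotient.mkₐ_eq_mk R, ← map_smul, Ideal.Quotient.mkₐ_eq_mk,
    Ideal.Quotient.eq_zero_iff_mem, mem_familyIdeal_iff_chartHom, map_smul, smul_eq_zero] at h
  rwa [Ideal.Quotient.eq_zero_iff_mem, mem_familyIdeal_iff_chartHom]

end Chart

/-! ### The Hilbert function -/

section Hilbert

open MvPolynomial LetterPair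

variable {R : Type} [CommRing R] (s : R)

theorem pairCoord_isHomogeneous (e : LetterPair) : (pairCoord R e).IsHomogeneous 1 := by
  have h (i j : Fin 7) : (genericEntry R i j).IsHomogeneous 1 := genericEntry_mem i j
  cases e <;> simp only [pairCoord] <;> first | exact h _ _ | exact (h _ _).neg

theorem pairMonomial_isHomogeneous (m : LetterPair → ℕ) :
    (pairMonomial R m).IsHomogeneous (∑ e, m e) := by
  refine IsHomogeneous.prod _ _ _ fun e _ => ?_
  simpa using (pairCoord_isHomogeneous e).pow (m e)

theorem homogeneousComponent_mem {σ : Type} {I : HomogeneousIdeal (homogeneousSubmodule σ R)}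
    {f : MvPolynomial σ R} (hf : f ∈ I.toIdeal) (n : ℕ) :
    homogeneousComponent n f ∈ I.toIdeal := by
  have h := I.isHomogeneous n hf
  rwa [← decomposition.decompose'_apply]

/-- The exponents of the letters in the products of `n` letter pairs. -/
abbrev LetterExponent (n : ℕ) : Type :=
  {E : Fin 6 → ℕ // E ∈ Set.range letters ∧ ∑ i, E i = 2 * n}

/-- The basis monomials of degree `n`, as elements of the coordinate ring. -/
def quotientBasisMonomial (n : ℕ) (E : LetterExponent n) :
    MvPolynomial PluckerIndex R ⧸ (familyIdeal s).toIdeal :=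
  Ideal.Quotient.mkₐ R _ (basisMonomial R ⟨E.1, E.2.1⟩)

theorem linearIndependent_quotientBasisMonomial [Nontrivial R] (n : ℕ) :
    LinearIndependent R (quotientBasisMonomial s n) := by
  let φ : (MvPolynomial PluckerIndex R ⧸ (familyIdeal s).toIdeal) →ₐ[R] MvPolynomial (Fin 6) R :=
    Ideal.Quotient.liftₐ _ (chartHom s) fun f => chartHom_eq_zero_of_mem s
  refine LinearIndependent.of_comp φ.toLinearMap ?_
  exact (linearIndependent_chartHom_basisMonomial s).comp
    (fun E : LetterExponent n => ⟨E.1, E.2.1⟩)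
    fun E E' h => Subtype.ext (congrArg (fun E : Set.range letters => E.1) h)

theorem span_quotientBasisMonomial (n : ℕ) :
    Submodule.span R (Set.range (quotientBasisMonomial s n)) =
      quotientGrading (familyIdeal s) n := by
  have hdeg (E : Set.range letters) : (basisMonomial R E).IsHomogeneous (∑ e, letterRep E e) :=
    pairMonomial_isHomogeneous _
  have hsum (E : Set.range letters) : ∑ i, E.1 i = 2 * ∑ e, letterRep E e := by
    rw [← two_mul_sum, letters_letterRep E]
  apply le_antisymm
  · rw [Submodule.span_le]
    rintro _ ⟨E, rfl⟩
    refine mk_mem_quotientGrading (familyIdeal s) (a := basisMonomial R ⟨E.1, E.2.1⟩) ?_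
    have h := hdeg ⟨E.1, E.2.1⟩
    have h1 := E.2.2.symm.trans (hsum ⟨E.1, E.2.1⟩)
    rwa [← Nat.eq_of_mul_eq_mul_left two_pos h1] at h
  · rintro _ ⟨f, hf, rfl⟩
    have key : (familyIdeal s).toIdeal.restrictScalars R ⊔
        Submodule.span R (Set.range (basisMonomial R)) ≤
        ((Submodule.span R (Set.range (quotientBasisMonomial s n))).comap
          (Ideal.Quotient.mkₐ R (familyIdeal s).toIdeal).toLinearMap).comap
            (homogeneousComponent n) := by
      refine sup_le (fun g hg => ?_) (Submodule.span_le.mpr ?_)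
      · have h : Ideal.Quotient.mkₐ R (familyIdeal s).toIdeal (homogeneousComponent n g) = 0 :=
          Ideal.Quotient.eq_zero_iff_mem.mpr (homogeneousComponent_mem hg n)
        rw [Submodule.mem_comap, Submodule.mem_comap, AlgHom.toLinearMap_apply, h]
        exact zero_mem _
      · rintro _ ⟨E, rfl⟩
        rw [SetLike.mem_coe, Submodule.mem_comap, Submodule.mem_comap,
          homogeneousComponent_of_mem (hdeg E)]
        split_ifs with h
        · exact Submodule.subset_span ⟨⟨E.1, E.2, by rw [hsum, h]⟩, rfl⟩
        · rw [map_zero]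
          exact zero_mem _
    have h := key (x := f) (by rw [ideal_sup_span_eq_top]; trivial)
    rw [Submodule.mem_comap, homogeneousComponent_of_mem hf, if_pos rfl] at h
    exact h

theorem finrank_quotientGrading_familyIdeal [Nontrivial R] (n : ℕ) [Fintype (LetterExponent n)] :
    Module.finrank R (quotientGrading (familyIdeal s) n) = Fintype.card (LetterExponent n) := by
  rw [← span_quotientBasisMonomial]
  exact finrank_span_eq_card (linearIndependent_quotientBasisMonomial s n)

theorem exists_split (b s a : ℕ) (h : b ≤ s + a) : ∃ x y, x + y = b ∧ x ≤ s ∧ y ≤ a :=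
  ⟨min b s, b - min b s, by omega, by omega, by omega⟩

/-- `x`, `y`, `z` pairs `de`, `be`, `bc` can be formed from the given numbers of letters: a greedy
choice from the two ends of the path `d - e - b - c`. -/
theorem exists_path_pairs {b c d e r : ℕ} (h1 : r ≤ b + e) (h2 : r ≤ c + e) (h3 : r ≤ b + d) :
    ∃ x y z, x + y + z = r ∧ x ≤ d ∧ x + y ≤ e ∧ y + z ≤ b ∧ z ≤ c := by
  obtain ⟨x, hx⟩ : ∃ x, x = min (min d e) r := ⟨_, rfl⟩
  obtain ⟨z, hz⟩ : ∃ z, z = min (min b c) (r - x) := ⟨_, rfl⟩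
  exact ⟨x, r - x - z, z, by omega, by omega, by omega, by omega, by omega⟩

/-- If `s` and `a` are at least as numerous as the other letters, and the number of letters is even,
then every other letter can be paired with `s` or `a`, and what is left of these among
themselves. -/
theorem exists_mixed_pairs {s a b c d e : ℕ} (h : b + c + d + e ≤ s + a)
    (h2 : (b + c + d + e + (s + a)) % 2 = 0) :
    ∃ ss sa aa sb ab sc ac sd ad se ae, sb + ab = b ∧ sc + ac = c ∧ sd + ad = d ∧ se + ae = e ∧
      2 * ss + sa + sb + sc + sd + se = s ∧ 2 * aa + sa + ab + ac + ad + ae = a := by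
  obtain ⟨sb, ab, hb, hsb, hab⟩ := exists_split b s a (by omega)
  obtain ⟨sc, ac, hc, hsc, hac⟩ := exists_split c (s - sb) (a - ab) (by omega)
  obtain ⟨sd, ad, hd, hsd, had⟩ := exists_split d (s - sb - sc) (a - ab - ac) (by omega)
  obtain ⟨se, ae, he, hse, hae⟩ := exists_split e (s - sb - sc - sd) (a - ab - ac - ad) (by omega)
  obtain ⟨u, hu⟩ : ∃ u, u + sb + sc + sd + se = s := ⟨s - sb - sc - sd - se, by omega⟩
  obtain ⟨v, hv⟩ : ∃ v, v + ab + ac + ad + ae = a := ⟨a - ab - ac - ad - ae, by omega⟩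
  have huv : u % 2 = v % 2 := by omega
  have hu2 := Nat.div_add_mod u 2
  have hv2 := Nat.div_add_mod v 2
  refine ⟨u / 2, u % 2, v / 2, sb, ab, sc, ac, sd, ad, se, ae, hb, hc, hd, he, ?_, ?_⟩
  · rw [hu2, hu]
  · rw [huv, hv2, hv]

/-- A monomial of degree `2n` in the letters is a product of letter pairs if and only if the letters
other than `s, a`, at most `n` of which can be paired with `s, a`, admit enough pairs among
themselves; by König's theorem for the path `d - e - b - c` it suffices to look at vertex covers. -/
theorem mem_range_letters_iff {E : Fin 6 → ℕ} {n : ℕ} (h : ∑ i, E i = 2 * n) :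
    E ∈ Set.range letters ↔ E 2 + E 3 + E 4 + E 5 ≤ n + (E 2 + E 5) ∧
      E 2 + E 3 + E 4 + E 5 ≤ n + (E 3 + E 5) ∧ E 2 + E 3 + E 4 + E 5 ≤ n + (E 2 + E 4) := by
  rw [Fin.sum_univ_six] at h
  constructor
  · rintro ⟨m, rfl⟩
    simp only [letters, Matrix.cons_val] at h ⊢
    omega
  · rintro ⟨h1, h2, h3⟩
    obtain ⟨x, y, z, hr, hx, hxy, hyz, hz⟩ := exists_path_pairs (b := E 2) (c := E 3) (d := E 4)
      (e := E 5) (r := E 2 + E 3 + E 4 + E 5 - n) (by omega) (by omega) (by omega)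
    obtain ⟨ss, sa, aa, sb, ab, sc, ac, sd, ad, se, ae, hb, hc, hd, he, hs, ha⟩ :=
      exists_mixed_pairs (s := E 0) (a := E 1) (b := E 2 - y - z) (c := E 3 - z) (d := E 4 - x)
        (e := E 5 - x - y) (by omega) (by omega)
    refine ⟨fun e => match e with
      | .ss => ss | .sa => sa | .aa => aa | .sb => sb | .ab => ab | .sc => sc | .ac => ac
      | .sd => sd | .ad => ad | .se => se | .ae => ae | .de => x | .be => y | .bc => z, ?_⟩
    clear h h1 h2 h3 hr
    have h4 : sb + ab + y + z = E 2 := by omega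
    have h5 : sc + ac + z = E 3 := by omega
    have h6 : sd + ad + x = E 4 := by omega
    have h7 : se + ae + x + y = E 5 := by omega
    ext i
    fin_cases i
    · exact hs
    · exact ha
    · exact h4
    · exact h5
    · exact h6
    · exact h7

/-- Parameters for the exponents of the products of `n` letter pairs: the number of letters other
than `s, a`, the number of letters `c, e` among them, the number of letters `s`, and the numbers of
letters `e` and `b`. -/
def letterParameters (n : ℕ) : Finset (Σ _ : ℕ, Σ _ : ℕ, ℕ × (ℕ × ℕ)) :=
  (Finset.range (2 * n + 1)).sigma fun m => (Finset.Ico (m - n) (m + 1 - (m - n))).sigma fun k =>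
    Finset.range (2 * n - m + 1) ×ˢ
      (Finset.range (k + 1) ×ˢ Finset.range (m - k + 1)).filter fun x => m - n ≤ x.1 + x.2

/-- The exponents of the products of `n` letter pairs correspond to `letterParameters n`. -/
def letterExponentEquiv (n : ℕ) : LetterExponent n ≃ letterParameters n where
  toFun E := ⟨⟨E.1 2 + E.1 3 + E.1 4 + E.1 5, E.1 3 + E.1 5, E.1 0, E.1 5, E.1 2⟩, by
    have h := (mem_range_letters_iff E.2.2).mp E.2.1
    have h1 := E.2.2
    rw [Fin.sum_univ_six] at h1
    simp only [letterParameters, Finset.mem_sigma, Finset.mem_range, Finset.mem_Ico,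
      Finset.mem_product, Finset.mem_filter]
    omega⟩
  invFun x := ⟨![x.1.2.2.1, 2 * n - x.1.1 - x.1.2.2.1, x.1.2.2.2.2, x.1.2.1 - x.1.2.2.2.1,
      x.1.1 - x.1.2.1 - x.1.2.2.2.2, x.1.2.2.2.1], by
    obtain ⟨⟨m, k, u, e, b⟩, hx⟩ := x
    simp only [letterParameters, Finset.mem_sigma, Finset.mem_range, Finset.mem_Ico,
      Finset.mem_product, Finset.mem_filter] at hx
    have h : ∑ i, ![u, 2 * n - m - u, b, k - e, m - k - b, e] i = 2 * n := by
      simp only [Fin.sum_univ_six, Matrix.cons_val]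
      omega
    refine ⟨(mem_range_letters_iff h).mpr ?_, h⟩
    simp only [Matrix.cons_val]
    omega⟩
  left_inv E := by
    have h := (mem_range_letters_iff E.2.2).mp E.2.1
    have h1 := E.2.2
    rw [Fin.sum_univ_six] at h1
    ext i
    fin_cases i <;> simp only [Fin.zero_eta, Fin.mk_one, Fin.reduceFinMk, Matrix.cons_val] <;> omega
  right_inv x := by
    obtain ⟨⟨m, k, u, e, b⟩, hx⟩ := x
    simp only [letterParameters, Finset.mem_sigma, Finset.mem_range, Finset.mem_Ico,
      Finset.mem_product, Finset.mem_filter] at hx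
    have h1 : b + (k - e) + (m - k - b) + e = m := by omega
    have h2 : k - e + e = k := by omega
    simp only [Matrix.cons_val, h1, h2]

theorem card_filter_le_add {r k l : ℕ} (hk : r ≤ k) (hl : r ≤ l) :
    (((Finset.range (k + 1) ×ˢ Finset.range (l + 1)).filter fun x => r ≤ x.1 + x.2).card : ℚ) =
      (k + 1) * (l + 1) - r * (r + 1) / 2 := by
  have h1 := Finset.card_filter_add_card_filter_not
    (s := Finset.range (k + 1) ×ˢ Finset.range (l + 1)) fun x => r ≤ x.1 + x.2
  have h2 : ((Finset.range (k + 1) ×ˢ Finset.range (l + 1)).filter fun x => ¬ r ≤ x.1 + x.2) =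
      ((Finset.range r).sigma fun i => Finset.range (r - i)).map
        (Equiv.sigmaEquivProd ℕ ℕ).toEmbedding := by
    ext ⟨i, j⟩
    simp only [Finset.mem_filter, Finset.mem_product, Finset.mem_range, Finset.mem_map_equiv,
      Equiv.sigmaEquivProd_symm_apply, Finset.mem_sigma]
    omega
  have h3 : (∑ i ∈ Finset.range r, (r - i)) = ∑ i ∈ Finset.range r, (i + 1) := by
    rw [← Finset.sum_range_reflect]
    refine Finset.sum_congr rfl fun i hi => ?_
    rw [Finset.mem_range] at hi
    omega
  have h4 (r : ℕ) : ∑ i ∈ Finset.range r, ((i : ℚ) + 1) = r * (r + 1) / 2 := by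
    induction r with
    | zero => simp
    | succ r ih =>
      rw [Finset.sum_range_succ, ih]
      push_cast
      ring
  rw [h2, Finset.card_map, Finset.card_sigma, Finset.card_product] at h1
  simp only [Finset.card_range] at h1
  rw [h3] at h1
  have h5 := congrArg (Nat.cast (R := ℚ)) h1
  push_cast at h5
  rw [h4] at h5
  linarith

theorem sum_range_quartic (c₀ c₁ c₂ c₃ c₄ : ℚ) (N : ℕ) :
    ∑ i ∈ Finset.range N, (c₀ + c₁ * i + c₂ * i ^ 2 + c₃ * i ^ 3 + c₄ * i ^ 4) =
      c₀ * N + c₁ * (N * (N - 1) / 2) + c₂ * (N * (N - 1) * (2 * N - 1) / 6) +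
        c₃ * (N * (N - 1) / 2) ^ 2 +
          c₄ * (N * (N - 1) * (2 * N - 1) * (3 * N ^ 2 - 3 * N - 1) / 30) := by
  induction N with
  | zero => simp
  | succ N ih =>
    rw [Finset.sum_range_succ, ih]
    push_cast
    ring

theorem card_letterParameters (n : ℕ) : ((letterParameters n).card : ℚ) =
    ∑ m ∈ Finset.range (2 * n + 1), ∑ k ∈ Finset.Ico (m - n) (m + 1 - (m - n)),
      ((2 * n - m : ℕ) + 1 : ℚ) *
        ((k + 1) * ((m - k : ℕ) + 1) - (m - n : ℕ) * ((m - n : ℕ) + 1) / 2) := by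
  rw [letterParameters, Finset.card_sigma]
  push_cast
  refine Finset.sum_congr rfl fun m hm => ?_
  rw [Finset.card_sigma]
  push_cast
  refine Finset.sum_congr rfl fun k hk => ?_
  rw [Finset.mem_range] at hm
  rw [Finset.mem_Ico] at hk
  rw [Finset.card_product, Nat.cast_mul, card_filter_le_add (by omega) (by omega)]
  simp

/-- The sum over `letterParameters n` is evaluated from the inside out. -/
theorem card_letterExponent (n : ℕ) : (Nat.card (LetterExponent n) : ℚ) =
    (n + 1) * (n + 2) * (2 * n + 3) * (3 * n + 4) * (3 * n + 5) / 120 := by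
  rw [Nat.card_congr (letterExponentEquiv n), Nat.card_eq_fintype_card, Fintype.card_coe,
    card_letterParameters]
  -- the inner sum, for `r` pairs without `s, a` that are forced and `l + 1` values of the index
  have inner (A : ℚ) (r l : ℕ) : ∑ k ∈ Finset.Ico r (r + l + 1), A *
      (((k : ℚ) + 1) * ((2 * r + l - k : ℕ) + 1) - r * (r + 1) / 2) =
        A * (l + 1) * ((r + 1) * (r + l + 1) + l * (l - 1) / 6 - r * (r + 1) / 2) := by
    rw [Finset.sum_Ico_eq_sum_range, show r + l + 1 - r = l + 1 by omega]
    have h := sum_range_quartic (A * ((r + 1) * (r + l + 1) - r * (r + 1) / 2)) (A * l) (-A)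
      0 0 (l + 1)
    push_cast at h
    refine (Finset.sum_congr rfl fun i hi => ?_).trans (h.trans ?_)
    · rw [Finset.mem_range] at hi
      rw [show 2 * r + l - (r + i) = r + l - i by omega, Nat.cast_sub (by omega)]
      push_cast
      ring
    · ring
  have h1 : ∑ m ∈ Finset.range (n + 1), ∑ k ∈ Finset.Ico (m - n) (m + 1 - (m - n)),
      ((2 * n - m : ℕ) + 1 : ℚ) *
        ((k + 1) * ((m - k : ℕ) + 1) - (m - n : ℕ) * ((m - n : ℕ) + 1) / 2) =
      ∑ m ∈ Finset.range (n + 1), ((2 * n + 1 : ℚ) + (11 * (2 * n + 1) - 6) / 6 * m +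
        (6 * (2 * n + 1) - 11) / 6 * m ^ 2 + (2 * n + 1 - 6) / 6 * m ^ 3 + -1 / 6 * m ^ 4) := by
    refine Finset.sum_congr rfl fun m hm => ?_
    rw [Finset.mem_range] at hm
    have h := inner ((2 * n - m : ℕ) + 1 : ℚ) 0 m
    rw [show m - n = 0 by omega]
    simp only [mul_zero, zero_add, Nat.cast_zero, Nat.sub_zero] at h ⊢
    rw [h, Nat.cast_sub (by omega)]
    push_cast
    ring
  have h2 : ∑ i ∈ Finset.range n,
      ∑ k ∈ Finset.Ico (n + 1 + i - n) (n + 1 + i + 1 - (n + 1 + i - n)),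
      ((2 * n - (n + 1 + i) : ℕ) + 1 : ℚ) * ((k + 1) * ((n + 1 + i - k : ℕ) + 1) -
        (n + 1 + i - n : ℕ) * ((n + 1 + i - n : ℕ) + 1) / 2) =
      ∑ l ∈ Finset.range n, (((n + 1) * (n + 2) / 2 : ℚ) + ((n + 1) * (n + 2) - 2 / 3) * l +
        ((n + 1) * (n + 2) / 2 - 5 / 3) * l ^ 2 + -4 / 3 * l ^ 3 + -1 / 3 * l ^ 4) := by
    rw [← Finset.sum_range_reflect]
    refine Finset.sum_congr rfl fun l hl => ?_
    rw [Finset.mem_range] at hl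
    have h := inner ((l : ℚ) + 1) (n - l) l
    rw [show n + 1 + (n - 1 - l) - n = n - l by omega,
      show n + 1 + (n - 1 - l) = 2 * (n - l) + l by omega,
      show 2 * (n - l) + l + 1 - (n - l) = n - l + l + 1 by omega,
      show 2 * n - (2 * (n - l) + l) = l by omega, h, Nat.cast_sub (by omega)]
    ring
  rw [show 2 * n + 1 = n + 1 + n by ring, Finset.sum_range_add, h1, h2, sum_range_quartic,
    sum_range_quartic]
  push_cast
  ring

/-- The Hilbert polynomial of the family. -/
def familyHilbertPolynomial : Polynomial ℚ :=
  Polynomial.C (1 / 120) * ((.X + 1) * (.X + 2) * (2 * .X + 3) * (3 * .X + 4) * (3 * .X + 5))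

theorem isHilbertPolynomial_familyIdeal (t : ℂ) :
    IsHilbertPolynomial (familyIdeal t) familyHilbertPolynomial := by
  refine Filter.Eventually.of_forall fun n => ?_
  have : Finite (LetterExponent n) := Finite.of_equiv _ (letterExponentEquiv n).symm
  have := Fintype.ofFinite (LetterExponent n)
  rw [finrank_quotientGrading_familyIdeal, ← Nat.card_eq_fintype_card, card_letterExponent,
    familyHilbertPolynomial]
  simp
  ring

end Hilbert

/-! ### Coordinates on the exterior algebra -/

section Coordinates

set_option linter.unusedSimpArgs false

/-- Contraction of an element of the exterior algebra with the `i`-th coordinate form. -/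
def contract (i : Fin 7) : ExteriorAlgebra ℂ V7 →ₗ[ℂ] ExteriorAlgebra ℂ V7 :=
  CliffordAlgebra.contractLeft (Q := (0 : QuadraticForm ℂ V7)) (LinearMap.proj i)

/-- The coordinate of an element of the exterior algebra with indices the list `l`. -/
def coord : List (Fin 7) → ExteriorAlgebra ℂ V7 →ₗ[ℂ] ℂ
  | [] => ExteriorAlgebra.algebraMapInv.toLinearMap
  | i :: l => coord l ∘ₗ contract i

theorem contract_ι_mul (i : Fin 7) (v : V7) (x : ExteriorAlgebra ℂ V7) :
    contract i (ExteriorAlgebra.ι ℂ v * x) = v i • x - ExteriorAlgebra.ι ℂ v * contract i x :=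
  CliffordAlgebra.contractLeft_ι_mul _ _ _

theorem contract_ι (i : Fin 7) (v : V7) :
    contract i (ExteriorAlgebra.ι ℂ v) = algebraMap ℂ _ (v i) :=
  CliffordAlgebra.contractLeft_ι _ _ _

theorem contract_algebraMap (i : Fin 7) (r : ℂ) :
    contract i (algebraMap ℂ (ExteriorAlgebra ℂ V7) r) = 0 :=
  CliffordAlgebra.contractLeft_algebraMap _ _ _

theorem contract_one (i : Fin 7) : contract i 1 = 0 :=
  CliffordAlgebra.contractLeft_one _ _

theorem contract_contract (i : Fin 7) (x : ExteriorAlgebra ℂ V7) : contract i (contract i x) = 0 :=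
  CliffordAlgebra.contractLeft_contractLeft _ _

theorem contract_comm (i j : Fin 7) (x : ExteriorAlgebra ℂ V7) :
    contract i (contract j x) = -contract j (contract i x) :=
  CliffordAlgebra.contractLeft_comm _ _ _

theorem coord_cons (i : Fin 7) (l : List (Fin 7)) (x : ExteriorAlgebra ℂ V7) :
    coord (i :: l) x = coord l (contract i x) :=
  rfl

theorem coord_nil (x : ExteriorAlgebra ℂ V7) :
    coord [] x = ExteriorAlgebra.algebraMapInv x :=
  rfl

theorem mem_exteriorPower_zero {x : ExteriorAlgebra ℂ V7} :
    x ∈ ⋀[ℂ]^0 V7 ↔ ∃ r : ℂ, algebraMap ℂ _ r = x := by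
  change x ∈ (LinearMap.range (ExteriorAlgebra.ι ℂ)) ^ 0 ↔ _
  rw [pow_zero, Submodule.one_eq_range]
  rfl

theorem ι_mul_mem_exteriorPower {k : ℕ} (v : V7) {x : ExteriorAlgebra ℂ V7} (hx : x ∈ ⋀[ℂ]^k V7) :
    ExteriorAlgebra.ι ℂ v * x ∈ ⋀[ℂ]^(k + 1) V7 := by
  change _ ∈ (LinearMap.range (ExteriorAlgebra.ι ℂ)) ^ (k + 1)
  rw [pow_succ']
  exact Submodule.mul_mem_mul ⟨v, rfl⟩ hx

theorem ιMulti_mem_exteriorPower {k : ℕ} (v : Fin k → V7) :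
    ExteriorAlgebra.ιMulti ℂ k v ∈ ⋀[ℂ]^k V7 := by
  rw [← ExteriorAlgebra.ιMulti_span_fixedDegree]
  exact Submodule.subset_span ⟨v, rfl⟩

theorem exteriorPower_induction {k : ℕ} {p : ExteriorAlgebra ℂ V7 → Prop}
    (h0 : p 0) (hadd : ∀ x y, p x → p y → p (x + y)) (hsmul : ∀ (c : ℂ) x, p x → p (c • x))
    (hprod : ∀ v : Fin k → V7, p (ExteriorAlgebra.ιMulti ℂ k v)) {x : ExteriorAlgebra ℂ V7}
    (hx : x ∈ ⋀[ℂ]^k V7) : p x := by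
  rw [← ExteriorAlgebra.ιMulti_span_fixedDegree] at hx
  induction hx using Submodule.span_induction with
  | mem x hx =>
    obtain ⟨v, rfl⟩ := hx
    exact hprod v
  | zero => exact h0
  | add x y _ _ hx hy => exact hadd x y hx hy
  | smul c x _ hx => exact hsmul c x hx

theorem contract_mem {k : ℕ} (i : Fin 7) {x : ExteriorAlgebra ℂ V7} (hx : x ∈ ⋀[ℂ]^(k + 1) V7) :
    contract i x ∈ ⋀[ℂ]^k V7 := by
  refine exteriorPower_induction (p := fun x => contract i x ∈ ⋀[ℂ]^k V7) ?_ ?_ ?_ ?_ hx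
  · rw [map_zero]
    exact zero_mem _
  · intro x y hx hy
    rw [map_add]
    exact add_mem hx hy
  · intro c x hx
    rw [map_smul]
    exact Submodule.smul_mem _ _ hx
  · intro v
    clear hx
    induction k with
    | zero =>
      rw [ExteriorAlgebra.ιMulti_succ_apply, ExteriorAlgebra.ιMulti_zero_apply, contract_ι_mul,
        contract_one, mul_zero, sub_zero, ← Algebra.algebraMap_eq_smul_one]
      exact mem_exteriorPower_zero.mpr ⟨_, rfl⟩
    | succ k ih =>
      rw [ExteriorAlgebra.ιMulti_succ_apply, contract_ι_mul]
      exact sub_mem (Submodule.smul_mem _ _ (ιMulti_mem_exteriorPower _))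
        (ι_mul_mem_exteriorPower _ (ih (Matrix.vecTail v)))

/-- Euler's identity: on `k`-vectors, contraction followed by multiplication with the basis vectors
sums to multiplication by `k`. -/
theorem sum_ι_mul_contract {k : ℕ} {x : ExteriorAlgebra ℂ V7} (hx : x ∈ ⋀[ℂ]^k V7) :
    ∑ i, ExteriorAlgebra.ι ℂ (Pi.single i 1) * contract i x = (k : ℂ) • x := by
  let p (x : ExteriorAlgebra ℂ V7) : Prop :=
    ∑ i, ExteriorAlgebra.ι ℂ (Pi.single i 1) * contract i x = (k : ℂ) • x
  refine exteriorPower_induction (p := p) ?_ ?_ ?_ ?_ hx <;> simp only [p]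
  · simp
  · intro x y hx hy
    simp only [map_add, mul_add, Finset.sum_add_distrib, hx, hy, smul_add]
  · intro c x hx
    simp only [map_smul, mul_smul_comm, ← Finset.smul_sum, hx, smul_comm c]
  · intro v
    clear hx p
    induction k with
    | zero => simp [ExteriorAlgebra.ιMulti_zero_apply, contract_one]
    | succ k ih =>
      have h1 (i : Fin 7) (y : ExteriorAlgebra ℂ V7) : ExteriorAlgebra.ι ℂ (Pi.single i 1) *
          (ExteriorAlgebra.ι ℂ (v 0) * y) =
          -(ExteriorAlgebra.ι ℂ (v 0) * (ExteriorAlgebra.ι ℂ (Pi.single i 1) * y)) := by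
        rw [← mul_assoc, ← mul_assoc, ← neg_mul]
        congr 1
        exact eq_neg_of_add_eq_zero_left (ExteriorAlgebra.ι_add_mul_swap _ _)
      have h2 : ∑ i, v 0 i • ExteriorAlgebra.ι ℂ (Pi.single i (1 : ℂ)) =
          ExteriorAlgebra.ι ℂ (v 0) := by
        rw [pi_eq_sum_univ' (v 0)]
        simp [map_sum, Pi.single_apply]
      rw [ExteriorAlgebra.ιMulti_succ_apply]
      simp only [contract_ι_mul, mul_sub, h1, sub_neg_eq_add, Finset.sum_add_distrib,
        ← Finset.mul_sum, ih, mul_smul_comm]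
      simp only [← smul_mul_assoc, ← Finset.sum_mul, h2]
      push_cast
      rw [add_smul, one_smul, add_comm, add_mul, smul_mul_assoc]

/-- A multivector vanishes if its coordinates with respect to increasing lists of indices vanish. -/
theorem eq_zero_of_coord_pairwise {k : ℕ} {x : ExteriorAlgebra ℂ V7} (hx : x ∈ ⋀[ℂ]^k V7)
    (h : ∀ l : List (Fin 7), l.Pairwise (· < ·) → l.length = k → coord l x = 0) : x = 0 := by
  have key (m : ℕ) (hm : m ≤ 7) : ∀ (k : ℕ) (x : ExteriorAlgebra ℂ V7), x ∈ ⋀[ℂ]^k V7 →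
      (∀ i : Fin 7, i.1 < 7 - m → contract i x = 0) →
      (∀ l : List (Fin 7), l.Pairwise (· < ·) → l.length = k → (∀ i ∈ l, 7 - m ≤ i.1) →
        coord l x = 0) → x = 0 := by
    induction m with
    | zero =>
      intro k x hx h0 h
      cases k with
      | zero =>
        obtain ⟨r, rfl⟩ := mem_exteriorPower_zero.mp hx
        have h1 := h [] List.Pairwise.nil rfl (by simp)
        rw [coord_nil, ExteriorAlgebra.algebraMap_leftInverse] at h1
        rw [h1, map_zero]
      | succ k =>
        have h1 := sum_ι_mul_contract hx
        rw [Finset.sum_eq_zero fun i _ => by rw [h0 i i.2, mul_zero], eq_comm, smul_eq_zero] at h1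
        exact h1.resolve_left (Nat.cast_ne_zero.mpr k.succ_ne_zero)
    | succ m ih =>
      intro k x hx h0 h
      cases k with
      | zero =>
        obtain ⟨r, rfl⟩ := mem_exteriorPower_zero.mp hx
        have h1 := h [] List.Pairwise.nil rfl (by simp)
        rw [coord_nil, ExteriorAlgebra.algebraMap_leftInverse] at h1
        rw [h1, map_zero]
      | succ k =>
        have hi : 7 - (m + 1) < 7 := by omega
        have h1 : contract ⟨7 - (m + 1), hi⟩ x = 0 := by
          refine ih (by omega) k _ (contract_mem _ hx) (fun i hi' => ?_) fun l hl hl' hl'' => ?_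
          · rcases Nat.lt_or_ge i.1 (7 - (m + 1)) with h2 | h2
            · rw [contract_comm, h0 i h2, map_zero, neg_zero]
            · obtain rfl : i = ⟨7 - (m + 1), hi⟩ := Fin.ext (by simp only; omega)
              exact contract_contract _ _
          · rw [← coord_cons]
            refine h _ (List.Pairwise.cons (fun i hi' => ?_) hl) (by rw [List.length_cons, hl'])
              fun i hi' => ?_
            · have := hl'' i hi'
              rw [Fin.lt_def]
              simp only
              omega
            · rcases List.mem_cons.mp hi' with rfl | hi'
              · simp
              · have := hl'' i hi'
                omega
        refine ih (by omega) (k + 1) x hx (fun i hi' => ?_) fun l hl hl' hl'' => ?_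
        · rcases Nat.lt_or_ge i.1 (7 - (m + 1)) with h2 | h2
          · exact h0 i h2
          · obtain rfl : i = ⟨7 - (m + 1), hi⟩ := Fin.ext (by simp only; omega)
            exact h1
        · refine h l hl hl' fun i hi' => ?_
          have := hl'' i hi'
          omega
  exact key 7 le_rfl k x hx (fun i hi => absurd hi (by omega)) fun l hl hl' _ => h l hl hl'

theorem coe_decomposableForm (i j k l : Fin 7) :
    (decomposableForm i j k l : ExteriorAlgebra ℂ V7) =
      ExteriorAlgebra.ι ℂ (Pi.single i 1) * (ExteriorAlgebra.ι ℂ (Pi.single j 1) *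
        (ExteriorAlgebra.ι ℂ (Pi.single k 1) * ExteriorAlgebra.ι ℂ (Pi.single l 1))) := by
  simp [decomposableForm, ExteriorAlgebra.ιMulti_succ_apply, ExteriorAlgebra.ιMulti_zero_apply,
    Matrix.vecTail]

theorem coe_omegaForm (t : ℂ) : (omegaForm t : ExteriorAlgebra ℂ V7) =
    decomposableForm 0 1 2 6 + decomposableForm 3 4 5 6 + decomposableForm 1 2 4 5 +
    decomposableForm 0 2 3 5 + t • (decomposableForm 0 1 3 4 : ExteriorAlgebra ℂ V7) :=
  rfl

/-- A multivector vanishes if its coordinates with increasing indices vanish. -/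
theorem eq_zero_of_coord {k : ℕ} {x : ExteriorAlgebra ℂ V7} (hx : x ∈ ⋀[ℂ]^k V7)
    (h : ∀ l ∈ (List.finRange 7).sublistsLen k, coord l x = 0) : x = 0 := by
  refine eq_zero_of_coord_pairwise hx fun l hl hl' => h l (List.mem_sublistsLen.mpr ⟨?_, hl'⟩)
  refine List.sublist_of_subperm_of_pairwise (r := (· < ·)) ?_ hl (List.pairwise_lt_finRange 7)
  exact List.subperm_of_subset (hl.imp ne_of_lt) fun i _ => List.mem_finRange i

/-- The condition `v ∧ w ∧ ω_t = 0` in terms of the Plücker coordinates of `v ∧ w`. -/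
theorem ι_mul_ι_mul_omegaForm_eq_zero_iff (t : ℂ) (v w : V7) :
    ExteriorAlgebra.ι ℂ v * ExteriorAlgebra.ι ℂ w * (omegaForm t : ExteriorAlgebra ℂ V7) = 0 ↔
      letI p (i j : Fin 7) := v i * w j - v j * w i
      p 1 2 + p 3 6 = 0 ∧ p 0 2 - p 4 6 = 0 ∧ p 0 1 + t * p 5 6 = 0 ∧ p 4 5 + p 0 6 = 0 ∧
        p 3 5 - p 1 6 = 0 ∧ p 3 4 + t * p 2 6 = 0 ∧ p 0 3 + p 1 4 + t * p 2 5 = 0 := by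
  set x := ExteriorAlgebra.ι ℂ v * ExteriorAlgebra.ι ℂ w * (omegaForm t : ExteriorAlgebra ℂ V7)
    with hx
  have hmem : x ∈ ⋀[ℂ]^6 V7 := by
    rw [hx, mul_assoc]
    exact ι_mul_mem_exteriorPower _ (ι_mul_mem_exteriorPower _ (omegaForm t).2)
  let p (i j : Fin 7) := v i * w j - v j * w i
  have e : coord [0, 1, 2, 3, 4, 5] x = p 0 3 + p 1 4 + t * p 2 5 ∧
      coord [0, 1, 2, 3, 4, 6] x = p 3 4 + t * p 2 6 ∧
      coord [0, 1, 2, 3, 5, 6] x = p 3 5 - p 1 6 ∧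
      coord [0, 1, 2, 4, 5, 6] x = p 4 5 + p 0 6 ∧
      coord [0, 1, 3, 4, 5, 6] x = p 0 1 + t * p 5 6 ∧
      coord [0, 2, 3, 4, 5, 6] x = p 0 2 - p 4 6 ∧
      coord [1, 2, 3, 4, 5, 6] x = p 1 2 + p 3 6 := by
    refine ⟨?_, ?_, ?_, ?_, ?_, ?_, ?_⟩ <;>
    simp only [hx, coe_omegaForm, coe_decomposableForm, mul_assoc, mul_add, map_add, map_smul,
      mul_smul_comm,
      coord_cons, contract_ι_mul, contract_ι, contract_algebraMap, map_sub, Pi.single_apply,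
      Fin.reduceEq, if_true, if_false, zero_smul, one_smul, map_zero, map_one, mul_zero, sub_zero,
      zero_sub, add_zero, zero_add, mul_neg, map_neg, mul_one, smul_zero, mul_sub, smul_sub,
      smul_neg, neg_zero, sub_self, coord_nil, AlgHom.commutes, smul_eq_mul,
      Algebra.algebraMap_self, RingHom.id_apply] <;>
    simp only [p] <;> ring
  obtain ⟨e1, e2, e3, e4, e5, e6, e7⟩ := e
  constructor
  · intro h
    rw [h, map_zero] at e1 e2 e3 e4 e5 e6 e7
    exact ⟨e7.symm, e6.symm, e5.symm, e4.symm, e3.symm, e2.symm, e1.symm⟩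
  · rintro ⟨h1, h2, h3, h4, h5, h6, h7⟩
    refine eq_zero_of_coord hmem ?_
    rw [show (List.finRange 7).sublistsLen 6 = [[1, 2, 3, 4, 5, 6], [0, 2, 3, 4, 5, 6],
      [0, 1, 3, 4, 5, 6], [0, 1, 2, 4, 5, 6], [0, 1, 2, 3, 5, 6], [0, 1, 2, 3, 4, 6],
      [0, 1, 2, 3, 4, 5]] by decide +kernel]
    simp only [List.forall_mem_cons, List.not_mem_nil, false_imp_iff, implies_true, and_true]
    exact ⟨e7.trans h1, e6.trans h2, e5.trans h3, e4.trans h4, e3.trans h5,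
      e2.trans h6, e1.trans h7⟩

theorem extDerivation_mem {k : ℕ} (A : V7 →ₗ[ℂ] V7) {x : ExteriorAlgebra ℂ V7}
    (hx : x ∈ ⋀[ℂ]^k V7) : extDerivation A x ∈ ⋀[ℂ]^k V7 := by
  refine exteriorPower_induction (p := fun x => extDerivation A x ∈ ⋀[ℂ]^k V7) ?_ ?_ ?_ ?_ hx
  · rw [map_zero]
    exact zero_mem _
  · intro x y hx hy
    rw [map_add]
    exact add_mem hx hy
  · intro c x hx
    rw [map_smul]
    exact Submodule.smul_mem _ _ hx
  · intro v
    clear hx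
    induction k with
    | zero =>
      rw [ExteriorAlgebra.ιMulti_zero_apply, extDerivation_apply, map_one, TrivSqZeroExt.snd_one]
      exact zero_mem _
    | succ k ih =>
      rw [ExteriorAlgebra.ιMulti_succ_apply, extDerivation_mul, extDerivation_ι]
      exact add_mem (ι_mul_mem_exteriorPower _ (ιMulti_mem_exteriorPower _))
        (ι_mul_mem_exteriorPower _ (ih _))

set_option maxHeartbeats 4000000 in
/-- The coordinates of the image of `ω₁` under an endomorphism of `V`, acting as a derivation. -/
theorem coord_extDerivation_omegaForm (A : Matrix (Fin 7) (Fin 7) ℂ) :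
    letI x := extDerivation (Matrix.toLin' A) (omegaForm 1 : ExteriorAlgebra ℂ V7)
    coord [0, 1, 2, 3] x = A 3 6 + A 1 5 - A 2 4 ∧
      coord [0, 1, 2, 4] x = A 4 6 - A 0 5 + A 2 3 ∧
      coord [0, 1, 2, 5] x = A 5 6 + A 0 4 - A 1 3 ∧
      coord [0, 1, 2, 6] x = A 0 0 + A 1 1 + A 2 2 + A 6 6 ∧
      coord [0, 1, 3, 4] x = A 0 0 + A 1 1 + A 3 3 + A 4 4 ∧
      coord [0, 1, 3, 5] x = A 1 2 + A 5 4 ∧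
      coord [0, 1, 3, 6] x = A 3 2 + A 6 4 ∧
      coord [0, 1, 4, 5] x = -A 0 2 - A 5 3 ∧
      coord [0, 1, 4, 6] x = A 4 2 - A 6 3 ∧
      coord [0, 1, 5, 6] x = A 5 2 ∧
      coord [0, 2, 3, 4] x = A 4 5 + A 2 1 ∧
      coord [0, 2, 3, 5] x = A 0 0 + A 2 2 + A 3 3 + A 5 5 ∧
      coord [0, 2, 3, 6] x = -A 3 1 + A 6 5 ∧
      coord [0, 2, 4, 5] x = A 0 1 + A 4 3 ∧
      coord [0, 2, 4, 6] x = -A 4 1 ∧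
      coord [0, 2, 5, 6] x = -A 5 1 - A 6 3 ∧
      coord [0, 3, 4, 5] x = -A 0 6 - A 4 2 + A 5 1 ∧
      coord [0, 3, 4, 6] x = A 0 5 + A 6 1 ∧
      coord [0, 3, 5, 6] x = -A 0 4 + A 6 2 ∧
      coord [0, 4, 5, 6] x = A 0 3 ∧
      coord [1, 2, 3, 4] x = -A 3 5 - A 2 0 ∧
      coord [1, 2, 3, 5] x = A 3 4 + A 1 0 ∧
      coord [1, 2, 3, 6] x = A 3 0 ∧
      coord [1, 2, 4, 5] x = A 1 1 + A 2 2 + A 4 4 + A 5 5 ∧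
      coord [1, 2, 4, 6] x = A 4 0 + A 6 5 ∧
      coord [1, 2, 5, 6] x = A 5 0 - A 6 4 ∧
      coord [1, 3, 4, 5] x = -A 1 6 + A 3 2 - A 5 0 ∧
      coord [1, 3, 4, 6] x = A 1 5 - A 6 0 ∧
      coord [1, 3, 5, 6] x = -A 1 4 ∧
      coord [1, 4, 5, 6] x = A 1 3 + A 6 2 ∧
      coord [2, 3, 4, 5] x = -A 2 6 - A 3 1 + A 4 0 ∧
      coord [2, 3, 4, 6] x = A 2 5 ∧
      coord [2, 3, 5, 6] x = -A 2 4 - A 6 0 ∧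
      coord [2, 4, 5, 6] x = A 2 3 - A 6 1 ∧
      coord [3, 4, 5, 6] x = A 3 3 + A 4 4 + A 5 5 + A 6 6 := by
  refine ⟨?_, ?_, ?_, ?_, ?_, ?_, ?_, ?_, ?_, ?_, ?_, ?_, ?_, ?_, ?_, ?_, ?_, ?_,
    ?_, ?_, ?_, ?_, ?_, ?_, ?_, ?_, ?_, ?_, ?_, ?_, ?_, ?_, ?_, ?_, ?_⟩ <;>
  simp only [extDerivation_mul, extDerivation_ι, Matrix.toLin'_apply, Matrix.mulVec_single_one,
      Matrix.col_apply, coe_omegaForm, coe_decomposableForm, mul_assoc, mul_add, map_add, map_smul,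
      mul_smul_comm,
      coord_cons, contract_ι_mul, contract_ι, contract_algebraMap, map_sub, Pi.single_apply,
      Fin.reduceEq, if_true, if_false, zero_smul, one_smul, map_zero, map_one, mul_zero, sub_zero,
      zero_sub, add_zero, zero_add, mul_neg, map_neg, mul_one, smul_zero, mul_sub, smul_sub,
      smul_neg, neg_zero, sub_self, coord_nil, AlgHom.commutes, smul_eq_mul,
      Algebra.algebraMap_self, RingHom.id_apply] <;> ring

end Coordinates

/-! ### Isotropic cones -/

section Cones

open MvPolynomial

/-- The skew-symmetric matrix with Plücker coordinates `p`. -/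
def skewMatrix (p : PluckerIndex → ℂ) : Matrix (Fin 7) (Fin 7) ℂ :=
  Matrix.of fun i j => eval p (genericEntry ℂ i j)

theorem eval_genericEntry (p : PluckerIndex → ℂ) (i j : Fin 7) :
    eval p (genericEntry ℂ i j) = skewMatrix p i j :=
  rfl

theorem skewMatrix_apply (p : PluckerIndex → ℂ) (a : PluckerIndex) :
    skewMatrix p a.1.1 a.1.2 = p a := by
  rw [← eval_genericEntry, genericEntry, dif_pos a.2, eval_X]

theorem skewMatrix_swap (p : PluckerIndex → ℂ) (i j : Fin 7) :
    skewMatrix p j i = -skewMatrix p i j := by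
  simp only [← eval_genericEntry, genericEntry]
  split_ifs with h1 h2 h2
  · exact absurd (h1.trans h2) (lt_irrefl _)
  · simp
  · simp
  · simp

theorem skewMatrix_eq_of_forall {p : PluckerIndex → ℂ} {Q : Matrix (Fin 7) (Fin 7) ℂ}
    (hQ : ∀ i j, Q j i = -Q i j) (h : ∀ a : PluckerIndex, p a = Q a.1.1 a.1.2) :
    skewMatrix p = Q := by
  ext i j
  rcases lt_trichotomy i j with hij | rfl | hij
  · exact (skewMatrix_apply p ⟨(i, j), hij⟩).trans (h ⟨(i, j), hij⟩)
  · have h1 := skewMatrix_swap p i i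
    have h2 := hQ i i
    rw [eq_neg_iff_add_eq_zero, ← two_mul] at h1 h2
    rw [(mul_eq_zero.mp h1).resolve_left two_ne_zero, (mul_eq_zero.mp h2).resolve_left two_ne_zero]
  · rw [skewMatrix_swap p j i, hQ j i]
    exact congrArg Neg.neg ((skewMatrix_apply p ⟨(j, i), hij⟩).trans (h ⟨(j, i), hij⟩))

/-- The linear equations `p ∧ ω_t = 0` for the skew-symmetric matrix `P` of a bivector `p`. -/
def IsotropyEquations (t : ℂ) (P : Matrix (Fin 7) (Fin 7) ℂ) : Prop :=
  P 1 2 + P 3 6 = 0 ∧ P 0 2 - P 4 6 = 0 ∧ P 0 1 + t * P 5 6 = 0 ∧ P 4 5 + P 0 6 = 0 ∧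
    P 3 5 - P 1 6 = 0 ∧ P 3 4 + t * P 2 6 = 0 ∧ P 0 3 + P 1 4 + t * P 2 5 = 0

/-- A skew-symmetric matrix that satisfies the Plücker relations is the matrix of a decomposable
bivector. -/
theorem exists_minors {Q : Matrix (Fin 7) (Fin 7) ℂ}
    (hP : ∀ i j k l, Q i j * Q k l - Q i k * Q j l + Q i l * Q j k = 0) :
    ∃ v w : V7, ∀ i j, Q i j = v i * w j - v j * w i := by
  by_cases h0 : Q = 0
  · exact ⟨0, 0, by simp [h0]⟩
  obtain ⟨i, j, hij⟩ : ∃ i j, Q i j ≠ 0 := by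
    by_contra! h
    exact h0 (Matrix.ext h)
  refine ⟨fun k => Q i k / Q i j, fun k => Q j k, fun k l => ?_⟩
  field_simp
  linear_combination hP i j k l

theorem mem_isotropicCone_omegaForm_iff_exists (t : ℂ) (p : PluckerIndex → ℂ) :
    p ∈ isotropicCone (omegaForm t) ↔ IsotropyEquations t (skewMatrix p) ∧
      ∃ v w : V7, ∀ i j, skewMatrix p i j = v i * w j - v j * w i := by
  constructor
  · rintro ⟨v, w, h1, h2⟩
    have h3 : ∀ i j, skewMatrix p i j = v i * w j - v j * w i := by
      intro i j
      rw [skewMatrix_eq_of_forall (Q := Matrix.of fun i j => v i * w j - v j * w i)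
        (fun i j => by simp only [Matrix.of_apply]; ring) h2, Matrix.of_apply]
    refine ⟨?_, v, w, h3⟩
    simp only [IsotropyEquations, h3]
    exact (ι_mul_ι_mul_omegaForm_eq_zero_iff t v w).mp h1
  · rintro ⟨h1, v, w, h2⟩
    simp only [IsotropyEquations, h2] at h1
    refine ⟨v, w, (ι_mul_ι_mul_omegaForm_eq_zero_iff t v w).mpr h1, fun a => ?_⟩
    rw [← h2, skewMatrix_apply]

theorem mem_isotropicCone_omegaForm_iff (t : ℂ) (p : PluckerIndex → ℂ) :
    p ∈ isotropicCone (omegaForm t) ↔ IsotropyEquations t (skewMatrix p) ∧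
      ∀ i j k l, skewMatrix p i j * skewMatrix p k l - skewMatrix p i k * skewMatrix p j l +
        skewMatrix p i l * skewMatrix p j k = 0 := by
  rw [mem_isotropicCone_omegaForm_iff_exists]
  refine and_congr_right fun _ => ⟨?_, exists_minors⟩
  rintro ⟨v, w, h⟩ i j k l
  simp only [h]
  ring

/-- The isotropic cone of `ω_t` is the zero locus of the equations of the family. -/
theorem mem_isotropicCone_omegaForm_iff_eval (t : ℂ) (p : PluckerIndex → ℂ) :
    p ∈ isotropicCone (omegaForm t) ↔
      ∀ f ∈ pluckerRelations ℂ ∪ isotropyEquations t, eval p f = 0 := by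
  rw [mem_isotropicCone_omegaForm_iff]
  constructor
  · rintro ⟨h1, h2⟩ f (⟨i, j, k, l, rfl⟩ | hf)
    · simpa [eval_genericEntry] using h2 i j k l
    · obtain ⟨e1, e2, e3, e4, e5, e6, e7⟩ := h1
      simp only [isotropyEquations, Set.mem_insert_iff, Set.mem_singleton_iff] at hf
      rcases hf with rfl | rfl | rfl | rfl | rfl | rfl | rfl <;>
      simpa [eval_genericEntry]
  · intro h
    constructor
    · have h' := fun f hf => h f (Or.inr hf)
      simpa [isotropyEquations, eval_genericEntry, IsotropyEquations] using h'
    · intro i j k l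
      simpa [eval_genericEntry] using h _ (Or.inl ⟨i, j, k, l, rfl⟩)

theorem eval_eq_zero_of_mem_familyIdeal {t : ℂ} {f : MvPolynomial PluckerIndex ℂ}
    (hf : f ∈ (familyIdeal t).toIdeal) {p : PluckerIndex → ℂ}
    (hp : p ∈ isotropicCone (omegaForm t)) : eval p f = 0 := by
  suffices h : (familyIdeal t).toIdeal ≤ RingHom.ker (eval p) from h hf
  exact Ideal.span_le.mpr ((mem_isotropicCone_omegaForm_iff_eval t p).mp hp)

section ConeIdeal

variable {σ : Type}

theorem eval_eq_zero_of_mem_coneIdeal {K : Set (σ → ℂ)} {f : MvPolynomial σ ℂ}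
    (hf : f ∈ (coneIdeal K).toIdeal) {p : σ → ℂ} (hp : p ∈ K) : eval p f = 0 := by
  have h := Ideal.toIdeal_homogeneousCore_le _ _ hf
  rw [← aeval_eq_eval]
  exact mem_vanishingIdeal_iff.mp h p hp

theorem mem_coneIdeal_of_isHomogeneous {K : Set (σ → ℂ)} {f : MvPolynomial σ ℂ} {n : ℕ}
    (hf : f.IsHomogeneous n) (h : ∀ p ∈ K, eval p f = 0) : f ∈ (coneIdeal K).toIdeal := by
  refine Ideal.mem_homogeneousCore_of_homogeneous_of_mem ⟨n, hf⟩ ?_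
  rw [mem_vanishingIdeal_iff]
  intro p hp
  rw [aeval_eq_eval]
  exact h p hp

end ConeIdeal

/-- The equations of the family generate the ideals of the isotropic varieties of all `ω_t`: the
points of the chart are isotropic, so a polynomial vanishing on the cone restricts to zero. -/
theorem familyIdeal_eq_isotropicIdeal (t : ℂ) : familyIdeal t = isotropicIdeal (omegaForm t) := by
  refine le_antisymm ?_ fun f hf => ?_
  · refine (Ideal.homogeneousCore.gc _ _ _).mp fun f hf => ?_
    rw [mem_vanishingIdeal_iff]
    intro p hp
    rw [aeval_eq_eval]
    exact eval_eq_zero_of_mem_familyIdeal hf hp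
  · refine (mem_familyIdeal_iff_chartHom t f).mpr (MvPolynomial.funext fun x => ?_)
    have h1 (g : MvPolynomial PluckerIndex ℂ) : eval x (chartHom t g) =
        eval (fun a : PluckerIndex => eval x (chartEntry t a.1.1 a.1.2)) g := by
      rw [chartHom, ← coe_aeval_eq_eval, ← coe_aeval_eq_eval]
      exact DFunLike.congr_fun (comp_aeval _ ((aeval x : MvPolynomial (Fin 6) ℂ →ₐ[ℂ] ℂ))) g
    rw [h1, map_zero]
    refine eval_eq_zero_of_mem_coneIdeal hf
      ((mem_isotropicCone_omegaForm_iff_eval t _).mpr fun g hg => ?_)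
    rw [← h1, chartHom_eq_zero_of_mem t (Ideal.subset_span hg), map_zero]

section BaseChange

variable {R S : Type} [CommRing R] [CommRing S] (φ : R →+* S)

theorem map_genericEntry (i j : Fin 7) :
    MvPolynomial.map φ (genericEntry R i j) = genericEntry S i j := by
  unfold genericEntry
  split_ifs <;> simp

/-- The ideal of the family is compatible with base change. -/
theorem map_familyIdeal (s : R) : (familyIdeal s).toIdeal.map (MvPolynomial.map φ) =
    (familyIdeal (φ s)).toIdeal := by
  change (Ideal.span _).map _ = Ideal.span _
  rw [Ideal.map_span, Set.image_union]
  congr 2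
  · ext f
    constructor
    · rintro ⟨_, ⟨i, j, k, l, rfl⟩, rfl⟩
      exact ⟨i, j, k, l, by simp [map_genericEntry]⟩
    · rintro ⟨i, j, k, l, rfl⟩
      exact ⟨_, ⟨i, j, k, l, rfl⟩, by simp [map_genericEntry]⟩
  · simp [isotropyEquations, Set.image_insert_eq, map_genericEntry]

end BaseChange

section Substitution

variable {σ τ : Type} [Fintype τ] [DecidableEq τ]

/-- The linear polynomials that describe a linear map. -/
def linearForm (M : (τ → ℂ) →ₗ[ℂ] (σ → ℂ)) (a : σ) : MvPolynomial τ ℂ :=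
  ∑ b, C (M (Pi.single b 1) a) * X b

theorem eval_linearForm (M : (τ → ℂ) →ₗ[ℂ] (σ → ℂ)) (a : σ) (q : τ → ℂ) :
    eval q (linearForm M a) = M q a := by
  conv_rhs => rw [pi_eq_sum_univ' q, map_sum]
  simp [linearForm, map_sum, mul_comm]

theorem linearForm_isHomogeneous (M : (τ → ℂ) →ₗ[ℂ] (σ → ℂ)) (a : σ) :
    (linearForm M a).IsHomogeneous 1 :=
  IsHomogeneous.sum _ _ _ fun b _ => by
    simpa using (isHomogeneous_C τ (M (Pi.single b 1) a)).mul (isHomogeneous_X ℂ b)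

/-- Specialization of the parameter to `t`, followed by the linear substitution `M`. -/
def specialize (t : ℂ) (M : (τ → ℂ) →ₗ[ℂ] (σ → ℂ)) :
    MvPolynomial σ (Polynomial ℂ) →+* MvPolynomial τ ℂ :=
  (aeval (linearForm M) : MvPolynomial σ ℂ →ₐ[ℂ] MvPolynomial τ ℂ).toRingHom.comp
    (MvPolynomial.map (Polynomial.evalRingHom t))

theorem eval_specialize (t : ℂ) (M : (τ → ℂ) →ₗ[ℂ] (σ → ℂ)) (F : MvPolynomial σ (Polynomial ℂ))
    (q : τ → ℂ) : eval q (specialize t M F) =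
      eval (M q) (MvPolynomial.map (Polynomial.evalRingHom t) F) := by
  have h : (aeval q : MvPolynomial τ ℂ →ₐ[ℂ] ℂ).comp (aeval (linearForm M)) = aeval (M q) := by
    rw [comp_aeval]
    congr 1
    ext a
    rw [aeval_eq_eval]
    exact eval_linearForm M a q
  have h1 := DFunLike.congr_fun h (MvPolynomial.map (Polynomial.evalRingHom t) F)
  rwa [AlgHom.comp_apply, aeval_eq_eval, aeval_eq_eval] at h1

theorem specialize_isHomogeneous (t : ℂ) (M : (τ → ℂ) →ₗ[ℂ] (σ → ℂ))
    {F : MvPolynomial σ (Polynomial ℂ)} {n : ℕ} (hF : F.IsHomogeneous n) :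
    (specialize t M F).IsHomogeneous n := by
  have h := (hF.map (Polynomial.evalRingHom t)).aeval (linearForm M) (linearForm_isHomogeneous M)
  rwa [one_mul] at h

end Substitution

/-- The fibre of the family over `t` is the projective variety with affine cone `K`, for every cone
`K` that is linearly isomorphic to the isotropic cone of `ω_t`. -/
theorem isFiberAt_of_linear {τ : Type} [Fintype τ] [DecidableEq τ] (t : ℂ) (K : Set (τ → ℂ))
    (L : (PluckerIndex → ℂ) →ₗ[ℂ] (τ → ℂ)) (M : (τ → ℂ) →ₗ[ℂ] (PluckerIndex → ℂ))
    (hL : ∀ p ∈ isotropicCone (omegaForm t), L p ∈ K ∧ M (L p) = p)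
    (hM : ∀ q ∈ K, M q ∈ isotropicCone (omegaForm t) ∧ L (M q) = q) :
    IsFiberAt isotropicFamilyHom t (projSchemeHom (coneIdeal K)) := by
  set ev := Polynomial.evalRingHom t
  have hgen : ∀ F ∈ (familyIdeal (Polynomial.X : Polynomial ℂ)).toIdeal,
      MvPolynomial.map ev F ∈ (familyIdeal t).toIdeal := by
    intro F hF
    have h := Ideal.mem_map_of_mem (MvPolynomial.map ev) hF
    rwa [map_familyIdeal, show ev Polynomial.X = t from Polynomial.eval_X] at h
  have hle : ∀ F ∈ (familyIdeal (Polynomial.X : Polynomial ℂ)).toIdeal,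
      (Ideal.Quotient.mk (coneIdeal K).toIdeal).comp (specialize t M) F = 0 := by
    suffices h : (familyIdeal (Polynomial.X : Polynomial ℂ)).toIdeal ≤
        RingHom.ker ((Ideal.Quotient.mk (coneIdeal K).toIdeal).comp (specialize t M)) from
      fun F hF => h hF
    refine Ideal.span_le.mpr fun F hF => ?_
    obtain ⟨n, hn⟩ := equations_homogeneous _ F hF
    rw [SetLike.mem_coe, RingHom.mem_ker, RingHom.comp_apply, Ideal.Quotient.eq_zero_iff_mem]
    refine mem_coneIdeal_of_isHomogeneous (specialize_isHomogeneous t M hn) fun q hq => ?_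
    rw [eval_specialize]
    exact eval_eq_zero_of_mem_familyIdeal (hgen F (Ideal.subset_span hF)) (hM q hq).1
  let f : GradedRingHom (quotientGrading (familyIdeal (Polynomial.X : Polynomial ℂ)))
      (quotientGrading (coneIdeal K)) :=
    { toRingHom := Ideal.Quotient.lift _ _ hle
      map_mem := by
        rintro n _ ⟨F, hF, rfl⟩
        exact mk_mem_quotientGrading _ (specialize_isHomogeneous t M hF) }
  have hf (F : MvPolynomial PluckerIndex (Polynomial ℂ)) :
      f (Ideal.Quotient.mk _ F) = Ideal.Quotient.mk _ (specialize t M F) := rfl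
  have hC (G : MvPolynomial PluckerIndex ℂ) :
      MvPolynomial.map ev (MvPolynomial.map Polynomial.C G) = G := by
    rw [MvPolynomial.map_map]
    convert MvPolynomial.map_id G
    ext
    · simp [ev]
  -- `f` sets `X = t` and substitutes `M`. It is surjective, as `L` inverts `M` on `K`. If it maps
  -- `F` to zero, then the value of `F` at `X = t` vanishes on the isotropic cone, so it lies in
  -- the ideal of the equations, and `F` is a multiple of `X - t` modulo the ideal of the family.
  refine exists_isPullback_projStructure _ _ ev (fun c => ⟨Polynomial.C c, Polynomial.eval_C⟩) f
    ?_ ?_ ?_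
  · intro y
    obtain ⟨G, rfl⟩ := Ideal.Quotient.mk_surjective y
    suffices h : ∃ F, Ideal.Quotient.mk (coneIdeal K).toIdeal (specialize t M F) =
        Ideal.Quotient.mk _ G by
      obtain ⟨F, hF⟩ := h
      exact ⟨Ideal.Quotient.mk _ F, (hf F).trans hF⟩
    induction G using MvPolynomial.induction_on with
    | C r => exact ⟨C (Polynomial.C r), by simp [specialize]⟩
    | add G G' hG hG' =>
      obtain ⟨F, hF⟩ := hG
      obtain ⟨F', hF'⟩ := hG'
      exact ⟨F + F', by rw [map_add, map_add, map_add, hF, hF']⟩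
    | mul_X G b hG =>
      obtain ⟨F, hF⟩ := hG
      refine ⟨F * MvPolynomial.map Polynomial.C (linearForm L b), ?_⟩
      rw [map_mul, map_mul, map_mul, hF]
      congr 1
      refine Ideal.Quotient.eq.mpr (mem_coneIdeal_of_isHomogeneous (n := 1)
        ((specialize_isHomogeneous t M ((linearForm_isHomogeneous L b).map _)).sub
          (isHomogeneous_X ℂ b)) fun q hq => ?_)
      rw [map_sub, eval_specialize, hC, eval_linearForm, (hM q hq).2, eval_X, sub_self]
  · intro r
    refine (hf (C r)).trans ?_
    simp only [specialize, RingHom.comp_apply, map_C]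
    exact congrArg (Ideal.Quotient.mk _) (aeval_C _ _)
  · rintro n _ ⟨F, hF, rfl⟩ h
    have hF0 : MvPolynomial.map ev F ∈ (familyIdeal t).toIdeal := by
      rw [familyIdeal_eq_isotropicIdeal]
      refine mem_coneIdeal_of_isHomogeneous (hF.map ev) fun p hp => ?_
      have h1 := eval_eq_zero_of_mem_coneIdeal (Ideal.Quotient.eq_zero_iff_mem.mp h)
        (hL p hp).1
      rwa [eval_specialize, (hL p hp).2] at h1
    have hX : (familyIdeal t).toIdeal =
        (familyIdeal (Polynomial.X : Polynomial ℂ)).toIdeal.map (MvPolynomial.map ev) := by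
      rw [map_familyIdeal, show ev Polynomial.X = t from Polynomial.eval_X]
    rw [hX, Ideal.mem_map_iff_of_surjective _ (fun G => ⟨_, hC G⟩)] at hF0
    obtain ⟨G, hG, hGF⟩ := hF0
    -- `F` differs from an element of the ideal by a multiple of `X - t`
    have hdvd : C (Polynomial.X - Polynomial.C t) ∣ F - homogeneousComponent n G := by
      rw [C_dvd_iff_dvd_coeff]
      intro d
      rw [Polynomial.dvd_iff_isRoot, coeff_sub, coeff_homogeneousComponent, Polynomial.IsRoot.def]
      have h1 := congrArg (coeff d) hGF
      rw [coeff_map, coeff_map] at h1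
      split_ifs with hd
      · rw [Polynomial.eval_sub]
        exact sub_eq_zero.mpr h1.symm
      · rw [sub_zero, hF.coeff_eq_zero hd, Polynomial.eval_zero]
    obtain ⟨B, hB⟩ := hdvd
    refine ⟨Polynomial.X - Polynomial.C t, Ideal.Quotient.mk _ (homogeneousComponent n B),
      mk_mem_quotientGrading _ (homogeneousComponent_isHomogeneous n B), by simp [ev], ?_⟩
    have h1 := congrArg (homogeneousComponent n) hB
    rw [homogeneousComponent_C_mul, map_sub, homogeneousComponent_of_mem hF, if_pos rfl,
      homogeneousComponent_of_mem (homogeneousComponent_isHomogeneous n G), if_pos rfl,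
      ← smul_eq_C_mul] at h1
    have h2 := congrArg (Ideal.Quotient.mkₐ (Polynomial ℂ)
      (familyIdeal (Polynomial.X : Polynomial ℂ)).toIdeal) h1
    rw [map_sub, map_smul] at h2
    have h3 : Ideal.Quotient.mkₐ (Polynomial ℂ) (familyIdeal (Polynomial.X : Polynomial ℂ)).toIdeal
        (homogeneousComponent n G) = 0 :=
      Ideal.Quotient.eq_zero_iff_mem.mpr (homogeneousComponent_mem hG n)
    rw [h3, sub_zero] at h2
    exact h2

end Cones

/-! ### Flatness and properness -/

section Structure

/-- The coordinate ring of the family is torsion-free over `ℂ[t]`. -/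
theorem flat_isotropicFamilyHom : Flat isotropicFamilyHom :=
  flat_projStructure (quotientGrading (familyIdeal (Polynomial.X : Polynomial ℂ)))
    (smul_eq_zero_of_quotient _)

theorem isProper_isotropicFamilyHom : IsProper isotropicFamilyHom := by
  have : Algebra.FiniteType (Polynomial ℂ) (MvPolynomial PluckerIndex (Polynomial ℂ) ⧸
      (familyIdeal (Polynomial.X : Polynomial ℂ)).toIdeal) :=
    Algebra.FiniteType.of_surjective (Ideal.Quotient.mkₐ (Polynomial ℂ) _)
      Ideal.Quotient.mk_surjective
  refine isProper_projStructure (quotientGrading (familyIdeal (Polynomial.X : Polynomial ℂ))) ?_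
  rintro ⟨_, F, hF, rfl⟩
  refine ⟨MvPolynomial.coeff 0 F, Subtype.ext ?_⟩
  have h : F = MvPolynomial.C (MvPolynomial.coeff 0 F) :=
    MvPolynomial.totalDegree_eq_zero_iff_eq_C.mp
      (Nat.le_zero.mp (MvPolynomial.IsHomogeneous.totalDegree_le hF))
  exact congrArg (Ideal.Quotient.mk _) h.symm

end Structure

/-! ### The open orbit of four-forms -/

section Action

theorem coe_exteriorPower_map (g : V7 →ₗ[ℂ] V7) (ω : FourForm) :
    (exteriorPower.map 4 g ω : ExteriorAlgebra ℂ V7) = ExteriorAlgebra.map g ω := by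
  have h : (⋀[ℂ]^4 V7).subtype ∘ₗ exteriorPower.map 4 g =
      (ExteriorAlgebra.map g).toLinearMap ∘ₗ (⋀[ℂ]^4 V7).subtype := by
    refine exteriorPower.linearMap_ext (AlternatingMap.ext fun v => ?_)
    simp only [LinearMap.compAlternatingMap_apply, LinearMap.comp_apply,
      exteriorPower.map_apply_ιMulti, Submodule.subtype_apply, exteriorPower.ιMulti_apply_coe,
      AlgHom.toLinearMap_apply, ExteriorAlgebra.map_apply_ιMulti]
  exact DFunLike.congr_fun h ω

theorem map_map_four (g h : V7 →ₗ[ℂ] V7) (ω : FourForm) :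
    exteriorPower.map 4 g (exteriorPower.map 4 h ω) = exteriorPower.map 4 (g ∘ₗ h) ω := by
  rw [exteriorPower.map_comp]
  rfl

theorem extDerivation_algebraMap (A : V7 →ₗ[ℂ] V7) (r : ℂ) :
    extDerivation A (algebraMap ℂ _ r) = 0 := by
  rw [extDerivation_apply, AlgHom.commutes]
  rfl

/-- Naturality of the derivations of the exterior algebra. -/
theorem extDerivation_map {A B g : V7 →ₗ[ℂ] V7} (h : B ∘ₗ g = g ∘ₗ A) (x : ExteriorAlgebra ℂ V7) :
    extDerivation B (ExteriorAlgebra.map g x) = ExteriorAlgebra.map g (extDerivation A x) := by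
  induction x using ExteriorAlgebra.induction with
  | algebraMap r =>
    rw [AlgHom.commutes, extDerivation_algebraMap, extDerivation_algebraMap, map_zero]
  | ι v =>
    rw [ExteriorAlgebra.map_apply_ι, extDerivation_ι, extDerivation_ι, ExteriorAlgebra.map_apply_ι]
    exact congrArg _ (DFunLike.congr_fun h v)
  | mul a b ha hb =>
    rw [map_mul, extDerivation_mul, extDerivation_mul, ha, hb, map_add, map_mul, map_mul]
  | add a b ha hb => rw [map_add, map_add, map_add, map_add, ha, hb]

theorem extDerivation_add (A B : V7 →ₗ[ℂ] V7) (x : ExteriorAlgebra ℂ V7) :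
    extDerivation (A + B) x = extDerivation A x + extDerivation B x := by
  induction x using ExteriorAlgebra.induction with
  | algebraMap r => simp only [extDerivation_algebraMap, add_zero]
  | ι v => simp only [extDerivation_ι, LinearMap.add_apply, map_add]
  | mul a b ha hb =>
    simp only [extDerivation_mul, ha, hb]
    noncomm_ring
  | add a b ha hb =>
    simp only [map_add, ha, hb]
    abel

theorem extDerivation_smul (c : ℂ) (A : V7 →ₗ[ℂ] V7) (x : ExteriorAlgebra ℂ V7) :
    extDerivation (c • A) x = c • extDerivation A x := by
  induction x using ExteriorAlgebra.induction with
  | algebraMap r => simp only [extDerivation_algebraMap, smul_zero]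
  | ι v => simp only [extDerivation_ι, LinearMap.smul_apply, map_smul]
  | mul a b ha hb => simp only [extDerivation_mul, ha, hb, smul_add, smul_mul_assoc, mul_smul_comm]
  | add a b ha hb => simp only [map_add, ha, hb, smul_add]

/-- The infinitesimal action `A ↦ A · ω` of `𝔤𝔩(V)` on a four-form `ω`. -/
def infinitesimalAction (ω : FourForm) : (V7 →ₗ[ℂ] V7) →ₗ[ℂ] FourForm where
  toFun A := ⟨extDerivation A ω, extDerivation_mem A ω.2⟩
  map_add' A B := Subtype.ext (extDerivation_add A B ω)
  map_smul' c A := Subtype.ext (extDerivation_smul c A ω)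

theorem infinitesimalAction_add (ω η : FourForm) (A : V7 →ₗ[ℂ] V7) :
    infinitesimalAction (ω + η) A = infinitesimalAction ω A + infinitesimalAction η A :=
  Subtype.ext ((extDerivation A).map_add ω η)

theorem infinitesimalAction_smul (c : ℂ) (ω : FourForm) (A : V7 →ₗ[ℂ] V7) :
    infinitesimalAction (c • ω) A = c • infinitesimalAction ω A :=
  Subtype.ext ((extDerivation A).map_smul c ω)

theorem extDerivation_ιMulti (A : V7 →ₗ[ℂ] V7) {k : ℕ} (v : Fin k → V7) :
    extDerivation A (ExteriorAlgebra.ιMulti ℂ k v) =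
      ∑ a, ExteriorAlgebra.ιMulti ℂ k (Function.update v a (A (v a))) := by
  induction k with
  | zero =>
    rw [ExteriorAlgebra.ιMulti_zero_apply, ← map_one (algebraMap ℂ _), extDerivation_algebraMap]
    rfl
  | succ k ih =>
    have h1 : Matrix.vecTail (Function.update v 0 (A (v 0))) = Matrix.vecTail v := by
      ext a
      simp [Matrix.vecTail]
    have h2 (a : Fin k) : Matrix.vecTail (Function.update v a.succ (A (v a.succ))) =
        Function.update (Matrix.vecTail v) a (A (Matrix.vecTail v a)) := by
      ext b
      by_cases h : b = a
      · subst h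
        simp [Matrix.vecTail]
      · simp [Matrix.vecTail, h]
    rw [ExteriorAlgebra.ιMulti_succ_apply, extDerivation_mul, extDerivation_ι, ih,
      Fin.sum_univ_succ, ExteriorAlgebra.ιMulti_succ_apply, Function.update_self, h1,
      Finset.mul_sum]
    congr 1
    refine Finset.sum_congr rfl fun a _ => ?_
    rw [ExteriorAlgebra.ιMulti_succ_apply, h2, Function.update_of_ne (Fin.succ_ne_zero a).symm]

theorem finrank_fourForm : Module.finrank ℂ FourForm = 35 := by
  rw [exteriorPower.finrank_eq, Module.finrank_fin_fun]
  rfl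

/-- Coordinates on the space of four-forms. -/
def fourFormCoord : FourForm ≃ₗ[ℂ] (Fin 35 → ℂ) :=
  LinearEquiv.ofFinrankEq _ _ (by rw [finrank_fourForm, Module.finrank_fin_fun])

end Action

section OpenOrbit

theorem continuous_multilinear {k m : ℕ} (f : MultilinearMap ℂ (fun _ : Fin k => V7) (Fin m → ℂ)) :
    Continuous f := by
  have h (v : Fin k → V7) : f v = ∑ r : Fin k → Fin 7, (∏ a, v a (r a)) •
      f fun a => Pi.single (r a) 1 := by
    conv_lhs => rw [show v = fun a => ∑ i, v a i • Pi.single i (1 : ℂ) from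
      funext fun a => pi_eq_sum_univ' (v a)]
    rw [MultilinearMap.map_sum]
    exact Finset.sum_congr rfl fun r _ => f.map_smul_univ _ _
  rw [show ⇑f = _ from funext h]
  fun_prop

/-- The derivative of the orbit map of `ω` at the identity is the infinitesimal action. -/
theorem exists_hasStrictFDerivAt (ω : FourForm) :
    ∃ D : (V7 →L[ℂ] V7) →L[ℂ] (Fin 35 → ℂ), HasStrictFDerivAt
      (fun M : V7 →L[ℂ] V7 => fourFormCoord (exteriorPower.map 4 (M : V7 →ₗ[ℂ] V7) ω)) D 1 ∧
        ∀ A : V7 →L[ℂ] V7, D A = fourFormCoord (infinitesimalAction ω A) := by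
  have h : ω ∈ Submodule.span ℂ (Set.range (exteriorPower.ιMulti ℂ 4 (M := V7))) := by
    rw [exteriorPower.ιMulti_span]
    trivial
  induction h using Submodule.span_induction with
  | zero => exact ⟨0, by simpa using hasStrictFDerivAt_const _ _, fun A => by
      have h := infinitesimalAction_smul 0 0 A
      rw [zero_smul, zero_smul] at h
      rw [h, map_zero]
      rfl⟩
  | add ω η _ _ h1 h2 =>
    obtain ⟨D, hD, hD'⟩ := h1
    obtain ⟨E, hE, hE'⟩ := h2
    refine ⟨D + E, ?_, fun A => ?_⟩
    · simp only [map_add]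
      exact hD.add hE
    · rw [infinitesimalAction_add, map_add, ← hD', ← hE']
      rfl
  | smul c ω _ h1 =>
    obtain ⟨D, hD, hD'⟩ := h1
    refine ⟨c • D, ?_, fun A => ?_⟩
    · simp only [map_smul]
      exact hD.const_smul c
    · rw [infinitesimalAction_smul, map_smul, ← hD']
      rfl
  | mem ω hω =>
    obtain ⟨v, rfl⟩ := hω
    let f : MultilinearMap ℂ (fun _ : Fin 4 => V7) (Fin 35 → ℂ) :=
      fourFormCoord.toLinearMap.compMultilinearMap (exteriorPower.ιMulti ℂ 4).toMultilinearMap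
    let F : ContinuousMultilinearMap ℂ (fun _ : Fin 4 => V7) (Fin 35 → ℂ) :=
      ⟨f, continuous_multilinear f⟩
    let ev : (V7 →L[ℂ] V7) →L[ℂ] (Fin 4 → V7) :=
      ContinuousLinearMap.pi fun a => ContinuousLinearMap.apply ℂ V7 (v a)
    refine ⟨(F.linearDeriv v).comp ev, ?_, fun A => ?_⟩
    · have h1 : HasStrictFDerivAt F (F.linearDeriv v) (ev 1) := F.hasStrictFDerivAt v
      have h2 := h1.comp (1 : V7 →L[ℂ] V7) ev.hasStrictFDerivAt
      refine h2.congr_of_eventuallyEq (Filter.Eventually.of_forall fun M => ?_)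
      simp only [exteriorPower.map_apply_ιMulti]
      rfl
    · have h1 : infinitesimalAction (exteriorPower.ιMulti ℂ 4 v) A =
          ∑ a, exteriorPower.ιMulti ℂ 4 (Function.update v a (A (v a))) := by
        refine Subtype.ext ((extDerivation_ιMulti A.toLinearMap v).trans ?_)
        rw [AddSubmonoidClass.coe_finsetSum]
        rfl
      rw [h1, map_sum, ContinuousLinearMap.comp_apply, ContinuousMultilinearMap.linearDeriv_apply]
      rfl

/-- Equivalence of four-forms under `GL(V)`. -/
def FourFormEquivalent (ω η : FourForm) : Prop :=
  ∃ g : V7 ≃ₗ[ℂ] V7, η = exteriorPower.map 4 g.toLinearMap ω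

theorem FourFormEquivalent.symm {ω η : FourForm} (h : FourFormEquivalent ω η) :
    FourFormEquivalent η ω := by
  obtain ⟨g, rfl⟩ := h
  refine ⟨g.symm, ?_⟩
  rw [map_map_four, show g.symm.toLinearMap ∘ₗ g.toLinearMap = LinearMap.id by ext; simp,
    exteriorPower.map_id, LinearMap.id_apply]

theorem FourFormEquivalent.trans {ω η θ : FourForm} (h : FourFormEquivalent ω η)
    (h' : FourFormEquivalent η θ) : FourFormEquivalent ω θ := by
  obtain ⟨g, rfl⟩ := h
  obtain ⟨g', rfl⟩ := h'
  exact ⟨g.trans g', by rw [map_map_four]; rfl⟩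

/-- A four-form on which `𝔤𝔩(V)` acts with full rank has an open orbit, in the classical
topology. -/
theorem eventually_equivalent {ω : FourForm} (h : Function.Surjective (infinitesimalAction ω)) :
    ∀ᶠ y in nhds (fourFormCoord ω), FourFormEquivalent ω (fourFormCoord.symm y) := by
  obtain ⟨D, hD, hD'⟩ := exists_hasStrictFDerivAt ω
  have hsurj : D.range = ⊤ := by
    refine LinearMap.range_eq_top.mpr fun y => ?_
    obtain ⟨A, hA⟩ := h (fourFormCoord.symm y)
    refine ⟨LinearMap.toContinuousLinearMap A, ?_⟩
    refine (hD' _).trans ?_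
    rw [LinearMap.coe_toContinuousLinearMap, hA, LinearEquiv.apply_symm_apply]
  have h1 := hD.map_nhds_eq_of_surj hsurj
  have h2 : fourFormCoord (exteriorPower.map 4 ((1 : V7 →L[ℂ] V7) : V7 →ₗ[ℂ] V7) ω) =
      fourFormCoord ω := by
    rw [show ((1 : V7 →L[ℂ] V7) : V7 →ₗ[ℂ] V7) = LinearMap.id from rfl, exteriorPower.map_id,
      LinearMap.id_apply]
  rw [h2] at h1
  rw [← h1, Filter.eventually_map]
  filter_upwards [ContinuousLinearEquiv.nhds (ContinuousLinearEquiv.refl ℂ V7)] with M hM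
  obtain ⟨g, rfl⟩ := hM
  rw [LinearEquiv.symm_apply_apply]
  exact ⟨g.toLinearEquiv, rfl⟩

/-- The determinant of the coordinates of `A₀ · ω, …, A₃₄ · ω`. -/
def actionMinor (A : Fin 35 → V7 →ₗ[ℂ] V7) (ω : FourForm) : ℂ :=
  (Matrix.of fun i k => fourFormCoord (infinitesimalAction ω (A k)) i).det

/-- Having full rank is a Zariski open condition, given by the nonvanishing of minors. -/
theorem surjective_infinitesimalAction_iff (ω : FourForm) :
    Function.Surjective (infinitesimalAction ω) ↔ ∃ A, actionMinor A ω ≠ 0 := by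
  constructor
  · intro h
    choose A hA using fun k : Fin 35 => h (fourFormCoord.symm (Pi.single k 1))
    refine ⟨A, ?_⟩
    have h1 : (Matrix.of fun i k => fourFormCoord (infinitesimalAction ω (A k)) i) = 1 := by
      ext i k
      rw [Matrix.of_apply, hA, LinearEquiv.apply_symm_apply, Matrix.one_apply, Pi.single_apply]
    rw [actionMinor, h1, Matrix.det_one]
    exact one_ne_zero
  · rintro ⟨A, hA⟩ y
    set M := Matrix.of fun i k => fourFormCoord (infinitesimalAction ω (A k)) i with hM
    have hu : IsUnit M.det := isUnit_iff_ne_zero.mpr hA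
    refine ⟨∑ k, (M⁻¹.mulVec (fourFormCoord y)) k • A k, fourFormCoord.injective ?_⟩
    have h1 : M.mulVec (M⁻¹.mulVec (fourFormCoord y)) = fourFormCoord y := by
      rw [Matrix.mulVec_mulVec, Matrix.mul_nonsing_inv _ hu, Matrix.one_mulVec]
    conv_rhs => rw [← h1]
    ext i
    simp only [map_sum, map_smul, Finset.sum_apply, Pi.smul_apply, Matrix.mulVec, dotProduct,
      smul_eq_mul, hM, Matrix.of_apply]
    exact Finset.sum_congr rfl fun k _ => mul_comm _ _

/-- The restriction of `actionMinor A` to a line is a polynomial. -/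
theorem exists_polynomial_actionMinor (A : Fin 35 → V7 →ₗ[ℂ] V7) (ω η : FourForm) :
    ∃ p : Polynomial ℂ, ∀ s, p.eval s = actionMinor A (ω + s • η) := by
  refine ⟨(Matrix.of fun i k => Polynomial.C (fourFormCoord (infinitesimalAction ω (A k)) i) +
    Polynomial.X * Polynomial.C (fourFormCoord (infinitesimalAction η (A k)) i)).det, fun s => ?_⟩
  rw [← Polynomial.coe_evalRingHom, RingHom.map_det, actionMinor]
  congr 1
  ext i k
  simp only [infinitesimalAction_add, infinitesimalAction_smul, map_add, map_smul, Pi.add_apply,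
    Pi.smul_apply, smul_eq_mul, RingHom.mapMatrix_apply, Matrix.map_apply, Matrix.of_apply,
    Polynomial.coe_evalRingHom, Polynomial.eval_add, Polynomial.eval_mul, Polynomial.eval_C,
    Polynomial.eval_X]

/-- Any two four-forms on which `𝔤𝔩(V)` acts with full rank are equivalent: on the line joining
them, the forms of full rank are the complement of a finite set, which is connected, and equivalence
is an open condition there. -/
theorem equivalent_of_surjective {ω η : FourForm} (hω : Function.Surjective (infinitesimalAction ω))
    (hη : Function.Surjective (infinitesimalAction η)) : FourFormEquivalent ω η := by
  set ℓ : ℂ → FourForm := fun s => ω + s • (η - ω) with hℓ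
  set S : Set ℂ := {s | Function.Surjective (infinitesimalAction (ℓ s))} with hS
  obtain ⟨A, hA⟩ := (surjective_infinitesimalAction_iff ω).mp hω
  obtain ⟨p, hp⟩ := exists_polynomial_actionMinor A ω (η - ω)
  have hp0 : p ≠ 0 := by
    rintro rfl
    have h := hp 0
    rw [Polynomial.eval_zero, zero_smul, add_zero] at h
    exact hA h.symm
  have hcount : Sᶜ.Countable := by
    refine Set.Countable.mono (fun s hs => ?_) (p.roots.toFinset.countable_toSet)
    rw [Finset.mem_coe, Multiset.mem_toFinset, Polynomial.mem_roots hp0, Polynomial.IsRoot.def, hp]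
    by_contra h
    exact hs ((surjective_infinitesimalAction_iff _).mpr ⟨A, h⟩)
  have hconn : IsPreconnected S := by
    have h := hcount.isConnected_compl_of_one_lt_rank (by rw [Complex.rank_real_complex]; norm_num)
    rw [compl_compl] at h
    exact h.isPreconnected
  have hcont : Continuous fun s => fourFormCoord (ℓ s) := by
    simp only [hℓ, map_add, map_smul]
    fun_prop
  have h0 : ℓ 0 = ω := by simp [hℓ]
  have h1 : ℓ 1 = η := by simp [hℓ]
  have key := hconn.induction₂ (fun s s' => FourFormEquivalent (ℓ s) (ℓ s')) (fun s hs => ?_)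
    (fun _ _ _ _ _ _ h h' => h.trans h') (fun _ _ _ _ h => h.symm)
    (show (0 : ℂ) ∈ S by rwa [hS, Set.mem_ofPred_eq, h0])
    (show (1 : ℂ) ∈ S by rwa [hS, Set.mem_ofPred_eq, h1])
  · rwa [h0, h1] at key
  · refine Filter.Eventually.filter_mono nhdsWithin_le_nhds ?_
    have h := hcont.continuousAt.eventually (eventually_equivalent hs)
    simpa only [LinearEquiv.symm_apply_apply] using h

theorem isZariskiClosed_not_surjective :
    IsZariskiClosed {ω : FourForm | ¬Function.Surjective (infinitesimalAction ω)} := by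
  let ℓ (A : V7 →ₗ[ℂ] V7) (i : Fin 35) : Module.Dual ℂ FourForm :=
    { toFun := fun ω => fourFormCoord (infinitesimalAction ω A) i
      map_add' := fun ω η => by rw [infinitesimalAction_add, map_add, Pi.add_apply]
      map_smul' := fun c ω => by rw [infinitesimalAction_smul, map_smul]; rfl }
  refine ⟨Set.range fun A : Fin 35 → V7 →ₗ[ℂ] V7 =>
    (Matrix.of fun i k => MvPolynomial.X (R := ℂ) (ℓ (A k) i)).det, ?_⟩
  ext ω
  rw [Set.mem_ofPred_eq, surjective_infinitesimalAction_iff, Set.mem_ofPred_eq,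
    Set.forall_mem_range]
  push Not
  refine forall_congr' fun A => ?_
  rw [RingHom.map_det, actionMinor]
  refine iff_of_eq (congrArg (· = 0) (congrArg Matrix.det ?_))
  ext i k
  simp [ℓ]

theorem surjective_infinitesimalAction_of_equivalent {ω η : FourForm} (h : FourFormEquivalent ω η)
    (hω : Function.Surjective (infinitesimalAction ω)) :
    Function.Surjective (infinitesimalAction η) := by
  obtain ⟨g, rfl⟩ := h
  intro y
  obtain ⟨A, hA⟩ := hω (exteriorPower.map 4 g.symm.toLinearMap y)
  refine ⟨g.toLinearMap ∘ₗ A ∘ₗ g.symm.toLinearMap, Subtype.ext ?_⟩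
  have h1 := extDerivation_map (A := A) (B := g.toLinearMap ∘ₗ A ∘ₗ g.symm.toLinearMap)
    (g := g.toLinearMap) (by ext; simp) ω
  have h2 : extDerivation A ω = (exteriorPower.map 4 g.symm.toLinearMap y : FourForm) :=
    congrArg Subtype.val hA
  rw [h2, ← coe_exteriorPower_map, ← coe_exteriorPower_map, map_map_four,
    show g.toLinearMap ∘ₗ g.symm.toLinearMap = LinearMap.id by ext; simp,
    exteriorPower.map_id] at h1
  exact h1

/-- The orbit of a form on which `𝔤𝔩(V)` acts with full rank consists of all such forms, so it is
Zariski open. -/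
theorem isNondegenerate_of_surjective {ω : FourForm}
    (h : Function.Surjective (infinitesimalAction ω)) : ω.IsNondegenerate := by
  have h1 : {η : FourForm | ∃ g : V7 ≃ₗ[ℂ] V7, η = exteriorPower.map 4 g.toLinearMap ω}ᶜ =
      {η : FourForm | ¬Function.Surjective (infinitesimalAction η)} := by
    ext η
    exact not_congr ⟨fun h' => surjective_infinitesimalAction_of_equivalent h' h,
      fun h' => equivalent_of_surjective h h'⟩
  rw [FourForm.IsNondegenerate, h1]
  exact isZariskiClosed_not_surjective

/-- Two nonempty Zariski open subsets meet, so there is only one open orbit. -/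
theorem equivalent_of_isNondegenerate {ω η : FourForm} (hω : ω.IsNondegenerate)
    (hη : Function.Surjective (infinitesimalAction η)) : FourFormEquivalent η ω := by
  obtain ⟨S, hS⟩ := hω
  have h1 : ω ∉ {η : FourForm | ∃ g : V7 ≃ₗ[ℂ] V7, η = exteriorPower.map 4 g.toLinearMap ω}ᶜ :=
    fun h => h ⟨LinearEquiv.refl ℂ V7, by
      rw [LinearEquiv.refl_toLinearMap, exteriorPower.map_id, LinearMap.id_apply]⟩
  rw [hS, Set.mem_ofPred_eq] at h1
  push Not at h1
  obtain ⟨f, hf, hfω⟩ := h1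
  -- On the line joining `ω` and `η`, the polynomial `p` detects the orbit of `ω` and the polynomial
  -- `q` below the forms of full rank; the line has a point at which neither vanishes.
  let p : Polynomial ℂ := MvPolynomial.aeval
    (fun l : Module.Dual ℂ FourForm =>
      Polynomial.C (l ω) + Polynomial.X * Polynomial.C (l (η - ω))) f
  have hp (s : ℂ) : p.eval s = MvPolynomial.eval (fun l : Module.Dual ℂ FourForm =>
      l (ω + s • (η - ω))) f := by
    have h2 : (Polynomial.aeval s).comp (MvPolynomial.aeval fun l : Module.Dual ℂ FourForm =>
        Polynomial.C (l ω) + Polynomial.X * Polynomial.C (l (η - ω))) =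
        MvPolynomial.aeval fun l : Module.Dual ℂ FourForm => l (ω + s • (η - ω)) := by
      rw [MvPolynomial.comp_aeval]
      congr 1
      ext l
      simp
    exact DFunLike.congr_fun h2 f
  obtain ⟨A, hA⟩ := (surjective_infinitesimalAction_iff η).mp hη
  obtain ⟨q, hq⟩ := exists_polynomial_actionMinor A ω (η - ω)
  have hp0 : p ≠ 0 := by
    intro h
    have h2 := hp 0
    rw [h, Polynomial.eval_zero, zero_smul, add_zero] at h2
    exact hfω h2.symm
  have hq0 : q ≠ 0 := by
    rintro rfl
    have h2 := hq 1
    rw [Polynomial.eval_zero, one_smul, add_sub_cancel] at h2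
    exact hA h2.symm
  obtain ⟨s, hs⟩ : ∃ s, (p * q).eval s ≠ 0 := by
    by_contra! h
    exact mul_ne_zero hp0 hq0 (Polynomial.funext fun s => by rw [h, Polynomial.eval_zero])
  rw [Polynomial.eval_mul] at hs
  have h3 : ω + s • (η - ω) ∈
      {η : FourForm | ∃ g : V7 ≃ₗ[ℂ] V7, η = exteriorPower.map 4 g.toLinearMap ω} := by
    by_contra h
    have h4 : ω + s • (η - ω) ∈ {η : FourForm | ∃ g : V7 ≃ₗ[ℂ] V7,
      η = exteriorPower.map 4 g.toLinearMap ω}ᶜ := h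
    rw [hS] at h4
    exact left_ne_zero_of_mul hs ((hp s).trans (h4 f hf))
  have h5 : Function.Surjective (infinitesimalAction (ω + s • (η - ω))) :=
    (surjective_infinitesimalAction_iff _).mpr ⟨A, by rw [← hq]; exact right_ne_zero_of_mul hs⟩
  exact (equivalent_of_surjective hη h5).trans (FourFormEquivalent.symm h3)

end OpenOrbit

/-! ### The Lie algebra of the stabilizer of `ω₁` -/

section LieAlgebra

/-- The Gram matrix `S` of the symmetric form on `V` that is invariant under the stabilizer of `ω₁`;
it identifies bivectors with skew-adjoint endomorphisms. -/
def invariantForm : Matrix (Fin 7) (Fin 7) ℂ :=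
  !![0, 0, 0, 1, 0, 0, 0; 0, 0, 0, 0, 1, 0, 0; 0, 0, 0, 0, 0, 1, 0; 1, 0, 0, 0, 0, 0, 0;
    0, 1, 0, 0, 0, 0, 0; 0, 0, 1, 0, 0, 0, 0; 0, 0, 0, 0, 0, 0, 2]

/-- The inverse of `invariantForm`. -/
def invariantFormInv : Matrix (Fin 7) (Fin 7) ℂ :=
  !![0, 0, 0, 1, 0, 0, 0; 0, 0, 0, 0, 1, 0, 0; 0, 0, 0, 0, 0, 1, 0; 1, 0, 0, 0, 0, 0, 0;
    0, 1, 0, 0, 0, 0, 0; 0, 0, 1, 0, 0, 0, 0; 0, 0, 0, 0, 0, 0, 1 / 2]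

theorem mul_invariantForm_apply (Q : Matrix (Fin 7) (Fin 7) ℂ) (i j : Fin 7) :
    (Q * invariantForm) i j = Q i (![3, 4, 5, 0, 1, 2, 6] j) * ![1, 1, 1, 1, 1, 1, 2] j := by
  fin_cases j <;> simp [Matrix.mul_apply, Fin.sum_univ_seven, invariantForm]

theorem invariantForm_mul_inv : invariantForm * invariantFormInv = 1 := by
  ext i j
  fin_cases i <;> fin_cases j <;>
  simp [Matrix.mul_apply, Fin.sum_univ_seven, invariantForm, invariantFormInv]

theorem inv_mul_invariantForm : invariantFormInv * invariantForm = 1 :=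
  mul_eq_one_comm.mp invariantForm_mul_inv

theorem mul_inv_mul_invariantForm (A : Matrix (Fin 7) (Fin 7) ℂ) :
    A * invariantFormInv * invariantForm = A := by
  rw [Matrix.mul_assoc, inv_mul_invariantForm, Matrix.mul_one]

theorem mul_invariantForm_mul_inv (A : Matrix (Fin 7) (Fin 7) ℂ) :
    A * invariantForm * invariantFormInv = A := by
  rw [Matrix.mul_assoc, invariantForm_mul_inv, Matrix.mul_one]

theorem transpose_invariantForm : invariantForm.transpose = invariantForm := by
  ext i j
  fin_cases i <;> fin_cases j <;> rfl

theorem skew_of_upper {Q : Matrix (Fin 7) (Fin 7) ℂ} (k00 : Q 0 0 + Q 0 0 = 0) (k01 : Q 0 1 + Q 1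
  0 = 0) (k02 : Q 0 2 + Q 2 0 = 0) (k03 : Q 0 3 + Q 3 0 = 0) (k04 : Q 0 4 + Q 4 0 = 0) (k05 : Q 0 5
  + Q 5 0 = 0) (k06 : Q 0 6 + Q 6 0 = 0) (k11 : Q 1 1 + Q 1 1 = 0) (k12 : Q 1 2 + Q 2 1 = 0) (k13 :
  Q 1 3 + Q 3 1 = 0) (k14 : Q 1 4 + Q 4 1 = 0) (k15 : Q 1 5 + Q 5 1 = 0) (k16 : Q 1 6 + Q 6 1 = 0)
  (k22 : Q 2 2 + Q 2 2 = 0) (k23 : Q 2 3 + Q 3 2 = 0) (k24 : Q 2 4 + Q 4 2 = 0) (k25 : Q 2 5 + Q 5 2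
  = 0) (k26 : Q 2 6 + Q 6 2 = 0) (k33 : Q 3 3 + Q 3 3 = 0) (k34 : Q 3 4 + Q 4 3 = 0) (k35 : Q 3 5 +
  Q 5 3 = 0) (k36 : Q 3 6 + Q 6 3 = 0) (k44 : Q 4 4 + Q 4 4 = 0) (k45 : Q 4 5 + Q 5 4 = 0) (k46 : Q
  4 6 + Q 6 4 = 0) (k55 : Q 5 5 + Q 5 5 = 0) (k56 : Q 5 6 + Q 6 5 = 0) (k66 : Q 6 6 + Q 6 6 = 0) (i
  j : Fin 7) : Q j i = -Q i j := by
  refine eq_neg_of_add_eq_zero_left ?_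
  fin_cases i <;> fin_cases j <;> simp only [Fin.zero_eta, Fin.mk_one, Fin.reduceFinMk] <;>
  first | assumption | (rw [add_comm]; assumption)

/-- An endomorphism `Q S` kills `ω₁` if and only if `Q` is the skew-symmetric matrix of a bivector
  `q`
with `q ∧ ω₁ = 0`. -/
theorem extDerivation_mul_invariantForm_eq_zero_iff (Q : Matrix (Fin 7) (Fin 7) ℂ) :
    extDerivation (Matrix.toLin' (Q * invariantForm)) (omegaForm 1 : ExteriorAlgebra ℂ V7) = 0 ↔
      (∀ i j, Q j i = -Q i j) ∧ IsotropyEquations 1 Q := by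
  obtain ⟨e0123, e0124, e0125, e0126, e0134, e0135, e0136, e0145, e0146, e0156, e0234, e0235,
    e0236, e0245, e0246, e0256, e0345, e0346, e0356, e0456, e1234, e1235, e1236, e1245, e1246,
    e1256, e1345, e1346, e1356, e1456, e2345, e2346, e2356, e2456, e3456⟩ :=
    coord_extDerivation_omegaForm (Q * invariantForm)
  simp only [mul_invariantForm_apply, Matrix.cons_val, mul_one] at *
  constructor
  · intro h
    have z (l : List (Fin 7)) : coord l (extDerivation (Matrix.toLin' (Q * invariantForm))
        (omegaForm 1 : ExteriorAlgebra ℂ V7)) = 0 := by rw [h, map_zero]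
    have h0123 := e0123.symm.trans (z _)
    have h0124 := e0124.symm.trans (z _)
    have h0125 := e0125.symm.trans (z _)
    have h0126 := e0126.symm.trans (z _)
    have h0134 := e0134.symm.trans (z _)
    have h0135 := e0135.symm.trans (z _)
    have h0136 := e0136.symm.trans (z _)
    have h0145 := e0145.symm.trans (z _)
    have h0146 := e0146.symm.trans (z _)
    have h0156 := e0156.symm.trans (z _)
    have h0234 := e0234.symm.trans (z _)
    have h0235 := e0235.symm.trans (z _)
    have h0236 := e0236.symm.trans (z _)
    have h0245 := e0245.symm.trans (z _)
    have h0246 := e0246.symm.trans (z _)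
    have h0256 := e0256.symm.trans (z _)
    have h0345 := e0345.symm.trans (z _)
    have h0346 := e0346.symm.trans (z _)
    have h0356 := e0356.symm.trans (z _)
    have h0456 := e0456.symm.trans (z _)
    have h1234 := e1234.symm.trans (z _)
    have h1235 := e1235.symm.trans (z _)
    have h1236 := e1236.symm.trans (z _)
    have h1245 := e1245.symm.trans (z _)
    have h1246 := e1246.symm.trans (z _)
    have h1256 := e1256.symm.trans (z _)
    have h1345 := e1345.symm.trans (z _)
    have h1346 := e1346.symm.trans (z _)
    have h1356 := e1356.symm.trans (z _)
    have h1456 := e1456.symm.trans (z _)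
    have h2345 := e2345.symm.trans (z _)
    have h2346 := e2346.symm.trans (z _)
    have h2356 := e2356.symm.trans (z _)
    have h2456 := e2456.symm.trans (z _)
    have h3456 := e3456.symm.trans (z _)
    have k00 : Q 0 0 + Q 0 0 = 0 := by linear_combination (2) * h0456
    have k01 : Q 0 1 + Q 1 0 = 0 := by linear_combination (-1) * h0356 + h1456
    have k02 : Q 0 2 + Q 2 0 = 0 := by linear_combination h0346 + h2456
    have k03 : Q 0 3 + Q 3 0 = 0 := by linear_combination (1/2) * h0134 + (1/2) * h0235 + (-1/2) *
      h1245
    have k04 : Q 0 4 + Q 4 0 = 0 := by linear_combination h0245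
    have k05 : Q 0 5 + Q 5 0 = 0 := by linear_combination (-1) * h0145
    have k06 : Q 0 6 + Q 6 0 = 0 := by linear_combination (-1/2) * h0146 + (-1/2) * h0256 + (-1/2)
      * h0345
    have k11 : Q 1 1 + Q 1 1 = 0 := by linear_combination (-2) * h1356
    have k12 : Q 1 2 + Q 2 1 = 0 := by linear_combination h1346 + (-1) * h2356
    have k13 : Q 1 3 + Q 3 1 = 0 := by linear_combination h1235
    have k14 : Q 1 4 + Q 4 1 = 0 := by linear_combination (1/2) * h0134 + (-1/2) * h0235 + (1/2) *
      h1245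
    have k15 : Q 1 5 + Q 5 1 = 0 := by linear_combination h0135
    have k16 : Q 1 6 + Q 6 1 = 0 := by linear_combination (1/2) * h0136 + (-1/2) * h1256 + (-1/2)
      * h1345
    have k22 : Q 2 2 + Q 2 2 = 0 := by linear_combination (2) * h2346
    have k23 : Q 2 3 + Q 3 2 = 0 := by linear_combination (-1) * h1234
    have k24 : Q 2 4 + Q 4 2 = 0 := by linear_combination h0234
    have k25 : Q 2 5 + Q 5 2 = 0 := by linear_combination (-1/2) * h0134 + (1/2) * h0235 + (1/2) *
      h1245
    have k26 : Q 2 6 + Q 6 2 = 0 := by linear_combination (1/2) * h0236 + (1/2) * h1246 + (-1/2) *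
      h2345
    have k33 : Q 3 3 + Q 3 3 = 0 := by linear_combination (2) * h1236
    have k34 : Q 3 4 + Q 4 3 = 0 := by linear_combination (-1) * h0236 + h1246
    have k35 : Q 3 5 + Q 5 3 = 0 := by linear_combination h0136 + h1256
    have k36 : Q 3 6 + Q 6 3 = 0 := by linear_combination (1/2) * h0123 + (-1/2) * h1346 + (-1/2)
      * h2356
    have k44 : Q 4 4 + Q 4 4 = 0 := by linear_combination (-2) * h0246
    have k45 : Q 4 5 + Q 5 4 = 0 := by linear_combination h0146 + (-1) * h0256
    have k46 : Q 4 6 + Q 6 4 = 0 := by linear_combination (1/2) * h0124 + (1/2) * h0346 + (-1/2) *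
      h2456
    have k55 : Q 5 5 + Q 5 5 = 0 := by linear_combination (2) * h0156
    have k56 : Q 5 6 + Q 6 5 = 0 := by linear_combination (1/2) * h0125 + (1/2) * h0356 + (1/2) *
      h1456
    have k66 : Q 6 6 + Q 6 6 = 0 := by linear_combination (1/2) * h0126 + (-1/4) * h0134 + (-1/4)
      * h0235 + (-1/4) * h1245 + (1/2) * h3456
    refine ⟨skew_of_upper k00 k01 k02 k03 k04 k05 k06 k11 k12 k13 k14 k15 k16 k22 k23 k24 k25 k26
      k33 k34 k35 k36 k44 k45 k46 k55 k56 k66, ?_, ?_, ?_, ?_, ?_, ?_, ?_⟩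
    · linear_combination (1/2) * h0123 + (1/2) * h1346 + (-1/2) * h2356
    · linear_combination (-1/2) * h0124 + (1/2) * h0346 + (1/2) * h2456
    · linear_combination (1/2) * h0125 + (-1/2) * h0356 + (1/2) * h1456
    · linear_combination (1/2) * h0146 + (-1/2) * h0256 + (-1/2) * h0345
    · linear_combination (1/2) * h0136 + (1/2) * h1256 + (1/2) * h1345
    · linear_combination (-1/2) * h0236 + (1/2) * h1246 + (-1/2) * h2345
    · linear_combination (1/2) * h0126 + (1/4) * h0134 + (1/4) * h0235 + (1/4) * h1245 + (-1/2) *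
        h3456
  · rintro ⟨hQ, m0, m1, m2, m3, m4, m5, m6⟩
    have k00 := hQ 0 0
    have k01 := hQ 0 1
    have k02 := hQ 0 2
    have k03 := hQ 0 3
    have k04 := hQ 0 4
    have k05 := hQ 0 5
    have k06 := hQ 0 6
    have k11 := hQ 1 1
    have k12 := hQ 1 2
    have k13 := hQ 1 3
    have k14 := hQ 1 4
    have k15 := hQ 1 5
    have k16 := hQ 1 6
    have k22 := hQ 2 2
    have k23 := hQ 2 3
    have k24 := hQ 2 4
    have k25 := hQ 2 5
    have k26 := hQ 2 6
    have k33 := hQ 3 3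
    have k34 := hQ 3 4
    have k35 := hQ 3 5
    have k36 := hQ 3 6
    have k44 := hQ 4 4
    have k45 := hQ 4 5
    have k46 := hQ 4 6
    have k55 := hQ 5 5
    have k56 := hQ 5 6
    have k66 := hQ 6 6
    refine eq_zero_of_coord (extDerivation_mem _ (omegaForm 1).2) ?_
    rw [show (List.finRange 7).sublistsLen 4 = [[3, 4, 5, 6], [2, 4, 5, 6], [2, 3, 5, 6], [2, 3,
      4, 6], [2, 3, 4, 5], [1, 4, 5, 6], [1, 3, 5, 6], [1, 3, 4, 6], [1, 3, 4, 5], [1, 2, 5, 6], [1,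
      2, 4, 6], [1, 2, 4, 5], [1, 2, 3, 6], [1, 2, 3, 5], [1, 2, 3, 4], [0, 4, 5, 6], [0, 3, 5, 6],
      [0, 3, 4, 6], [0, 3, 4, 5], [0, 2, 5, 6], [0, 2, 4, 6], [0, 2, 4, 5], [0, 2, 3, 6], [0, 2, 3,
      5], [0, 2, 3, 4], [0, 1, 5, 6], [0, 1, 4, 6], [0, 1, 4, 5], [0, 1, 3, 6], [0, 1, 3, 5], [0, 1,
      3, 4], [0, 1, 2, 6], [0, 1, 2, 5], [0, 1, 2, 4], [0, 1, 2, 3]] by decide +kernel]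
    simp only [List.forall_mem_cons, List.not_mem_nil, false_imp_iff, implies_true, and_true]
    refine ⟨e3456.trans ?_, e2456.trans ?_, e2356.trans ?_, e2346.trans ?_, e2345.trans ?_,
      e1456.trans ?_, e1356.trans ?_, e1346.trans ?_, e1345.trans ?_, e1256.trans ?_, e1246.trans
      ?_, e1245.trans ?_, e1236.trans ?_, e1235.trans ?_, e1234.trans ?_, e0456.trans ?_,
      e0356.trans ?_, e0346.trans ?_, e0345.trans ?_, e0256.trans ?_, e0246.trans ?_, e0245.trans
      ?_, e0236.trans ?_, e0235.trans ?_, e0234.trans ?_, e0156.trans ?_, e0146.trans ?_,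
      e0145.trans ?_, e0136.trans ?_, e0135.trans ?_, e0134.trans ?_, e0126.trans ?_, e0125.trans
      ?_, e0124.trans ?_, e0123.trans ?_⟩
    · linear_combination k03 + k14 + k25 + k66 + (-1) * m6
    · linear_combination k02 + (-1) * k46 + (-1) * m1
    · linear_combination (-1) * k12 + (-1) * k36 + m0
    · linear_combination (1/2) * k22
    · linear_combination k34 + (-2) * m5
    · linear_combination k01 + k56 + (-1) * m2
    · linear_combination (-1/2) * k11
    · linear_combination (-1) * k36 + m0
    · linear_combination (-1) * k35 + (2) * m4
    · linear_combination (-1) * k16 + k35 + (-1) * m4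
    · linear_combination k26 + k34 + (-1) * m5
    · linear_combination k14 + k25
    · linear_combination (1/2) * k33
    · linear_combination k13
    · linear_combination (-1) * k23
    · linear_combination (1/2) * k00
    · linear_combination k56 + (-1) * m2
    · linear_combination k46 + m1
    · linear_combination k45 + (-2) * m3
    · linear_combination (-1) * k06 + (-1) * k45 + m3
    · linear_combination (-1/2) * k44
    · linear_combination k04
    · linear_combination k26 + (-1) * m5
    · linear_combination k03 + k25
    · linear_combination k24
    · linear_combination (1/2) * k55
    · linear_combination (-1) * k06 + m3
    · linear_combination (-1) * k05
    · linear_combination k16 + m4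
    · linear_combination k15
    · linear_combination k03 + k14
    · linear_combination k66 + m6
    · linear_combination (-1) * k01 + (2) * m2
    · linear_combination k02 + (-2) * m1
    · linear_combination (-1) * k12 + (2) * m0

theorem eq_zero_of_isotropyEquations {t : ℂ} {Q : Matrix (Fin 7) (Fin 7) ℂ}
    (hs : ∀ i j, Q j i = -Q i j) (hm : IsotropyEquations t Q) (q04 : Q 0 4 = 0) (q14 : Q 1 4 = 0)
    (q13 : Q 1 3 = 0) (q24 : Q 2 4 = 0) (q23 : Q 2 3 = 0) (q06 : Q 0 6 = 0) (q16 : Q 1 6 = 0)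
    (q46 : Q 4 6 = 0) (q36 : Q 3 6 = 0) (q05 : Q 0 5 = 0) (q15 : Q 1 5 = 0) (q56 : Q 5 6 = 0)
    (q25 : Q 2 5 = 0) (q26 : Q 2 6 = 0) : Q = 0 := by
  obtain ⟨m0, m1, m2, m3, m4, m5, m6⟩ := hm
  simp only [q14, q06, q16, q46, q36, q56, q25, q26, mul_zero, add_zero, sub_zero]
    at m0 m1 m2 m3 m4 m5 m6
  have hdiag (i : Fin 7) : Q i i = 0 := by
    have := hs i i
    rwa [eq_neg_iff_add_eq_zero, ← two_mul, mul_eq_zero, or_iff_right two_ne_zero] at this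
  ext i j
  rw [Matrix.zero_apply]
  fin_cases i <;> fin_cases j <;> simp only [Fin.zero_eta, Fin.mk_one, Fin.reduceFinMk] <;>
  first | assumption | exact hdiag _ | (rw [hs, neg_eq_zero]; assumption)

/-- The infinitesimal action on `ω₁` is surjective, because its kernel, the Lie algebra `𝔤₂`, is
determined by fourteen coordinates. -/
theorem surjective_infinitesimalAction_omegaForm_one :
    Function.Surjective (infinitesimalAction (omegaForm 1)) := by
  let T := infinitesimalAction (omegaForm 1)
  let idx : Fin 14 → Fin 7 × Fin 7 := ![(0, 4), (1, 4), (1, 3), (2, 4), (2, 3), (0, 6), (1, 6),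
    (4, 6), (3, 6), (0, 5), (1, 5), (5, 6), (2, 5), (2, 6)]
  let φ : (V7 →ₗ[ℂ] V7) →ₗ[ℂ] (Fin 14 → ℂ) :=
    { toFun := fun A k => (LinearMap.toMatrix' A * invariantFormInv) (idx k).1 (idx k).2
      map_add' := fun A B => by
        ext k
        simp [Matrix.add_mul]
      map_smul' := fun c A => by
        ext k
        simp }
  have hinj : Function.Injective (φ ∘ₗ (LinearMap.ker T).subtype) := by
    rw [injective_iff_map_eq_zero]
    rintro ⟨A, hA⟩ h
    set Q := LinearMap.toMatrix' A * invariantFormInv with hQ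
    have hQA : Matrix.toLin' (Q * invariantForm) = A := by
      rw [hQ, mul_inv_mul_invariantForm, Matrix.toLin'_toMatrix']
    have h1 : extDerivation (Matrix.toLin' (Q * invariantForm))
        (omegaForm 1 : ExteriorAlgebra ℂ V7) = 0 := by
      rw [hQA]
      exact congrArg Subtype.val (LinearMap.mem_ker.mp hA)
    obtain ⟨hs, hm⟩ := (extDerivation_mul_invariantForm_eq_zero_iff Q).mp h1
    have h2 (k : Fin 14) : Q (idx k).1 (idx k).2 = 0 := congrFun h k
    have hQ0 : Q = 0 := eq_zero_of_isotropyEquations hs hm (h2 0) (h2 1) (h2 2) (h2 3) (h2 4) (h2 5)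
      (h2 6) (h2 7) (h2 8) (h2 9) (h2 10) (h2 11) (h2 12) (h2 13)
    have hA0 : A = 0 := by rw [← hQA, hQ0, Matrix.zero_mul, map_zero]
    exact Subtype.ext hA0
  have h1 : Module.finrank ℂ (LinearMap.ker T) ≤ 14 := by
    have h := LinearMap.finrank_le_finrank_of_injective hinj
    rwa [Module.finrank_fin_fun] at h
  have h2 := T.finrank_range_add_finrank_ker
  have h3 : Module.finrank ℂ (V7 →ₗ[ℂ] V7) = 49 := by
    rw [Module.finrank_linearMap, Module.finrank_fin_fun]
  rw [h3] at h2
  refine LinearMap.range_eq_top.mp (Submodule.eq_top_of_finrank_eq ?_)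
  have h4 := (LinearMap.range T).finrank_le
  rw [finrank_fourForm] at h4 ⊢
  change Module.finrank ℂ (LinearMap.range T) = 35
  omega

theorem map_piCongrRight_decomposableForm (d : Fin 7 → ℂˣ) (i j k l : Fin 7) :
    exteriorPower.map 4 (LinearEquiv.piCongrRight fun i =>
        LinearEquiv.smulOfUnit (M := ℂ) (d i)).toLinearMap (decomposableForm i j k l) =
      (d i * d j * d k * d l : ℂ) • decomposableForm i j k l := by
  have h (i : Fin 7) : (LinearEquiv.piCongrRight fun i =>
      LinearEquiv.smulOfUnit (M := ℂ) (d i)) (Pi.single i 1) = (d i : ℂ) • Pi.single i (1 : ℂ) := by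
    ext j
    rcases eq_or_ne j i with rfl | hj
    · simp [LinearEquiv.smulOfUnit, Units.smul_def]
    · simp [hj]
  rw [decomposableForm, exteriorPower.map_apply_ιMulti]
  have h1 := (exteriorPower.ιMulti ℂ 4 (M := V7)).map_smul_univ ![(d i : ℂ), d j, d k, d l]
    ![Pi.single i (1 : ℂ), Pi.single j (1 : ℂ), Pi.single k (1 : ℂ), Pi.single l (1 : ℂ)]
  rw [Fin.prod_univ_four] at h1
  refine Eq.trans (congrArg _ (funext fun a => ?_)) h1
  fin_cases a <;> exact h _

/-- All `ω_t` with `t ≠ 0` are equivalent, under diagonal matrices whose entries are powers of a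
fourth root of `t`. -/
theorem omegaForm_equivalent {t : ℂ} (ht : t ≠ 0) :
    FourFormEquivalent (omegaForm 1) (omegaForm t) := by
  obtain ⟨r, hr⟩ : ∃ r : ℂ, r ^ 4 = t := IsAlgClosed.exists_pow_nat_eq t (by norm_num)
  have hr0 : r ≠ 0 := by
    rintro rfl
    exact ht (by rw [← hr]; norm_num)
  let u := Units.mk0 r hr0
  refine ⟨LinearEquiv.piCongrRight fun i =>
    LinearEquiv.smulOfUnit (M := ℂ) (![u, u, u⁻¹, u, u, u⁻¹, u⁻¹] i), ?_⟩
  simp only [omegaForm, map_add, map_smul, map_piCongrRight_decomposableForm]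
  simp [u, hr0, ← hr]
  ring_nf

theorem omegaForm_isNondegenerate {t : ℂ} (ht : t ≠ 0) : (omegaForm t).IsNondegenerate :=
  isNondegenerate_of_surjective (surjective_infinitesimalAction_of_equivalent
    (omegaForm_equivalent ht) surjective_infinitesimalAction_omegaForm_one)

end LieAlgebra

/-! ### Change of coordinates -/

section Transport

/-- The Plücker coordinates of a skew-symmetric matrix, as a linear map. -/
def upperEntries : Matrix (Fin 7) (Fin 7) ℂ →ₗ[ℂ] (PluckerIndex → ℂ) where
  toFun P a := P a.1.1 a.1.2
  map_add' _ _ := rfl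
  map_smul' _ _ := rfl

/-- The linear map underlying `skewMatrix`. -/
def skewMatrixLinear : (PluckerIndex → ℂ) →ₗ[ℂ] Matrix (Fin 7) (Fin 7) ℂ where
  toFun := skewMatrix
  map_add' p q := by
    ext i j
    simp only [Matrix.add_apply, ← eval_genericEntry, genericEntry]
    split_ifs
    · simp
    · simp [add_comm]
    · simp
  map_smul' c p := by
    ext i j
    simp only [Matrix.smul_apply, ← eval_genericEntry, genericEntry]
    split_ifs <;> simp

/-- `P` is the skew-symmetric matrix of a decomposable bivector `v ∧ w` with `v ∧ w ∧ ω = 0`. -/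
def IsotropicMatrix (ω : FourForm) (P : Matrix (Fin 7) (Fin 7) ℂ) : Prop :=
  ∃ v w : V7, ExteriorAlgebra.ι ℂ v * ExteriorAlgebra.ι ℂ w * (ω : ExteriorAlgebra ℂ V7) = 0 ∧
    P = Matrix.vecMulVec v w - Matrix.vecMulVec w v

theorem IsotropicMatrix.swap {ω : FourForm} {P : Matrix (Fin 7) (Fin 7) ℂ}
    (h : IsotropicMatrix ω P) (i j : Fin 7) : P j i = -P i j := by
  obtain ⟨v, w, -, rfl⟩ := h
  simp only [Matrix.sub_apply, Matrix.vecMulVec_apply]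
  ring

theorem upperEntries_skewMatrix (p : PluckerIndex → ℂ) : upperEntries (skewMatrix p) = p :=
  funext fun a => skewMatrix_apply p a

theorem skewMatrix_upperEntries {P : Matrix (Fin 7) (Fin 7) ℂ} (h : ∀ i j, P j i = -P i j) :
    skewMatrix (upperEntries P) = P :=
  skewMatrix_eq_of_forall h fun _ => rfl

theorem mem_isotropicCone_iff (ω : FourForm) (p : PluckerIndex → ℂ) :
    p ∈ isotropicCone ω ↔ IsotropicMatrix ω (skewMatrix p) := by
  refine exists_congr fun v => exists_congr fun w => and_congr_right fun _ => ⟨fun h => ?_,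
    fun h a => ?_⟩
  · refine skewMatrix_eq_of_forall (fun i j => ?_) fun a => ?_
    · simp only [Matrix.sub_apply, Matrix.vecMulVec_apply]
      ring
    · rw [h a, Matrix.sub_apply, Matrix.vecMulVec_apply, Matrix.vecMulVec_apply, mul_comm (w _)]
  · rw [← skewMatrix_apply p, h, Matrix.sub_apply, Matrix.vecMulVec_apply, Matrix.vecMulVec_apply,
      mul_comm (w _)]

theorem upperEntries_mem_isotropicCone {ω : FourForm} {P : Matrix (Fin 7) (Fin 7) ℂ}
    (h : IsotropicMatrix ω P) : upperEntries P ∈ isotropicCone ω := by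
  rwa [mem_isotropicCone_iff, skewMatrix_upperEntries h.swap]

theorem isotropicMatrix_omegaForm_iff (t : ℂ) (P : Matrix (Fin 7) (Fin 7) ℂ) :
    IsotropicMatrix (omegaForm t) P ↔ (∀ i j, P j i = -P i j) ∧ IsotropyEquations t P ∧
      ∀ i j k l, P i j * P k l - P i k * P j l + P i l * P j k = 0 := by
  constructor
  · intro h
    have h1 := (mem_isotropicCone_omegaForm_iff t _).mp (upperEntries_mem_isotropicCone h)
    rw [skewMatrix_upperEntries h.swap] at h1
    exact ⟨h.swap, h1⟩
  · rintro ⟨hs, h1⟩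
    rw [← skewMatrix_upperEntries hs, ← mem_isotropicCone_iff, mem_isotropicCone_omegaForm_iff,
      skewMatrix_upperEntries hs]
    exact h1

theorem IsotropicMatrix.map {ω : FourForm} {P : Matrix (Fin 7) (Fin 7) ℂ}
    (h : IsotropicMatrix ω P) (G : Matrix (Fin 7) (Fin 7) ℂ) :
    IsotropicMatrix (exteriorPower.map 4 (Matrix.toLin' G) ω) (G * P * G.transpose) := by
  obtain ⟨v, w, h, rfl⟩ := h
  refine ⟨G.mulVec v, G.mulVec w, ?_, ?_⟩
  · have h1 := congrArg (ExteriorAlgebra.map (Matrix.toLin' G)) h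
    rw [map_mul, map_mul, map_zero, ExteriorAlgebra.map_apply_ι, ExteriorAlgebra.map_apply_ι,
      ← coe_exteriorPower_map] at h1
    exact h1
  · rw [Matrix.mul_sub, Matrix.sub_mul, Matrix.mul_vecMulVec, Matrix.mul_vecMulVec,
      Matrix.vecMulVec_mul, Matrix.vecMulVec_mul, Matrix.vecMul_transpose, Matrix.vecMul_transpose]

theorem FourFormEquivalent.exists_matrix {ω η : FourForm} (h : FourFormEquivalent ω η) :
    ∃ G H : Matrix (Fin 7) (Fin 7) ℂ, G * H = 1 ∧ exteriorPower.map 4 (Matrix.toLin' G) ω = η := by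
  obtain ⟨g, rfl⟩ := h
  refine ⟨LinearMap.toMatrix' g.toLinearMap, LinearMap.toMatrix' g.symm.toLinearMap, ?_, ?_⟩
  · rw [← LinearMap.toMatrix'_comp, LinearEquiv.comp_symm, LinearMap.toMatrix'_id]
  · rw [Matrix.toLin'_toMatrix']

theorem map_eq_of_mul_eq_one {ω η : FourForm} {G H : Matrix (Fin 7) (Fin 7) ℂ} (hHG : H * G = 1)
    (h : exteriorPower.map 4 (Matrix.toLin' G) ω = η) :
    exteriorPower.map 4 (Matrix.toLin' H) η = ω := by
  rw [← h, map_map_four, ← Matrix.toLin'_mul, hHG, Matrix.toLin'_one, exteriorPower.map_id]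
  rfl

theorem mul_cancel_transpose {G H P : Matrix (Fin 7) (Fin 7) ℂ} (h : H * G = 1) :
    H * (G * P * G.transpose) * H.transpose = P := by
  have h1 : G.transpose * H.transpose = 1 := by
    rw [← Matrix.transpose_mul, h, Matrix.transpose_one]
  rw [Matrix.mul_assoc, Matrix.mul_assoc, Matrix.mul_assoc, h1, Matrix.mul_one, ← Matrix.mul_assoc,
    h, Matrix.one_mul]

/-- The isotropic variety of a form equivalent to `ω_t` is a fibre of the family over `t`. -/
theorem isFiberAt_of_equivalent {t : ℂ} {ω : FourForm} (h : FourFormEquivalent (omegaForm t) ω) :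
    IsFiberAt isotropicFamilyHom t (projSchemeHom (isotropicIdeal ω)) := by
  obtain ⟨G, H, hGH, hG⟩ := h.exists_matrix
  have hHG : H * G = 1 := mul_eq_one_comm.mp hGH
  have hH := map_eq_of_mul_eq_one hHG hG
  refine isFiberAt_of_linear t (isotropicCone ω)
    (upperEntries ∘ₗ LinearMap.mulRight ℂ G.transpose ∘ₗ LinearMap.mulLeft ℂ G ∘ₗ skewMatrixLinear)
    (upperEntries ∘ₗ LinearMap.mulRight ℂ H.transpose ∘ₗ LinearMap.mulLeft ℂ H ∘ₗ skewMatrixLinear)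
    (fun p hp => ?_) (fun q hq => ?_)
  · have h1 := ((mem_isotropicCone_iff _ _).mp hp).map G
    rw [hG] at h1
    refine ⟨upperEntries_mem_isotropicCone h1, ?_⟩
    change upperEntries (H * skewMatrix (upperEntries (G * skewMatrix p * G.transpose)) *
      H.transpose) = p
    rw [skewMatrix_upperEntries h1.swap, mul_cancel_transpose hHG, upperEntries_skewMatrix]
  · have h1 := ((mem_isotropicCone_iff _ _).mp hq).map H
    rw [hH] at h1
    refine ⟨upperEntries_mem_isotropicCone h1, ?_⟩
    change upperEntries (G * skewMatrix (upperEntries (H * skewMatrix q * H.transpose)) *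
      G.transpose) = q
    rw [skewMatrix_upperEntries h1.swap, mul_cancel_transpose hGH, upperEntries_skewMatrix]

/-- The cone of the endomorphisms `P S`, where `P` runs through the matrices of isotropic bivectors
of a form equivalent to `ω_t` and `S` is invertible, also defines a fibre over `t`. -/
theorem isFiberAt_matrixConeIdeal {t : ℂ} {ω : FourForm} (h : FourFormEquivalent (omegaForm t) ω)
    {S T : Matrix (Fin 7) (Fin 7) ℂ} (hST : S * T = 1) :
    IsFiberAt isotropicFamilyHom t
      (projSchemeHom (matrixConeIdeal {B | ∃ P, IsotropicMatrix ω P ∧ B = P * S})) := by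
  obtain ⟨G, H, hGH, hG⟩ := h.exists_matrix
  have hHG : H * G = 1 := mul_eq_one_comm.mp hGH
  have hH := map_eq_of_mul_eq_one hHG hG
  let e : Matrix (Fin 7) (Fin 7) ℂ →ₗ[ℂ] (Fin 7 × Fin 7 → ℂ) :=
    { toFun := fun B ij => B ij.1 ij.2
      map_add' := fun _ _ => rfl
      map_smul' := fun _ _ => rfl }
  let e' : (Fin 7 × Fin 7 → ℂ) →ₗ[ℂ] Matrix (Fin 7) (Fin 7) ℂ :=
    { toFun := fun f => Matrix.of fun i j => f (i, j)
      map_add' := fun _ _ => rfl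
      map_smul' := fun _ _ => rfl }
  refine isFiberAt_of_linear t _
    (e ∘ₗ LinearMap.mulRight ℂ S ∘ₗ LinearMap.mulRight ℂ G.transpose ∘ₗ LinearMap.mulLeft ℂ G ∘ₗ
      skewMatrixLinear)
    (upperEntries ∘ₗ LinearMap.mulRight ℂ H.transpose ∘ₗ LinearMap.mulLeft ℂ H ∘ₗ
      LinearMap.mulRight ℂ T ∘ₗ e')
    (fun p hp => ?_) ?_
  · have h1 := ((mem_isotropicCone_iff _ _).mp hp).map G
    rw [hG] at h1
    refine ⟨⟨_, ⟨_, h1, rfl⟩, rfl⟩, ?_⟩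
    change upperEntries (H * (G * skewMatrix p * G.transpose * S * T) * H.transpose) = p
    rw [Matrix.mul_assoc _ S, hST, Matrix.mul_one, mul_cancel_transpose hHG,
      upperEntries_skewMatrix]
  · rintro _ ⟨_, ⟨P, hP, rfl⟩, rfl⟩
    have h1 := hP.map H
    rw [hH] at h1
    have h2 : H * (P * S * T) * H.transpose = H * P * H.transpose := by
      rw [Matrix.mul_assoc _ S, hST, Matrix.mul_one]
    constructor
    · change upperEntries (H * (P * S * T) * H.transpose) ∈ _
      rw [h2]
      exact upperEntries_mem_isotropicCone h1
    · change e (G * skewMatrix (upperEntries (H * (P * S * T) * H.transpose)) * G.transpose * S) =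
        e (P * S)
      rw [h2, skewMatrix_upperEntries h1.swap, mul_cancel_transpose hGH]

theorem IsZariskiClosed.image {W W' : Type} [AddCommGroup W] [Module ℂ W] [AddCommGroup W']
    [Module ℂ W'] {Z : Set W} (hZ : IsZariskiClosed Z) (e : W ≃ₗ[ℂ] W') :
    IsZariskiClosed (e '' Z) := by
  obtain ⟨S, rfl⟩ := hZ
  refine ⟨MvPolynomial.rename (fun l => l ∘ₗ e.symm.toLinearMap) '' S, ?_⟩
  ext w
  rw [LinearEquiv.image_eq_preimage_symm]
  simp only [Set.mem_preimage, Set.mem_ofPred_eq, Set.forall_mem_image, MvPolynomial.eval_rename]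
  rfl

/-- The adjoint cone of an equivalent form is obtained by conjugation. -/
theorem IsAdjointCone.conj {ω η : FourForm} {C : Set (Matrix (Fin 7) (Fin 7) ℂ)}
    (hC : IsAdjointCone ω C) {G H : Matrix (Fin 7) (Fin 7) ℂ} (hGH : G * H = 1)
    (hG : exteriorPower.map 4 (Matrix.toLin' G) ω = η) :
    IsAdjointCone η {B | ∃ A ∈ C, B = G * A * H} := by
  have hHG : H * G = 1 := mul_eq_one_comm.mp hGH
  have hH := map_eq_of_mul_eq_one hHG hG
  obtain ⟨hZ, A, ⟨hA1, hA2⟩, hA0, rfl⟩ := hC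
  have hGA : G * A * H * G = G * A := by rw [Matrix.mul_assoc, hHG, Matrix.mul_one]
  have conj_mem {G H : Matrix (Fin 7) (Fin 7) ℂ} {ω η : FourForm} (hGH : G * H = 1)
      (hG : exteriorPower.map 4 (Matrix.toLin' G) ω = η)
      {g : Matrix.SpecialLinearGroup (Fin 7) ℂ} (hg : g ∈ stabilizerGroup ω) :
      ∃ k ∈ stabilizerGroup η, (k : Matrix (Fin 7) (Fin 7) ℂ) = G * g * H ∧
        ((k⁻¹ : Matrix.SpecialLinearGroup (Fin 7) ℂ) : Matrix (Fin 7) (Fin 7) ℂ) =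
          G * ((g⁻¹ : Matrix.SpecialLinearGroup (Fin 7) ℂ) : Matrix (Fin 7) (Fin 7) ℂ) * H := by
    have hHG : H * G = 1 := mul_eq_one_comm.mp hGH
    have hdet : (G * (g : Matrix (Fin 7) (Fin 7) ℂ) * H).det = 1 := by
      rw [Matrix.det_mul, Matrix.det_mul, g.2, mul_one, ← Matrix.det_mul, hGH, Matrix.det_one]
    refine ⟨⟨_, hdet⟩, ?_, rfl, ?_⟩
    · change exteriorPower.map 4 (Matrix.toLin' (G * (g : Matrix (Fin 7) (Fin 7) ℂ) * H)) η = η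
      rw [Matrix.toLin'_mul, Matrix.toLin'_mul, ← map_map_four, ← map_map_four,
        map_eq_of_mul_eq_one hHG hG, show exteriorPower.map 4 (Matrix.toLin'
          (g : Matrix (Fin 7) (Fin 7) ℂ)) ω = ω from hg, hG]
    · refine left_inv_eq_right_inv (a := G * (g : Matrix (Fin 7) (Fin 7) ℂ) * H) ?_ ?_
      · exact congrArg
          (fun k : Matrix.SpecialLinearGroup (Fin 7) ℂ => (k : Matrix (Fin 7) (Fin 7) ℂ))
          (inv_mul_cancel (show Matrix.SpecialLinearGroup (Fin 7) ℂ from ⟨_, hdet⟩))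
      · have h1 : (g : Matrix (Fin 7) (Fin 7) ℂ) *
            ((g⁻¹ : Matrix.SpecialLinearGroup (Fin 7) ℂ) : Matrix (Fin 7) (Fin 7) ℂ) = 1 := by
          rw [← Matrix.SpecialLinearGroup.coe_mul, mul_inv_cancel,
            Matrix.SpecialLinearGroup.coe_one]
        calc _ = G * g * (H * G) * ((g⁻¹ : Matrix.SpecialLinearGroup (Fin 7) ℂ) :
              Matrix (Fin 7) (Fin 7) ℂ) * H := by simp only [Matrix.mul_assoc]
          _ = 1 := by rw [hHG, Matrix.mul_one, Matrix.mul_assoc G, h1, Matrix.mul_one, hGH]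
  refine ⟨?_, G * A * H, ⟨?_, ?_⟩, fun h => hA0 ?_, ?_⟩
  · let e : Matrix (Fin 7) (Fin 7) ℂ ≃ₗ[ℂ] Matrix (Fin 7) (Fin 7) ℂ :=
      LinearEquiv.ofLinearMap (LinearMap.mulRight ℂ H ∘ₗ LinearMap.mulLeft ℂ G)
        (LinearMap.mulRight ℂ G ∘ₗ LinearMap.mulLeft ℂ H)
        (LinearMap.ext fun B => by
          change G * (H * B * G) * H = B
          rw [Matrix.mul_assoc, Matrix.mul_assoc, hGH, Matrix.mul_one, ← Matrix.mul_assoc, hGH,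
            Matrix.one_mul])
        (LinearMap.ext fun B => by
          change H * (G * B * H) * G = B
          rw [Matrix.mul_assoc, Matrix.mul_assoc, hHG, Matrix.mul_one, ← Matrix.mul_assoc, hHG,
            Matrix.one_mul])
    convert hZ.image e using 1
    ext B
    exact exists_congr fun A => and_congr_right fun _ => eq_comm
  · rw [Matrix.mul_assoc, Matrix.trace_mul_comm, Matrix.mul_assoc, hHG, Matrix.mul_one, hA1]
  · rw [← hG, coe_exteriorPower_map, extDerivation_map (A := Matrix.toLin' A), hA2, map_zero]
    rw [← Matrix.toLin'_mul, ← Matrix.toLin'_mul, hGA]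
  · calc A = H * G * A * (H * G) := by rw [hHG, Matrix.one_mul, Matrix.mul_one]
      _ = H * (G * A * H) * G := by simp only [Matrix.mul_assoc]
      _ = 0 := by rw [h, Matrix.mul_zero, Matrix.zero_mul]
  · ext B
    constructor
    · rintro ⟨_, ⟨c, g, hg, rfl⟩, rfl⟩
      obtain ⟨k, hk, h1, h2⟩ := conj_mem hGH hG hg
      refine ⟨c, k, hk, ?_⟩
      rw [h1, h2, Matrix.mul_smul, Matrix.smul_mul]
      congr 1
      calc _ = G * g * (H * G) * A * (H * G) * ((g⁻¹ : Matrix.SpecialLinearGroup (Fin 7) ℂ) :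
              Matrix (Fin 7) (Fin 7) ℂ) * H := by
            rw [hHG]; simp only [Matrix.mul_assoc, Matrix.mul_one]
        _ = _ := by simp only [Matrix.mul_assoc]
    · rintro ⟨c, k, hk, rfl⟩
      obtain ⟨g, hg, h1, h2⟩ := conj_mem hHG hH hk
      refine ⟨_, ⟨c, g, hg, rfl⟩, ?_⟩
      rw [h1, h2, Matrix.mul_smul, Matrix.smul_mul]
      congr 1
      calc _ = (G * H) * (k : Matrix (Fin 7) (Fin 7) ℂ) * G * A * H *
              ((k⁻¹ : Matrix.SpecialLinearGroup (Fin 7) ℂ) : Matrix (Fin 7) (Fin 7) ℂ) *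
              (G * H) := by
            rw [hGH]; simp only [Matrix.mul_assoc, Matrix.mul_one, Matrix.one_mul]
        _ = _ := by simp only [Matrix.mul_assoc]

end Transport

/-! ### Elements of the stabilizer of `ω₁` -/

section Stabilizer

/-- The exterior algebra of `V` is the sum of its graded pieces of degrees `0, …, 7`. -/
instance finite_exteriorAlgebra : Module.Finite ℂ (ExteriorAlgebra ℂ V7) := by
  have h := (DirectSum.Decomposition.isInternal fun i : ℕ => ⋀[ℂ]^i V7).submodule_iSup_eq_top
  have h1 : (⨆ i ∈ Finset.range 8, ⋀[ℂ]^i V7) = ⊤ := by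
    rw [← h]
    refine le_antisymm (iSup₂_le fun i _ => le_iSup (fun i => ⋀[ℂ]^i V7) i) (iSup_le fun i => ?_)
    by_cases hi : i < 8
    · exact le_iSup₂_of_le i (Finset.mem_range.mpr hi) le_rfl
    · have h2 : Module.finrank ℂ (⋀[ℂ]^i V7) = 0 := by
        rw [exteriorPower.finrank_eq, Module.finrank_fin_fun]
        exact Nat.choose_eq_zero_of_lt (by omega)
      rw [Submodule.finrank_eq_zero.mp h2]
      exact bot_le
  rw [Module.finite_def, ← h1]
  exact Submodule.fg_biSup _ _ fun i _ => Module.Finite.iff_fg.mp inferInstance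

theorem extDerivation_pow_mul_eq_zero (A : V7 →ₗ[ℂ] V7) {n : ℕ} {x y : ExteriorAlgebra ℂ V7} :
    ∀ a b : ℕ, a + b = n + 1 → (extDerivation A ^ a) x = 0 → (extDerivation A ^ b) y = 0 →
      (extDerivation A ^ n) (x * y) = 0 := by
  induction n generalizing x y with
  | zero =>
    intro a b hab ha hb
    rcases Nat.eq_zero_or_pos a with rfl | h
    · rw [show x = 0 from ha, zero_mul, map_zero]
    · obtain rfl : b = 0 := by omega
      rw [show y = 0 from hb, mul_zero, map_zero]
  | succ n ih =>
    intro a b hab ha hb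
    rw [pow_succ, Module.End.mul_apply, extDerivation_mul, map_add]
    rcases a with _ | a
    · rw [show x = 0 from ha]
      simp
    rcases b with _ | b
    · rw [show y = 0 from hb]
      simp
    rw [ih a (b + 1) (by omega) (by rwa [pow_succ] at ha) hb,
      ih (a + 1) b (by omega) ha (by rwa [pow_succ] at hb), add_zero]

/-- The derivation defined by a nilpotent endomorphism is nilpotent. -/
theorem isNilpotent_extDerivation {A : V7 →ₗ[ℂ] V7} (hA : IsNilpotent A) :
    IsNilpotent (extDerivation A : Module.End ℂ (ExteriorAlgebra ℂ V7)) := by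
  obtain ⟨m, hm⟩ := hA
  rw [Module.End.isNilpotent_iff_of_finite]
  intro x
  induction x using ExteriorAlgebra.induction with
  | algebraMap r => exact ⟨1, by rw [pow_one, extDerivation_algebraMap]⟩
  | ι v =>
    have h (n : ℕ) : (extDerivation A ^ n) (ExteriorAlgebra.ι ℂ v) =
        ExteriorAlgebra.ι ℂ ((A ^ n) v) := by
      induction n with
      | zero => rfl
      | succ n ih => rw [pow_succ', pow_succ', Module.End.mul_apply, ih, extDerivation_ι]; rfl
    exact ⟨m, by rw [h, hm, LinearMap.zero_apply, map_zero]⟩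
  | mul x y hx hy =>
    obtain ⟨a, ha⟩ := hx
    obtain ⟨b, hb⟩ := hy
    refine ⟨a + b, ?_⟩
    refine extDerivation_pow_mul_eq_zero A a (b + 1) rfl ha ?_
    rw [pow_succ', Module.End.mul_apply, hb, map_zero]
  | add x y hx hy =>
    obtain ⟨a, ha⟩ := hx
    obtain ⟨b, hb⟩ := hy
    have hx : (extDerivation A ^ (b + a)) x = 0 := by
      rw [pow_add, Module.End.mul_apply, ha, map_zero]
    have hy : (extDerivation A ^ (a + b)) y = 0 := by
      rw [pow_add, Module.End.mul_apply, hb, map_zero]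
    exact ⟨a + b, by rw [map_add, hy, add_zero, add_comm, hx]⟩

/-- If `N³ = 0` and `N` acts on `ω` by zero, then `exp N` fixes `ω`: the exponential of the
nilpotent derivation defined by `N` is the algebra endomorphism defined by `exp N`. -/
theorem exp_fixes {ω : FourForm} {N : Matrix (Fin 7) (Fin 7) ℂ} (hN : N * N * N = 0)
    (h : extDerivation (Matrix.toLin' N) (ω : ExteriorAlgebra ℂ V7) = 0) :
    exteriorPower.map 4 (Matrix.toLin' (1 + N + (1 / 2 : ℂ) • (N * N))) ω = ω := by
  have hN3 : Matrix.toLin' N ^ 3 = 0 := by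
    rw [← Matrix.toLin'_pow, pow_succ, pow_two, hN, map_zero]
  set D : Module.End ℂ (ExteriorAlgebra ℂ V7) := extDerivation (Matrix.toLin' N) with hD
  have hnil : IsNilpotent D := isNilpotent_extDerivation ⟨3, hN3⟩
  have hexp {k : ℕ} {x : ExteriorAlgebra ℂ V7} (hx : (D ^ k) x = 0) :
      IsNilpotent.exp D x = ∑ i ∈ Finset.range k, (i.factorial : ℚ)⁻¹ • (D ^ i) x := by
    obtain ⟨n, hn⟩ := hnil
    have hn' : D ^ (n + k) = 0 := by rw [pow_add, hn, zero_mul]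
    rw [IsNilpotent.exp_eq_sum hn', LinearMap.sum_apply, add_comm n, Finset.sum_range_add]
    refine add_eq_left.mpr (Finset.sum_eq_zero fun i _ => ?_)
    rw [LinearMap.smul_apply, add_comm k, pow_add, Module.End.mul_apply, hx, map_zero, smul_zero]
  have hmap (x : ExteriorAlgebra ℂ V7) : IsNilpotent.exp D x =
      ExteriorAlgebra.map (Matrix.toLin' (1 + N + (1 / 2 : ℂ) • (N * N))) x := by
    induction x using ExteriorAlgebra.induction with
    | algebraMap r =>
      rw [hexp (k := 1) (by rw [pow_one, hD, extDerivation_algebraMap]), AlgHom.commutes]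
      simp
    | ι v =>
      have h2 : D (ExteriorAlgebra.ι ℂ v) = ExteriorAlgebra.ι ℂ (N.mulVec v) := by
        rw [hD, extDerivation_ι, Matrix.toLin'_apply]
      have h3 : D (ExteriorAlgebra.ι ℂ (N.mulVec v)) = ExteriorAlgebra.ι ℂ ((N * N).mulVec v) := by
        rw [hD, extDerivation_ι, Matrix.toLin'_apply, Matrix.mulVec_mulVec]
      have h4 : D (ExteriorAlgebra.ι ℂ ((N * N).mulVec v)) = 0 := by
        rw [hD, extDerivation_ι, Matrix.toLin'_apply, Matrix.mulVec_mulVec, ← Matrix.mul_assoc, hN,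
          Matrix.zero_mulVec, map_zero]
      have h5 : (D ^ 2) (ExteriorAlgebra.ι ℂ v) = ExteriorAlgebra.ι ℂ ((N * N).mulVec v) := by
        rw [pow_two, Module.End.mul_apply, h2, h3]
      rw [hexp (k := 3) (by rw [pow_succ', Module.End.mul_apply, h5, h4]), Finset.sum_range_succ,
        Finset.sum_range_succ, Finset.sum_range_one, h5, pow_one, h2, ExteriorAlgebra.map_apply_ι,
        Matrix.toLin'_apply, Matrix.add_mulVec, Matrix.add_mulVec, Matrix.one_mulVec,
        Matrix.smul_mulVec, map_add, map_add, map_smul]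
      norm_num
      rw [← Rat.cast_smul_eq_qsmul ℂ]
      norm_num
    | mul x y hx hy =>
      rw [Module.End.exp_mul_of_derivation ℂ _ D
        (fun x y => by rw [hD, extDerivation_mul, add_comm]) hnil, hx, hy, map_mul]
    | add x y hx hy => rw [map_add, map_add, hx, hy]
  refine Subtype.ext ?_
  rw [coe_exteriorPower_map, ← hmap, hexp (k := 1) (by rw [pow_one, hD, h])]
  simp

theorem det_invariantForm_ne_zero : invariantForm.det ≠ 0 := by
  intro h
  have h1 := congrArg Matrix.det invariantForm_mul_inv
  rw [Matrix.det_mul, h, zero_mul, Matrix.det_one] at h1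
  exact zero_ne_one h1

/-- The subgroup of the stabilizer of `ω₁` that preserves `invariantForm`. -/
def isometries : Set (Matrix (Fin 7) (Fin 7) ℂ) :=
  {g | exteriorPower.map 4 (Matrix.toLin' g) (omegaForm 1) = omegaForm 1 ∧
    g.transpose * invariantForm * g = invariantForm ∧ g.det = 1}

theorem mul_mem_isometries {g h : Matrix (Fin 7) (Fin 7) ℂ} (hg : g ∈ isometries)
    (hh : h ∈ isometries) : g * h ∈ isometries := by
  obtain ⟨g1, g2, g3⟩ := hg
  obtain ⟨h1, h2, h3⟩ := hh
  refine ⟨?_, ?_, ?_⟩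
  · rw [Matrix.toLin'_mul, ← map_map_four, h1, g1]
  · calc _ = h.transpose * (g.transpose * invariantForm * g) * h := by
          simp only [Matrix.transpose_mul, Matrix.mul_assoc]
      _ = invariantForm := by rw [g2, h2]
  · rw [Matrix.det_mul, g3, h3, mul_one]

theorem conj_mul_invariantForm (g : Matrix.SpecialLinearGroup (Fin 7) ℂ)
    (hg : (g : Matrix (Fin 7) (Fin 7) ℂ) ∈ isometries) (P : Matrix (Fin 7) (Fin 7) ℂ) :
    (g : Matrix (Fin 7) (Fin 7) ℂ) * (P * invariantForm) *
        ((g⁻¹ : Matrix.SpecialLinearGroup (Fin 7) ℂ) : Matrix (Fin 7) (Fin 7) ℂ) =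
      g * P * (g : Matrix (Fin 7) (Fin 7) ℂ).transpose * invariantForm := by
  have h : (g : Matrix (Fin 7) (Fin 7) ℂ) *
      ((g⁻¹ : Matrix.SpecialLinearGroup (Fin 7) ℂ) : Matrix (Fin 7) (Fin 7) ℂ) = 1 := by
    rw [← Matrix.SpecialLinearGroup.coe_mul, mul_inv_cancel, Matrix.SpecialLinearGroup.coe_one]
  conv_lhs => rw [← hg.2.1]
  calc _ = (g : Matrix (Fin 7) (Fin 7) ℂ) * P * (g : Matrix (Fin 7) (Fin 7) ℂ).transpose *
        invariantForm * ((g : Matrix (Fin 7) (Fin 7) ℂ) *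
          ((g⁻¹ : Matrix.SpecialLinearGroup (Fin 7) ℂ) : Matrix (Fin 7) (Fin 7) ℂ)) := by
        simp only [Matrix.mul_assoc]
    _ = _ := by rw [h, Matrix.mul_one]

theorem exp_transpose_mul_mul_exp {N S : Matrix (Fin 7) (Fin 7) ℂ} (hN : N * N * N = 0)
    (h : N.transpose * S = -(S * N)) (c : ℂ) :
    (1 + c • N + (1 / 2 : ℂ) • (c • N * c • N)).transpose * S *
      (1 + c • N + (1 / 2 : ℂ) • (c • N * c • N)) = S := by
  have h1 : (1 + c • N + (1 / 2 : ℂ) • (c • N * c • N)).transpose * S =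
      S * (1 - c • N + (1 / 2 : ℂ) • (c • N * c • N)) := by
    simp only [Matrix.transpose_add, Matrix.transpose_one, Matrix.transpose_smul,
      Matrix.transpose_mul, Matrix.add_mul, Matrix.mul_add, Matrix.mul_sub, Matrix.smul_mul,
      Matrix.mul_smul, Matrix.mul_assoc, h, Matrix.one_mul, Matrix.mul_one, Matrix.mul_neg]
    rw [← Matrix.mul_assoc N.transpose, h, Matrix.neg_mul, neg_neg, Matrix.mul_assoc, smul_neg,
      sub_eq_add_neg]
  rw [h1, Matrix.mul_assoc]
  convert Matrix.mul_one S
  simp only [Matrix.add_mul, Matrix.mul_add, Matrix.sub_mul, Matrix.smul_mul, Matrix.mul_smul,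
    Matrix.one_mul, Matrix.mul_one, ← Matrix.mul_assoc, hN, smul_zero, add_zero, sub_zero]
  module

/-- The exponential of an element of `𝔤₂` with `N³ = 0` lies in the stabilizer. Its determinant is
`1` because it is the square of the isometry `exp (N / 2)`. -/
theorem exp_mem_isometries {Q : Matrix (Fin 7) (Fin 7) ℂ} (hs : ∀ i j, Q j i = -Q i j)
    (hQ : IsotropyEquations 1 Q)
    (hN : Q * invariantForm * (Q * invariantForm) * (Q * invariantForm) = 0) :
    1 + Q * invariantForm + (1 / 2 : ℂ) • (Q * invariantForm * (Q * invariantForm)) ∈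
      isometries := by
  have h : (Q * invariantForm).transpose * invariantForm =
      -(invariantForm * (Q * invariantForm)) := by
    rw [Matrix.transpose_mul, transpose_invariantForm, show Q.transpose = -Q from Matrix.ext hs,
      Matrix.mul_neg, Matrix.neg_mul, Matrix.mul_assoc]
  have h1 := exp_transpose_mul_mul_exp hN h
  refine ⟨exp_fixes hN ((extDerivation_mul_invariantForm_eq_zero_iff Q).mpr ⟨hs, hQ⟩), ?_, ?_⟩
  · simpa only [one_smul] using h1 1
  · set N := Q * invariantForm
    set E := 1 + (1 / 2 : ℂ) • N + (1 / 2 : ℂ) • ((1 / 2 : ℂ) • N * (1 / 2 : ℂ) • N)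
    have h2 : 1 + N + (1 / 2 : ℂ) • (N * N) = E * E := by
      simp only [E, Matrix.add_mul, Matrix.mul_add, Matrix.smul_mul, Matrix.mul_smul,
        Matrix.one_mul, Matrix.mul_one, ← Matrix.mul_assoc, hN, smul_zero, add_zero]
      module
    have h3 := congrArg Matrix.det (h1 (1 / 2))
    rw [Matrix.det_mul, Matrix.det_mul, Matrix.det_transpose] at h3
    rw [h2, Matrix.det_mul]
    exact mul_right_cancel₀ det_invariantForm_ne_zero (by linear_combination h3)

theorem decomposableForm_swap_zero_one (i j k l : Fin 7) :
    decomposableForm j i k l = -decomposableForm i j k l := by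
  rw [decomposableForm, decomposableForm,
    ← AlternatingMap.map_swap _ _ (i := 0) (j := 1) (by decide)]
  refine congrArg _ (funext fun a => ?_)
  fin_cases a <;> rfl

theorem decomposableForm_swap_one_two (i j k l : Fin 7) :
    decomposableForm i k j l = -decomposableForm i j k l := by
  rw [decomposableForm, decomposableForm,
    ← AlternatingMap.map_swap _ _ (i := 1) (j := 2) (by decide)]
  refine congrArg _ (funext fun a => ?_)
  fin_cases a <;> rfl

theorem decomposableForm_swap_two_three (i j k l : Fin 7) :
    decomposableForm i j l k = -decomposableForm i j k l := by
  rw [decomposableForm, decomposableForm,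
    ← AlternatingMap.map_swap _ _ (i := 2) (j := 3) (by decide)]
  refine congrArg _ (funext fun a => ?_)
  fin_cases a <;> rfl

/-- The image of a basis four-form under a signed permutation of the basis. -/
theorem map_decomposableForm {g : V7 →ₗ[ℂ] V7} {σ : Fin 7 → Fin 7} {ε : Fin 7 → ℂ}
    (h : ∀ i, g (Pi.single i 1) = ε i • Pi.single (σ i) 1) (i j k l : Fin 7) :
    exteriorPower.map 4 g (decomposableForm i j k l) =
      (ε i * ε j * ε k * ε l) • decomposableForm (σ i) (σ j) (σ k) (σ l) := by
  rw [decomposableForm, exteriorPower.map_apply_ιMulti]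
  have h1 := (exteriorPower.ιMulti ℂ 4 (M := V7)).map_smul_univ ![ε i, ε j, ε k, ε l]
    ![Pi.single (σ i) (1 : ℂ), Pi.single (σ j) (1 : ℂ), Pi.single (σ k) (1 : ℂ),
      Pi.single (σ l) (1 : ℂ)]
  rw [Fin.prod_univ_four] at h1
  refine Eq.trans (congrArg _ (funext fun a => ?_)) h1
  fin_cases a <;> exact h _

/-- The cyclic permutation `x₁ ↦ x₂ ↦ x₃ ↦ x₁`, `x₄ ↦ x₅ ↦ x₆ ↦ x₄`. -/
def cyclicMatrix : Matrix (Fin 7) (Fin 7) ℂ :=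
  !![0, 0, 1, 0, 0, 0, 0; 1, 0, 0, 0, 0, 0, 0; 0, 1, 0, 0, 0, 0, 0; 0, 0, 0, 0, 0, 1, 0;
    0, 0, 0, 1, 0, 0, 0; 0, 0, 0, 0, 1, 0, 0; 0, 0, 0, 0, 0, 0, 1]

/-- The signed permutation `x₁ ↦ x₂ ↦ -x₁`, `x₄ ↦ x₅ ↦ -x₄`. -/
def exchangeMatrix : Matrix (Fin 7) (Fin 7) ℂ :=
  !![0, -1, 0, 0, 0, 0, 0; 1, 0, 0, 0, 0, 0, 0; 0, 0, 1, 0, 0, 0, 0; 0, 0, 0, 0, -1, 0, 0;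
    0, 0, 0, 1, 0, 0, 0; 0, 0, 0, 0, 0, 1, 0; 0, 0, 0, 0, 0, 0, 1]

theorem cyclicMatrix_pow_three : cyclicMatrix * cyclicMatrix * cyclicMatrix = 1 := by
  ext i j
  fin_cases i <;> fin_cases j <;>
  simp [Matrix.mul_apply, Fin.sum_univ_seven, cyclicMatrix]

theorem exchangeMatrix_pow_four :
    exchangeMatrix * (exchangeMatrix * exchangeMatrix * exchangeMatrix) = 1 := by
  ext i j
  fin_cases i <;> fin_cases j <;>
  simp [Matrix.mul_apply, Fin.sum_univ_seven, exchangeMatrix]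

theorem cyclicMatrix_mem_isometries : cyclicMatrix ∈ isometries := by
  have h (i : Fin 7) : Matrix.toLin' cyclicMatrix (Pi.single i 1) =
      (1 : ℂ) • Pi.single (![1, 2, 0, 4, 5, 3, 6] i) 1 := by
    rw [Matrix.toLin'_apply, Matrix.mulVec_single_one]
    ext j
    fin_cases i <;> fin_cases j <;> simp [cyclicMatrix]
  have hS : cyclicMatrix.transpose * invariantForm * cyclicMatrix = invariantForm := by
    ext i j
    fin_cases i <;> fin_cases j <;>
    simp [Matrix.mul_apply, Fin.sum_univ_seven, cyclicMatrix, invariantForm]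
  refine ⟨?_, hS, ?_⟩
  · simp only [omegaForm, map_add, one_smul, map_decomposableForm (ε := fun _ => 1) h,
      Matrix.cons_val, mul_one]
    rw [decomposableForm_swap_one_two 1 0 2 6, decomposableForm_swap_zero_one 0 1 2 6,
      decomposableForm_swap_one_two 4 3 5 6, decomposableForm_swap_zero_one 3 4 5 6,
      decomposableForm_swap_zero_one 0 2 5 3, decomposableForm_swap_two_three 0 2 3 5,
      decomposableForm_swap_zero_one 0 1 4 3, decomposableForm_swap_two_three 0 1 3 4]
    simp only [neg_neg]
    abel
  · have h1 := congrArg Matrix.det cyclicMatrix_pow_three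
    have h2 := congrArg Matrix.det hS
    rw [Matrix.det_mul, Matrix.det_mul, Matrix.det_one] at h1
    rw [Matrix.det_mul, Matrix.det_mul, Matrix.det_transpose] at h2
    have h3 : cyclicMatrix.det * cyclicMatrix.det = 1 :=
      mul_right_cancel₀ det_invariantForm_ne_zero (by linear_combination h2)
    rwa [h3, one_mul] at h1

theorem exchangeMatrix_mem_isometries : exchangeMatrix ∈ isometries := by
  have h (i : Fin 7) : Matrix.toLin' exchangeMatrix (Pi.single i 1) =
      (![1, -1, 1, 1, -1, 1, 1] i : ℂ) • Pi.single (![1, 0, 2, 4, 3, 5, 6] i) 1 := by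
    rw [Matrix.toLin'_apply, Matrix.mulVec_single_one]
    ext j
    fin_cases i <;> fin_cases j <;> simp [exchangeMatrix]
  refine ⟨?_, ?_, ?_⟩
  · simp only [omegaForm, map_add, one_smul, map_decomposableForm h,
      Matrix.cons_val, mul_one]
    rw [decomposableForm_swap_zero_one 0 1 2 6, decomposableForm_swap_zero_one 3 4 5 6,
      decomposableForm_swap_zero_one 0 1 4 3, decomposableForm_swap_two_three 0 1 3 4]
    module
  · ext i j
    fin_cases i <;> fin_cases j <;>
    simp [Matrix.mul_apply, Fin.sum_univ_seven, exchangeMatrix, invariantForm]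
  · have h1 : exchangeMatrix = (Matrix.diagonal ![1, -1, 1, 1, -1, 1, 1]).submatrix
        (Equiv.swap 0 1 * Equiv.swap 3 4 : Equiv.Perm (Fin 7)) id := by
      ext i j
      fin_cases i <;> fin_cases j <;> rfl
    rw [h1, Matrix.det_permute, Matrix.det_diagonal, Equiv.Perm.sign_mul,
      Equiv.Perm.sign_swap (by decide), Equiv.Perm.sign_swap (by decide), Fin.prod_univ_seven]
    simp

end Stabilizer

/-! ### The adjoint variety -/

section AdjointVariety

/-- The base point `x₁ ∧ x₅`, whose image in `𝔤₂` is a long root vector. -/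
def baseBivector : Matrix (Fin 7) (Fin 7) ℂ :=
  Matrix.vecMulVec (Pi.single 0 1) (Pi.single 4 1) -
    Matrix.vecMulVec (Pi.single 4 1) (Pi.single 0 1)

theorem isotropicMatrix_baseBivector : IsotropicMatrix (omegaForm 1) baseBivector := by
  have h (i j : Fin 7) : baseBivector i j = (Pi.single 0 1 : V7) i * (Pi.single 4 1 : V7) j -
      (Pi.single 4 1 : V7) i * (Pi.single 0 1 : V7) j := rfl
  refine (isotropicMatrix_omegaForm_iff 1 _).mpr ⟨fun i j => ?_, ?_, fun i j k l => ?_⟩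
  · rw [h, h]
    ring
  · simp [IsotropyEquations, h]
  · simp only [h]
    ring

theorem IsotropicMatrix.smul {ω : FourForm} {P : Matrix (Fin 7) (Fin 7) ℂ}
    (h : IsotropicMatrix ω P) (c : ℂ) : IsotropicMatrix ω (c • P) := by
  obtain ⟨v, w, h, rfl⟩ := h
  refine ⟨c • v, w, ?_, ?_⟩
  · rw [map_smul, smul_mul_assoc, smul_mul_assoc, h, smul_zero]
  · rw [smul_sub, Matrix.smul_vecMulVec, Matrix.vecMulVec_smul]

/-- The bivectors whose matrix is a multiple of a translate of the base point by an isometry. -/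
def IsReachable (P : Matrix (Fin 7) (Fin 7) ℂ) : Prop :=
  ∃ c : ℂ, ∃ g ∈ isometries, P = c • (g * baseBivector * g.transpose)

theorem IsReachable.of_mul {P g h : Matrix (Fin 7) (Fin 7) ℂ} (hgh : g * h = 1)
    (hg : g ∈ isometries) (hP : IsReachable (h * P * h.transpose)) : IsReachable P := by
  obtain ⟨c, k, hk, hP⟩ := hP
  refine ⟨c, g * k, mul_mem_isometries hg hk, ?_⟩
  rw [← mul_cancel_transpose (P := P) hgh, hP, Matrix.mul_smul, Matrix.smul_mul,
    Matrix.transpose_mul]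
  simp only [Matrix.mul_assoc]

/-- A generic element of the nilradical of the parabolic subalgebra opposite to the stabilizer of
the base point. -/
def nilradicalBivector (a b c d e : ℂ) : Matrix (Fin 7) (Fin 7) ℂ :=
  !![0, 0, 0, 0, 0, 0, 0; 0, 0, d, a, 0, -e, -c; 0, -d, 0, b, 0, 0, 0; 0, -a, -b, 0, 0, -c, -d;
    0, 0, 0, 0, 0, 0, 0; 0, e, 0, c, 0, 0, 0; 0, c, 0, d, 0, 0, 0]

theorem nilradicalBivector_mul_invariantForm (a b c d e : ℂ) :
    nilradicalBivector a b c d e * invariantForm =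
      !![0, 0, 0, 0, 0, 0, 0; a, 0, -e, 0, 0, d, -2 * c; b, 0, 0, 0, -d, 0, 0;
        0, 0, -c, 0, -a, -b, -2 * d; 0, 0, 0, 0, 0, 0, 0; c, 0, 0, 0, e, 0, 0;
        d, 0, 0, 0, c, 0, 0] := by
  ext i j
  rw [mul_invariantForm_apply]
  fin_cases i <;> fin_cases j <;> simp [nilradicalBivector, mul_comm]

theorem nilradicalBivector_sq (a b c d e : ℂ) :
    nilradicalBivector a b c d e * invariantForm * (nilradicalBivector a b c d e * invariantForm) =
      !![0, 0, 0, 0, 0, 0, 0; -(b * e) - c * d, 0, 0, 0, 2 * d * e - 2 * c ^ 2, 0, 0;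
        0, 0, 0, 0, 0, 0, 0; -2 * b * c - 2 * d ^ 2, 0, 0, 0, -(c * d) - b * e, 0, 0;
        0, 0, 0, 0, 0, 0, 0; 0, 0, 0, 0, 0, 0, 0; 0, 0, 0, 0, 0, 0, 0] := by
  rw [nilradicalBivector_mul_invariantForm]
  ext i j
  rw [Matrix.mul_apply, Fin.sum_univ_seven]
  fin_cases i <;> fin_cases j <;> simp <;> ring

theorem nilradicalBivector_cube (a b c d e : ℂ) :
    nilradicalBivector a b c d e * invariantForm * (nilradicalBivector a b c d e * invariantForm) *
      (nilradicalBivector a b c d e * invariantForm) = 0 := by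
  rw [nilradicalBivector_sq, nilradicalBivector_mul_invariantForm]
  ext i j
  rw [Matrix.mul_apply, Fin.sum_univ_seven]
  fin_cases i <;> fin_cases j <;> simp

/-- The open cell: a point of the variety at which the coordinate `p₁₅` does not vanish is the
translate of the base point by the exponential of an element of the nilradical. -/
theorem isReachable_of_ne_zero {P : Matrix (Fin 7) (Fin 7) ℂ}
    (hP : IsotropicMatrix (omegaForm 1) P) (h0 : P 0 4 ≠ 0) : IsReachable P := by
  wlog h1 : P 0 4 = 1 generalizing P
  · have h2 : ((P 0 4)⁻¹ • P) 0 4 = 1 := by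
      rw [Matrix.smul_apply, smul_eq_mul, inv_mul_cancel₀ h0]
    obtain ⟨c, g, hg, h3⟩ := this (hP.smul _) (by rw [h2]; exact one_ne_zero) h2
    refine ⟨P 0 4 * c, g, hg, ?_⟩
    rw [mul_smul, ← h3, smul_smul, mul_inv_cancel₀ h0, one_smul]
  obtain ⟨hs, ⟨m0, m1, m2, m3, m4, m5, m6⟩, hp⟩ := (isotropicMatrix_omegaForm_iff 1 P).mp hP
  have hdiag (i : Fin 7) : P i i = 0 := by
    have := hs i i
    rwa [eq_neg_iff_add_eq_zero, ← two_mul, mul_eq_zero, or_iff_right two_ne_zero] at this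
  have hp' (k l : Fin 7) : P k l = P k 4 * P 0 l - P l 4 * P 0 k := by
    linear_combination hp 0 4 k l - P k l * h1 + P 0 k * hs l 4 - P 0 l * hs k 4
  -- The entries of `P` in the rows `0` and `4` are read off from `exp N` applied to the base point.
  set N := nilradicalBivector (P 1 4 + (P 2 4 * P 0 5 + P 0 6 * P 6 4) / 2) (P 2 4) (P 0 6) (P 6 4)
    (P 0 5) * invariantForm with hN
  have hg : 1 + N + (1 / 2 : ℂ) • (N * N) ∈ isometries := by
    refine exp_mem_isometries (fun i j => ?_) ?_ (nilradicalBivector_cube _ _ _ _ _)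
    · fin_cases i <;> fin_cases j <;> simp [nilradicalBivector]
    · simp [IsotropyEquations, nilradicalBivector]
  have e54 : P 5 4 = P 0 6 := by linear_combination hs 4 5 - m3
  have e02 : P 0 2 = -P 6 4 := by linear_combination m1 + hs 6 4
  have hv : (1 + N + (1 / 2 : ℂ) • (N * N)).mulVec (Pi.single 0 1) = fun k => P k 4 := by
    rw [hN, nilradicalBivector_sq, nilradicalBivector_mul_invariantForm, Matrix.mulVec_single_one]
    ext k
    fin_cases k <;> simp [h1, hdiag, e54]
    · ring
    · linear_combination -m5 + hp' 2 6 - P 6 4 * e02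
  have hw : (1 + N + (1 / 2 : ℂ) • (N * N)).mulVec (Pi.single 4 1) = fun k => P 0 k := by
    rw [hN, nilradicalBivector_sq, nilradicalBivector_mul_invariantForm, Matrix.mulVec_single_one]
    ext k
    fin_cases k <;> simp [h1, hdiag, e02]
    · linear_combination -m2 + hp' 5 6 + P 0 6 * e54
    · linear_combination -m6 + hp' 2 5 - P 5 4 * e02 + P 6 4 * e54
  refine ⟨1, _, hg, ?_⟩
  rw [one_smul, baseBivector, Matrix.mul_sub, Matrix.sub_mul, Matrix.mul_vecMulVec,
    Matrix.mul_vecMulVec, Matrix.vecMulVec_mul, Matrix.vecMulVec_mul, Matrix.vecMul_transpose,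
    Matrix.vecMul_transpose, hv, hw]
  ext k l
  rw [hp', Matrix.sub_apply, Matrix.vecMulVec_apply, Matrix.vecMulVec_apply]
  ring

/-- A point of the isotropic cone at which the six long root coordinates vanish is zero: the Plücker
relations then make the square of each remaining coordinate vanish. -/
theorem eq_zero_of_long_coordinates {P : Matrix (Fin 7) (Fin 7) ℂ}
    (hP : IsotropicMatrix (omegaForm 1) P) (p04 : P 0 4 = 0) (p05 : P 0 5 = 0) (p13 : P 1 3 = 0)
    (p15 : P 1 5 = 0) (p23 : P 2 3 = 0) (p24 : P 2 4 = 0) : P = 0 := by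
  obtain ⟨hs, hm, hp⟩ := (isotropicMatrix_omegaForm_iff 1 P).mp hP
  obtain ⟨m0, m1, m2, m3, m4, m5, m6⟩ := id hm
  have h2 {x : ℂ} (h : x * x = 0) : x = 0 := mul_self_eq_zero.mp h
  have p40 : P 4 0 = 0 := by rw [hs, p04, neg_zero]
  have p42 : P 4 2 = 0 := by rw [hs, p24, neg_zero]
  have p31 : P 3 1 = 0 := by rw [hs, p13, neg_zero]
  have p32 : P 3 2 = 0 := by rw [hs, p23, neg_zero]
  have p50 : P 5 0 = 0 := by rw [hs, p05, neg_zero]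
  have p51 : P 5 1 = 0 := by rw [hs, p15, neg_zero]
  have p06 : P 0 6 = 0 := h2 (by
    linear_combination -hp 0 6 4 5 + P 0 6 * m3 - P 6 5 * p04 + P 6 4 * p05)
  have p16 : P 1 6 = 0 := h2 (by
    linear_combination hp 1 6 3 5 - P 1 6 * m4 + P 6 5 * p13 - P 6 3 * p15)
  have p46 : P 4 6 = 0 := h2 (by
    linear_combination hp 4 6 0 2 - P 4 6 * m1 + P 6 2 * p40 - P 6 0 * p42)
  have p36 : P 3 6 = 0 := h2 (by
    linear_combination -hp 3 6 1 2 + P 3 6 * m0 - P 6 2 * p31 + P 6 1 * p32)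
  have p56 : P 5 6 = 0 := h2 (by
    linear_combination -hp 5 6 0 1 + P 5 6 * m2 - P 6 1 * p50 + P 6 0 * p51)
  have p26 : P 2 6 = 0 := h2 (by
    linear_combination -hp 2 6 3 4 + P 2 6 * m5 - P 6 4 * p23 + P 6 3 * p24)
  have h3 : P 1 4 * P 2 5 = 0 := by
    linear_combination hp 1 4 2 5 + P 4 5 * (m0 - p36) - P 4 2 * p15
  have p14 : P 1 4 = 0 := h2 (by
    linear_combination -hp 0 3 1 4 + P 1 4 * m6 - h3 - P 3 4 * (m2 - p56) + P 3 1 * p04)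
  have p25 : P 2 5 = 0 := h2 (by
    linear_combination -hp 0 3 2 5 + P 2 5 * m6 - h3 - P 3 5 * (m1 + p46) + P 3 2 * p05)
  exact eq_zero_of_isotropyEquations hs hm p04 p14 p13 p24 p23 p06 p16 p46 p36 p05 p15 p56 p25 p26

/-- The isotropic bivectors form a single cone orbit: the Weyl group elements `cyclicMatrix` and
`exchangeMatrix` permute the six long root coordinates transitively, up to sign, so that one that
does not vanish can be moved to the coordinate of the base point. -/
theorem IsotropicMatrix.isReachable {P : Matrix (Fin 7) (Fin 7) ℂ}
    (hP : IsotropicMatrix (omegaForm 1) P) : IsReachable P := by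
  have hmap {Q g : Matrix (Fin 7) (Fin 7) ℂ} (hQ : IsotropicMatrix (omegaForm 1) Q)
      (hg : g ∈ isometries) : IsotropicMatrix (omegaForm 1) (g * Q * g.transpose) := by
    have h := hQ.map g
    rwa [hg.1] at h
  have hc := cyclicMatrix_mem_isometries
  have hx := exchangeMatrix_mem_isometries
  have hx3 := mul_mem_isometries (mul_mem_isometries hx hx) hx
  have hx4 : exchangeMatrix * exchangeMatrix * exchangeMatrix * exchangeMatrix = 1 :=
    mul_eq_one_comm.mp exchangeMatrix_pow_four
  have c04 (Q : Matrix (Fin 7) (Fin 7) ℂ) :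
      (cyclicMatrix * Q * cyclicMatrix.transpose) 0 4 = Q 2 3 := by
    simp only [Matrix.mul_apply, Fin.sum_univ_seven, Matrix.transpose_apply]
    simp [cyclicMatrix]
  have c23 (Q : Matrix (Fin 7) (Fin 7) ℂ) :
      (cyclicMatrix * Q * cyclicMatrix.transpose) 2 3 = Q 1 5 := by
    simp only [Matrix.mul_apply, Fin.sum_univ_seven, Matrix.transpose_apply]
    simp [cyclicMatrix]
  have x04 (Q : Matrix (Fin 7) (Fin 7) ℂ) :
      (exchangeMatrix * Q * exchangeMatrix.transpose) 0 4 = -Q 1 3 := by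
    simp only [Matrix.mul_apply, Fin.sum_univ_seven, Matrix.transpose_apply]
    simp [exchangeMatrix]
  have x23 (Q : Matrix (Fin 7) (Fin 7) ℂ) :
      (exchangeMatrix * Q * exchangeMatrix.transpose) 2 3 = -Q 2 4 := by
    simp only [Matrix.mul_apply, Fin.sum_univ_seven, Matrix.transpose_apply]
    simp [exchangeMatrix]
  have x15 (Q : Matrix (Fin 7) (Fin 7) ℂ) :
      (exchangeMatrix * Q * exchangeMatrix.transpose) 1 5 = Q 0 5 := by
    simp only [Matrix.mul_apply, Fin.sum_univ_seven, Matrix.transpose_apply]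
    simp [exchangeMatrix]
  have r23 {Q : Matrix (Fin 7) (Fin 7) ℂ} (hQ : IsotropicMatrix (omegaForm 1) Q)
      (h : Q 2 3 ≠ 0) : IsReachable Q :=
    .of_mul cyclicMatrix_pow_three (mul_mem_isometries hc hc)
      (isReachable_of_ne_zero (hmap hQ hc) (by rwa [c04]))
  have r15 {Q : Matrix (Fin 7) (Fin 7) ℂ} (hQ : IsotropicMatrix (omegaForm 1) Q)
      (h : Q 1 5 ≠ 0) : IsReachable Q :=
    .of_mul cyclicMatrix_pow_three (mul_mem_isometries hc hc) (r23 (hmap hQ hc) (by rwa [c23]))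
  by_contra hr
  have p04 : P 0 4 = 0 := by
    by_contra h
    exact hr (isReachable_of_ne_zero hP h)
  have p23 : P 2 3 = 0 := by
    by_contra h
    exact hr (r23 hP h)
  have p15 : P 1 5 = 0 := by
    by_contra h
    exact hr (r15 hP h)
  have p13 : P 1 3 = 0 := by
    by_contra h
    exact hr (.of_mul hx4 hx3 (isReachable_of_ne_zero (hmap hP hx) (by rwa [x04, neg_ne_zero])))
  have p24 : P 2 4 = 0 := by
    by_contra h
    exact hr (.of_mul hx4 hx3 (r23 (hmap hP hx) (by rwa [x23, neg_ne_zero])))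
  have p05 : P 0 5 = 0 := by
    by_contra h
    exact hr (.of_mul hx4 hx3 (r15 (hmap hP hx) (by rwa [x15])))
  refine hr ⟨0, _, hc, ?_⟩
  rw [zero_smul, eq_zero_of_long_coordinates hP p04 p05 p13 p15 p23 p24]

/-- A skew-symmetric matrix of rank at most two satisfies the Plücker relations. -/
theorem plucker_of_rank_two {Q : Matrix (Fin 7) (Fin 7) ℂ} (hs : ∀ i j, Q j i = -Q i j)
    {u u' z z' : V7} (h : Q = Matrix.vecMulVec u z - Matrix.vecMulVec u' z') (i j k l : Fin 7) :
    Q i j * Q k l - Q i k * Q j l + Q i l * Q j k = 0 := by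
  have h1 (i j k l : Fin 7) :
      Q i j * (Q i j * Q k l - Q i k * Q j l + Q i l * Q j k) = 0 := by
    have h2 : Q i i * (Q j j * Q k l - Q j l * Q k j) - Q i j * (Q j i * Q k l - Q j l * Q k i) +
        Q i l * (Q j i * Q k j - Q j j * Q k i) = 0 := by
      simp only [h, Matrix.sub_apply, Matrix.vecMulVec_apply]
      ring
    have hdiag (i : Fin 7) : Q i i = 0 := by
      have := hs i i
      rwa [eq_neg_iff_add_eq_zero, ← two_mul, mul_eq_zero, or_iff_right two_ne_zero] at this
    rw [hdiag i, hdiag j, hs i j, hs i k, hs j k] at h2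
    linear_combination h2
  refine mul_self_eq_zero.mp ?_
  have h3 := h1 i j k l
  have h4 := h1 i k j l
  have h5 := h1 i l j k
  rw [hs k l, hs j l] at h5
  rw [hs j k] at h4
  linear_combination Q k l * h3 + Q j l * h4 + Q j k * h5

/-- The endomorphisms of `V` defined by the isotropic bivectors of `ω₁` form the cone over the
adjoint variety: they are the multiples of the conjugates of a long root vector, and they are cut
out by the skew-symmetry of `B S⁻¹`, the linear equations and the Plücker relations. -/
theorem isAdjointCone_omegaForm_one : IsAdjointCone (omegaForm 1)
    {B | ∃ P, IsotropicMatrix (omegaForm 1) P ∧ B = P * invariantForm} := by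
  have hmem (B : Matrix (Fin 7) (Fin 7) ℂ) :
      (∃ P, IsotropicMatrix (omegaForm 1) P ∧ B = P * invariantForm) ↔
        IsotropicMatrix (omegaForm 1) (B * invariantFormInv) := by
    constructor
    · rintro ⟨P, hP, rfl⟩
      rwa [mul_invariantForm_mul_inv]
    · exact fun h => ⟨_, h, (mul_inv_mul_invariantForm B).symm⟩
  refine ⟨?_, baseBivector * invariantForm, ⟨?_, ?_⟩, fun h => ?_, ?_⟩
  · let x (i j : Fin 7) : MvPolynomial (Module.Dual ℂ (Matrix (Fin 7) (Fin 7) ℂ)) ℂ :=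
      MvPolynomial.X (Matrix.entryLinearMap ℂ ℂ i j ∘ₗ LinearMap.mulRight ℂ invariantFormInv)
    have hx (B : Matrix (Fin 7) (Fin 7) ℂ) (i j : Fin 7) :
        MvPolynomial.eval (fun l : Module.Dual ℂ (Matrix (Fin 7) (Fin 7) ℂ) => l B) (x i j) =
          (B * invariantFormInv) i j := by
      rw [MvPolynomial.eval_X]
      rfl
    refine ⟨{f | ∃ i j, f = x j i + x i j} ∪
      ({x 1 2 + x 3 6, x 0 2 - x 4 6, x 0 1 + x 5 6, x 4 5 + x 0 6, x 3 5 - x 1 6, x 3 4 + x 2 6,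
        x 0 3 + x 1 4 + x 2 5} ∪
      {f | ∃ i j k l, f = x i j * x k l - x i k * x j l + x i l * x j k}), ?_⟩
    ext B
    rw [Set.mem_ofPred_eq, hmem, isotropicMatrix_omegaForm_iff, Set.mem_ofPred_eq, Set.union_def]
    simp only [Set.mem_ofPred_eq, Set.mem_union, or_imp, forall_and, IsotropyEquations,
      Set.mem_insert_iff, Set.mem_singleton_iff, forall_eq, map_add, map_sub, hx, one_mul]
    refine and_congr ?_ (and_congr Iff.rfl ?_)
    · constructor
      · rintro h _ ⟨i, j, rfl⟩
        rw [map_add, hx, hx, h, neg_add_cancel]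
      · intro h i j
        have h1 := h _ ⟨i, j, rfl⟩
        rw [map_add, hx, hx] at h1
        exact eq_neg_of_add_eq_zero_left h1
    · constructor
      · rintro h _ ⟨i, j, k, l, rfl⟩
        simpa only [map_add, map_sub, map_mul, hx] using h i j k l
      · intro h i j k l
        simpa only [map_add, map_sub, map_mul, hx] using h _ ⟨i, j, k, l, rfl⟩
  · simp [Matrix.trace, Fin.sum_univ_seven, mul_invariantForm_apply, baseBivector,
      Matrix.vecMulVec_apply]
  · obtain ⟨h1, h2, -⟩ := (isotropicMatrix_omegaForm_iff 1 _).mp isotropicMatrix_baseBivector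
    exact (extDerivation_mul_invariantForm_eq_zero_iff _).mpr ⟨h1, h2⟩
  · have h1 := congrFun (congrFun (mul_invariantForm_mul_inv baseBivector) 0) 4
    rw [h] at h1
    simp [baseBivector, Matrix.vecMulVec_apply] at h1
  · ext B
    rw [Set.mem_ofPred_eq, Set.mem_ofPred_eq]
    constructor
    · rintro ⟨P, hP, rfl⟩
      obtain ⟨c, g, hg, rfl⟩ := hP.isReachable
      refine ⟨c, ⟨g, hg.2.2⟩, hg.1, ?_⟩
      rw [conj_mul_invariantForm ⟨g, hg.2.2⟩ hg, Matrix.smul_mul]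
    · rintro ⟨c, g, hg, rfl⟩
      rw [hmem]
      rw [Matrix.smul_mul]
      refine IsotropicMatrix.smul ?_ c
      set A := baseBivector * invariantForm with hA
      set G := (g : Matrix (Fin 7) (Fin 7) ℂ) with hG
      set G' := ((g⁻¹ : Matrix.SpecialLinearGroup (Fin 7) ℂ) : Matrix (Fin 7) (Fin 7) ℂ) with hG'
      have h1 : G' * G = 1 := by
        rw [hG, hG', ← Matrix.SpecialLinearGroup.coe_mul, inv_mul_cancel,
          Matrix.SpecialLinearGroup.coe_one]
      have h2 : extDerivation (Matrix.toLin' (G * A * G' * invariantFormInv * invariantForm))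
          (omegaForm 1 : ExteriorAlgebra ℂ V7) = 0 := by
        have hg' : exteriorPower.map 4 (Matrix.toLin' G) (omegaForm 1) = omegaForm 1 := hg
        have hA0 : extDerivation (Matrix.toLin' A) (omegaForm 1 : ExteriorAlgebra ℂ V7) = 0 := by
          obtain ⟨h1, h2, -⟩ := (isotropicMatrix_omegaForm_iff 1 _).mp isotropicMatrix_baseBivector
          exact (extDerivation_mul_invariantForm_eq_zero_iff _).mpr ⟨h1, h2⟩
        rw [mul_inv_mul_invariantForm]
        conv_lhs => rw [← hg']
        rw [coe_exteriorPower_map, extDerivation_map (A := Matrix.toLin' A), hA0, map_zero]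
        rw [← Matrix.toLin'_mul, ← Matrix.toLin'_mul, Matrix.mul_assoc _ G', h1, Matrix.mul_one]
      -- A conjugate of the base point again has rank two, which gives the Plücker relations.
      obtain ⟨h3, h4⟩ := (extDerivation_mul_invariantForm_eq_zero_iff _).mp h2
      refine (isotropicMatrix_omegaForm_iff 1 _).mpr ⟨h3, h4, plucker_of_rank_two h3
        (u := G.mulVec (Pi.single 0 1)) (u' := G.mulVec (Pi.single 4 1))
        (z := Matrix.vecMul (Pi.single 4 1) (invariantForm * G' * invariantFormInv))
        (z' := Matrix.vecMul (Pi.single 0 1) (invariantForm * G' * invariantFormInv)) ?_⟩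
      rw [← Matrix.mul_vecMulVec, ← Matrix.mul_vecMulVec, ← Matrix.vecMulVec_mul,
        ← Matrix.vecMulVec_mul, hA, baseBivector]
      simp only [Matrix.mul_assoc, Matrix.mul_sub, Matrix.sub_mul]

end AdjointVariety

/-! ### The degeneration -/

/-- The adjoint cone of a nondegenerate form, as the image of the cone of isotropic bivectors. -/
theorem exists_isAdjointCone {ω : FourForm} (h : FourFormEquivalent (omegaForm 1) ω) :
    ∃ S T : Matrix (Fin 7) (Fin 7) ℂ, S * T = 1 ∧
      IsAdjointCone ω {B | ∃ P, IsotropicMatrix ω P ∧ B = P * S} := by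
  obtain ⟨G, H, hGH, hG⟩ := h.exists_matrix
  have hHG : H * G = 1 := mul_eq_one_comm.mp hGH
  have hH := map_eq_of_mul_eq_one hHG hG
  have hGH' : G.transpose * H.transpose = 1 := by
    rw [← Matrix.transpose_mul, hHG, Matrix.transpose_one]
  have hHG' : H.transpose * G.transpose = 1 := by
    rw [← Matrix.transpose_mul, hGH, Matrix.transpose_one]
  refine ⟨H.transpose * invariantForm * H, G * invariantFormInv * G.transpose, ?_, ?_⟩
  · calc _ = H.transpose * (invariantForm * (H * G) * invariantFormInv) * G.transpose := by
          simp only [Matrix.mul_assoc]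
      _ = 1 := by rw [hHG, Matrix.mul_one, invariantForm_mul_inv, Matrix.mul_one, hHG']
  · convert isAdjointCone_omegaForm_one.conj hGH hG using 1
    ext B
    constructor
    · rintro ⟨P, hP, rfl⟩
      have h1 := hP.map H
      rw [hH] at h1
      refine ⟨_, ⟨_, h1, rfl⟩, ?_⟩
      calc _ = (G * H) * P * (H.transpose * invariantForm * H) := by rw [hGH, Matrix.one_mul]
        _ = _ := by simp only [Matrix.mul_assoc]
    · rintro ⟨_, ⟨P, hP, rfl⟩, rfl⟩
      have h1 := hP.map G
      rw [hG] at h1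
      refine ⟨_, h1, ?_⟩
      calc _ = G * P * (G.transpose * H.transpose) * invariantForm * H := by
            rw [hGH', Matrix.mul_one, ← Matrix.mul_assoc G]
        _ = _ := by simp only [Matrix.mul_assoc]

theorem mainTheorem4 :
    Flat isotropicFamilyHom ∧ IsProper isotropicFamilyHom ∧
    (∀ t : ℂ, familyIdeal t = isotropicIdeal (omegaForm t) ∧
      IsFiberAt isotropicFamilyHom t (projSchemeHom (isotropicIdeal (omegaForm t)))) ∧
    IsFiberAt isotropicFamilyHom 0 GHatHom ∧
    (∀ t : ℂ, t ≠ 0 → (omegaForm t).IsNondegenerate) ∧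
    (∀ ω : FourForm, ω.IsNondegenerate →
      (∀ t : ℂ, t ≠ 0 → IsFiberAt isotropicFamilyHom t (projSchemeHom (isotropicIdeal ω))) ∧
      ∃ C : Set (Matrix (Fin 7) (Fin 7) ℂ), IsAdjointCone ω C ∧
        ∀ t : ℂ, t ≠ 0 → IsFiberAt isotropicFamilyHom t (projSchemeHom (matrixConeIdeal C))) ∧
    ∃ P : Polynomial ℚ, ∀ t : ℂ, IsHilbertPolynomial (isotropicIdeal (omegaForm t)) P := by
  have hrefl (ω : FourForm) : FourFormEquivalent ω ω :=
    ⟨LinearEquiv.refl ℂ V7, by rw [LinearEquiv.refl_toLinearMap, exteriorPower.map_id]; rfl⟩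
  have hfib (t : ℂ) := isFiberAt_of_equivalent (hrefl (omegaForm t))
  refine ⟨flat_isotropicFamilyHom, isProper_isotropicFamilyHom,
    fun t => ⟨familyIdeal_eq_isotropicIdeal t, hfib t⟩, hfib 0,
    fun t ht => omegaForm_isNondegenerate ht, fun ω hω => ?_, familyHilbertPolynomial, fun t => ?_⟩
  · have h1 : FourFormEquivalent (omegaForm 1) ω :=
      equivalent_of_isNondegenerate hω surjective_infinitesimalAction_omegaForm_one
    have ht {t : ℂ} (ht : t ≠ 0) : FourFormEquivalent (omegaForm t) ω :=
      (omegaForm_equivalent ht).symm.trans h1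
    obtain ⟨S, T, hST, hC⟩ := exists_isAdjointCone h1
    exact ⟨fun t h => isFiberAt_of_equivalent (ht h), _, hC,
      fun t h => isFiberAt_matrixConeIdeal (ht h) hST⟩
  · rw [← familyIdeal_eq_isotropicIdeal t]
    exact isHilbertPolynomial_familyIdeal t
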